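/- Let $\mathcal A$ be a set of atomic propositions (finite, or more generally effectively enumerated). A Markov chain is a tuple $M=(S,P,s_0,L)$ with a countable set $S$ of states, transition probabilities $P:S\times S\to[0,1]$ whose rows sum to $1$, an initial state $s_0$, and a labelling $L:S\to 2^{\mathcal A}$. Formulae $\Phi$ of the $\mathbf F_{q/1},\mathbf G_1,\vee$-fragment of probabilistic CTL are given by $$\Phi ::= a\mid\neg a\mid\Phi\wedge\Phi\mid\Phi\vee\Phi\mid\mathbf F_{\rhd q}\Phi\mid\mathbf G_{=1}\Psi,\qquad \Psi ::= a\mid\neg a\mid\Psi\wedge\Psi\mid\Psi\vee\Psi\mid\mathbf F_{=1}\Psi\mid\mathbf G_{=1}\Psi,$$ where $a\in\mathcal A$, $q\in[0,1]\cap\mathbb Q$, $\rhd\in\{\ge,>\}$, and $=1$ abbreviates $\ge 1$. Here $M,s\models\mathbf F_{\rhd q}\varphi$ (resp. $\mathbf G_{\rhd q}\varphi$) means that the probability that a run of $M$ started in $s$ visits some state satisfying $\varphi$ (resp. visits only states satisfying $\varphi$) is $\rhd q$; the other constructs are interpreted as usual. $M$ is a model of $\varphi$ if $M,s_0\models\varphi$;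 $\varphi$ is (finitely) satisfiable if it has a (finite) model. The length $|\varphi|$ is the number of literals, connectives and temporal operators in $\varphi$. A Markov chain has height $h$ if it is a tree with back edges of height $h$: its states form a rooted tree with root $s_0$ whose longest branch has $h$ edges, every tree edge is a transition of positive probability, and every transition of positive probability is either a tree edge or leads from a state to itself or to one of its ancestors. Theorem. 1. There is a computable function $f:\mathbb N\to\mathbb N$ such that every satisfiable formula $\varphi$ of the fragment has a finite model of height at most $|\varphi|^2$ with at most $f(|\varphi|)$ states. 2. A formula of the fragment is satisfiable if and only if it is finitely satisfiable. 3. The satisfiability problem and the finite satisfiability problem for the fragment are decidable: the set of (codes of) satisfiable formulae of the fragment and the set of (codes of) finitely satisfiable formulae of the fragment are computable. -/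

import Mathlib

namespace PCTL

open MeasureTheory ProbabilityTheory

/-! ### Markov chains and their run measures -/

/-- A (discrete-time, labelled) Markov chain over the set `A` of atomic propositions: countably many
states, a stochastic transition matrix (row `s` is the distribution `P s`, so `P s t = P(s,t)`),
an initial state and a labelling of the states by sets of atomic propositions. -/
structure MarkovChain.{u} (A : Type u) where
  S : Type
  countable : Countable S
  P : S → PMF S
  init : S
  L : S → Set A

universe u

namespace MarkovChain

variable {A : Type u} (M : MarkovChain A)

instance : Countable M.S := M.countable

/-- States carry the discrete σ-algebra; as there are countably many, the product σ-algebra on runs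
`ℕ → M.S` is the one generated by the cylinders. -/
instance : MeasurableSpace M.S := ⊤

instance : DiscreteMeasurableSpace M.S := ⟨fun _ => trivial⟩

/-- The transition kernel: given the history up to time `n`, the next state is drawn from the row of
the current state. -/
noncomputable def stepKernel (n : ℕ) : Kernel ((i : Finset.Iic n) → M.S) M.S where
  toFun x := (M.P (x ⟨n, Finset.mem_Iic.2 le_rfl⟩)).toMeasure
  measurable' :=
    (measurable_from_top (f := fun s : M.S => (M.P s).toMeasure)).comp (measurable_pi_apply _)

instance (n : ℕ) : IsMarkovKernel (M.stepKernel n) :=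
  ⟨fun x => PMF.toMeasure.isProbabilityMeasure (M.P (x ⟨n, Finset.mem_Iic.2 le_rfl⟩))⟩

/-- The probability measure on the runs of `M` started in the state `s`. -/
noncomputable def runMeasure (s : M.S) : Measure (ℕ → M.S) :=
  Kernel.traj (X := fun _ => M.S) M.stepKernel 0 (fun _ => s)

instance (s : M.S) : IsProbabilityMeasure (M.runMeasure s) := by
  unfold runMeasure; infer_instance

/-- The run measure is the one determined by the values on cylinders: the cylinder of a finite
path `ρ 0, …, ρ n` has measure `∏_{i < n} P(ρ i, ρ (i+1))` if `ρ 0 = s`, and `0` otherwise. -/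
theorem runMeasure_cylinder (s : M.S) (ρ : ℕ → M.S) (n : ℕ) [Decidable (ρ 0 = s)] :
    M.runMeasure s {π | ∀ i ≤ n, π i = ρ i} =
      if ρ 0 = s then ∏ i ∈ Finset.range n, M.P (ρ i) (ρ (i + 1)) else 0 := by
  have key : ∀ n, Kernel.partialTraj (X := fun _ => M.S) M.stepKernel 0 n (fun _ => s)
      {x | ∀ i, x i = ρ i} =
      if ρ 0 = s then ∏ i ∈ Finset.range n, M.P (ρ i) (ρ (i + 1)) else 0 := by
    intro n
    induction n with
    | zero =>
      rw [Kernel.partialTraj_zero, Kernel.deterministic_apply' _ _ MeasurableSet.of_discrete]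
      by_cases h : ρ 0 = s
      · rw [Set.indicator_of_mem]
        · simp [h]
        · rintro ⟨i, hi⟩
          obtain rfl : i = 0 := by simpa using hi
          exact h.symm
      · rw [Set.indicator_of_notMem]
        · simp [h]
        · intro hm
          exact h (hm ⟨0, by simp⟩).symm
    | succ n ih =>
      have hpre : (IicProdIoc n (n + 1) (X := fun _ => M.S)) ⁻¹' {x | ∀ i, x i = ρ i} =
          {x : (i : Finset.Iic n) → M.S | ∀ i, x i = ρ i} ×ˢ
            {y : (i : Finset.Ioc n (n + 1)) → M.S | ∀ i, y i = ρ i} := by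
        ext ⟨x, y⟩
        simp only [Set.mem_preimage, Set.mem_ofPred_eq, Set.mem_prod, IicProdIoc]
        constructor
        · intro h
          constructor
          · rintro ⟨i, hi⟩
            have hi' := Finset.mem_Iic.1 hi
            simpa [hi'] using h ⟨i, Finset.mem_Iic.2 (by omega)⟩
          · rintro ⟨i, hi⟩
            have hi' := Finset.mem_Ioc.1 hi
            simpa [show ¬ i ≤ n by omega] using h ⟨i, Finset.mem_Iic.2 (by omega)⟩
        · rintro ⟨h₁, h₂⟩ ⟨i, hi⟩
          have hi' := Finset.mem_Iic.1 hi
          by_cases hn : i ≤ n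
          · simpa [hn] using h₁ ⟨i, Finset.mem_Iic.2 hn⟩
          · simpa [hn] using h₂ ⟨i, Finset.mem_Ioc.2 (by omega)⟩
      have hη : ∀ x : (i : Finset.Iic n) → M.S,
          ((M.stepKernel n).map (MeasurableEquiv.piSingleton (X := fun _ => M.S) n)) x
            {y | ∀ i, y i = ρ i} = M.P (x ⟨n, by simp⟩) (ρ (n + 1)) := by
        intro x
        rw [Kernel.map_apply' _ (MeasurableEquiv.measurable _) _ MeasurableSet.of_discrete]
        have : (MeasurableEquiv.piSingleton (X := fun _ => M.S) n) ⁻¹' {y | ∀ i, y i = ρ i} =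
            {ρ (n + 1)} := by
          ext t
          simp only [Set.mem_preimage, Set.mem_ofPred_eq, Set.mem_singleton_iff]
          constructor
          · intro h
            simpa [MeasurableEquiv.piSingleton] using h ⟨n + 1, by simp⟩
          · rintro rfl ⟨i, hi⟩
            obtain rfl : i = n + 1 := by
              have := Finset.mem_Ioc.1 hi
              omega
            simp [MeasurableEquiv.piSingleton]
        rw [this]
        exact PMF.toMeasure_apply_singleton _ _ (MeasurableSet.of_discrete)
      have : IsMarkovKernel
          ((M.stepKernel n).map (MeasurableEquiv.piSingleton (X := fun _ => M.S) n)) :=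
        Kernel.IsMarkovKernel.map _ (MeasurableEquiv.measurable _)
      have hm : Measurable (IicProdIoc n (n + 1) (X := fun _ => M.S)) := measurable_IicProdIoc
      rw [Kernel.partialTraj_succ_of_le (Nat.zero_le n)]
      refine (Kernel.map_apply' _ hm _ MeasurableSet.of_discrete).trans ?_
      rw [hpre, Kernel.comp_apply' _ _ _ (MeasurableSet.of_discrete.prod MeasurableSet.of_discrete)]
      have hint : ∀ x : (i : Finset.Iic n) → M.S,
          (Kernel.id ×ₖ
            (M.stepKernel n).map (MeasurableEquiv.piSingleton (X := fun _ => M.S) n)) x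
            ({x : (i : Finset.Iic n) → M.S | ∀ i, x i = ρ i} ×ˢ
            {y : (i : Finset.Ioc n (n + 1)) → M.S | ∀ i, y i = ρ i}) =
          ({x : (i : Finset.Iic n) → M.S | ∀ i, x i = ρ i}).indicator
            (fun _ => M.P (ρ n) (ρ (n + 1))) x := by
        intro x
        rw [Kernel.prod_apply, Measure.prod_prod, hη, Kernel.id_apply,
          Measure.dirac_apply' _ MeasurableSet.of_discrete]
        by_cases hx : x ∈ {x : (i : Finset.Iic n) → M.S | ∀ i, x i = ρ i}
        · rw [Set.indicator_of_mem hx, Set.indicator_of_mem hx, hx ⟨n, by simp⟩]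
          simp
        · rw [Set.indicator_of_notMem hx, Set.indicator_of_notMem hx, zero_mul]
      rw [lintegral_congr hint, lintegral_indicator MeasurableSet.of_discrete, setLIntegral_const,
        ih, Finset.prod_range_succ]
      split_ifs
      · rw [mul_comm]
      · rw [mul_zero]
  have h := Kernel.traj_map_frestrictLe_apply (X := fun _ => M.S) (κ := M.stepKernel) 0 n
    (fun _ => s)
  rw [← key n, ← h, Measure.map_apply (Preorder.measurable_frestrictLe n)
    (MeasurableSet.of_discrete)]
  congr 1
  ext π
  simp [Preorder.frestrictLe]

/-- The immediate successors of `s`. -/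
def post (s : M.S) : Set M.S := {t | 0 < M.P s t}

/-- `M` is a tree with back edges, given by the function `parent` and the function `depth`: the root
is the initial state, every other state `s` is a successor of its parent and lies one level deeper,
and every transition either is a tree edge or leads back to the source or one of its ancestors.
(The value of `parent` at the root is set to the root itself.) -/
structure IsTreeWithBackEdges (parent : M.S → M.S) (depth : M.S → ℕ) : Prop where
  parent_init : parent M.init = M.init
  depth_init : depth M.init = 0
  mem_post : ∀ s, s ≠ M.init → s ∈ M.post (parent s)
  depth_eq : ∀ s, s ≠ M.init → depth s = depth (parent s) + 1
  edge : ∀ s t, t ∈ M.post s → (t ≠ M.init ∧ parent t = s) ∨ ∃ k : ℕ, parent^[k] s = t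

/-- `M` has height `h`: it is a tree with back edges whose longest branch has `h` (tree) edges. -/
def HasHeight (h : ℕ) : Prop :=
  ∃ (parent : M.S → M.S) (depth : M.S → ℕ), M.IsTreeWithBackEdges parent depth ∧
    (∀ s, depth s ≤ h) ∧ ∃ s, depth s = h

end MarkovChain

/-! ### Formulae -/

/-- The comparisons `≥` and `>`. -/
inductive Comparison where
  | ge
  | gt

/-- `c.Holds x q` is `x ≥ q` or `x > q`. -/
def Comparison.Holds : Comparison → ℝ → ℝ → Prop
  | .ge, x, q => x ≥ q
  | .gt, x, q => x > q

/-- Formulae of PCTL(F, G) in negation normal form, with rational bounds in `[0,1]`. -/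
inductive Formula (A : Type u) where
  | atom (a : A)
  | natom (a : A)
  | and (φ ψ : Formula A)
  | or (φ ψ : Formula A)
  | F (c : Comparison) (q : Set.Icc (0 : ℚ) 1) (φ : Formula A)
  | G (c : Comparison) (q : Set.Icc (0 : ℚ) 1) (φ : Formula A)

namespace Formula

variable {A : Type u}

/-- The length `|φ|`: the number of literals, connectives and temporal operators in `φ`. A negated
proposition counts as one symbol (counting it as two would only enlarge `|φ|`). -/
def length : Formula A → ℕ
  | atom _ => 1
  | natom _ => 1
  | and φ ψ => φ.length + ψ.length + 1
  | or φ ψ => φ.length + ψ.length + 1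
  | F _ _ φ => φ.length + 1
  | G _ _ φ => φ.length + 1

/-- The satisfaction relation `M, s ⊨ φ`. -/
def Sat (M : MarkovChain A) : Formula A → M.S → Prop
  | atom a, s => a ∈ M.L s
  | natom a, s => a ∉ M.L s
  | and φ ψ, s => Sat M φ s ∧ Sat M ψ s
  | or φ ψ, s => Sat M φ s ∨ Sat M ψ s
  | F c q φ, s => c.Holds ((M.runMeasure s).real {π | ∃ i : ℕ, Sat M φ (π i)}) ((q : ℚ) : ℝ)
  | G c q φ, s => c.Holds ((M.runMeasure s).real {π | ∀ i : ℕ, Sat M φ (π i)}) ((q : ℚ) : ℝ)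

/-- The formulae `Ψ` allowed inside a `G`:
`Ψ ::= a | ¬a | Ψ ∧ Ψ | Ψ ∨ Ψ | F_{=1} Ψ | G_{=1} Ψ`, where `=1` stands for `≥ 1`. -/
inductive IsInner : Formula A → Prop
  | atom (a : A) : IsInner (atom a)
  | natom (a : A) : IsInner (natom a)
  | and {φ ψ : Formula A} : IsInner φ → IsInner ψ → IsInner (and φ ψ)
  | or {φ ψ : Formula A} : IsInner φ → IsInner ψ → IsInner (or φ ψ)
  | F {φ : Formula A} : IsInner φ → IsInner (F .ge 1 φ)
  | G {φ : Formula A} : IsInner φ → IsInner (G .ge 1 φ)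

/-- The fragment `F_{q/1}, G_1, ∨`:
`Φ ::= a | ¬a | Φ ∧ Φ | Φ ∨ Φ | F_{▷q} Φ | G_{=1} Ψ`. -/
inductive InFragment : Formula A → Prop
  | atom (a : A) : InFragment (atom a)
  | natom (a : A) : InFragment (natom a)
  | and {φ ψ : Formula A} : InFragment φ → InFragment ψ → InFragment (and φ ψ)
  | or {φ ψ : Formula A} : InFragment φ → InFragment ψ → InFragment (or φ ψ)
  | F (c : Comparison) (q : Set.Icc (0 : ℚ) 1) {φ : Formula A} :
      InFragment φ → InFragment (F c q φ)
  | G {φ : Formula A} : IsInner φ → InFragment (G .ge 1 φ)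

/-- `φ` has a model. -/
def Satisfiable (φ : Formula A) : Prop :=
  ∃ M : MarkovChain A, φ.Sat M M.init

/-- `φ` has a model with finitely many states. -/
def FinitelySatisfiable (φ : Formula A) : Prop :=
  ∃ M : MarkovChain A, Finite M.S ∧ φ.Sat M M.init

end Formula

/-! ### Formulae as inputs of algorithms -/

/-- The code of a comparison. -/
def Comparison.code : Comparison → ℕ
  | .ge => 0
  | .gt => 1

/-- The code of a rational number: numerator and denominator (in lowest terms). -/
def ratCode (q : ℚ) : ℕ := Nat.pair (Encodable.encode q.num) q.den

/-- The Gödel number of a formula. -/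
def Formula.code {A : Type u} [Primcodable A] : Formula A → ℕ
  | .atom a => Nat.pair 0 (Encodable.encode a)
  | .natom a => Nat.pair 1 (Encodable.encode a)
  | .and φ ψ => Nat.pair 2 (Nat.pair φ.code ψ.code)
  | .or φ ψ => Nat.pair 3 (Nat.pair φ.code ψ.code)
  | .F c q φ => Nat.pair 4 (Nat.pair (Nat.pair c.code (ratCode q)) φ.code)
  | .G c q φ => Nat.pair 5 (Nat.pair (Nat.pair c.code (ratCode q)) φ.code)

theorem Comparison.code_injective : Function.Injective Comparison.code := by
  intro c d h; cases c <;> cases d <;> simp_all [Comparison.code]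

theorem ratCode_injective : Function.Injective ratCode := by
  intro p q h
  have h := Nat.pair_eq_pair.1 h
  exact Rat.ext (Encodable.encode_injective h.1) h.2

/-- Different formulae have different Gödel numbers. -/
theorem Formula.code_injective {A : Type u} [Primcodable A] :
    Function.Injective (Formula.code (A := A)) := by
  intro φ
  induction φ with
  | atom a => intro ψ h; cases ψ <;> simp_all [Formula.code, Nat.pair_eq_pair]
  | natom a => intro ψ h; cases ψ <;> simp_all [Formula.code, Nat.pair_eq_pair]
  | and φ₁ φ₂ h₁ h₂ =>
    intro ψ h
    cases ψ <;> simp only [Formula.code, Nat.pair_eq_pair] at h <;> try omega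
    rw [h₁ h.2.1, h₂ h.2.2]
  | or φ₁ φ₂ h₁ h₂ =>
    intro ψ h
    cases ψ <;> simp only [Formula.code, Nat.pair_eq_pair] at h <;> try omega
    rw [h₁ h.2.1, h₂ h.2.2]
  | F c q φ ih =>
    intro ψ h
    cases ψ <;> simp only [Formula.code, Nat.pair_eq_pair] at h <;> try omega
    rw [Comparison.code_injective h.2.1.1, Subtype.ext (ratCode_injective h.2.1.2), ih h.2.2]
  | G c q φ ih =>
    intro ψ h
    cases ψ <;> simp only [Formula.code, Nat.pair_eq_pair] at h <;> try omega
    rw [Comparison.code_injective h.2.1.1, Subtype.ext (ratCode_injective h.2.1.2), ih h.2.2]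

/-- A property of the formulae of the fragment is decidable if the set of the Gödel numbers of the
formulae of the fragment that have the property is decidable by an algorithm. -/
def DecidableOnFragment {A : Type u} [Primcodable A] (p : Formula A → Prop) : Prop :=
  ComputablePred fun n : ℕ => ∃ φ : Formula A, φ.code = n ∧ φ.InFragment ∧ p φ

end PCTL

/-!
A satisfiable formula `φ` of the fragment has a model of a very special shape, a *bundle of lassos*:
finitely many ultimately periodic runs (`Lasso`) with positive weights. The lassos are arranged as a
tree by their common prefixes, and branch only before their cycles. A run that picks a lasso with
probability proportional to its weight and follows it is a run of a finite Markov chain on the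
prefixes (`Bundle.chain`), which is a tree whose back edges lead from the ends of the lassos to the
starts of their cycles (`Bundle.Valid.hasHeight`). The elements of the lassos carry lists of
formulae that they claim. A claim `F q χ` is justified if lassos of sufficient relative weight claim
`χ` later, a claim `G χ` if all later elements claim `χ`. In a bundle all of whose claims are
justified the claims are true (`Bundle.Valid.sat`).

A bundle for `φ` is extracted from an arbitrary countable model (`Extraction.exists_forest`).
Outside the scope of `G`, a true formula rests on finitely many pending goals, namely the arguments
of its operators `F`, each to be reached with some probability. Let the model run until one of these
goals is reached. The distribution of the state in which this happens may have infinite support, but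
by Carathéodory's theorem finitely many branches yield the same probabilities of reaching the
individual goals. Here the convex combination is countable, and in finite dimension it nevertheless
lies in the convex hull (`mem_convexHull_of_hasSum`, `exists_finite_branching`). After each branch a
goal has been reached and is replaced by goals of smaller weight, so that the construction
terminates.

Inside the scope of `G` all operators are qualitative. Hence a branch need not reproduce the path of
the model: it suffices to keep one witness for each `F_{=1} ψ` that holds along the path
(`Extraction.exists_chainOk`). A mass that reaches no further goal is sent to a cycle, which is made
of witnesses that are reachable from a state with a maximal set of true formulae `G ψ`
(`Extraction.exists_terminal`, `Extraction.exists_forest_of_terminal`). If `φ` has `a` operators `F`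
outside the scope of `G` and `b` formulae `F_{=1} ψ` inside, then a lasso has at most
`a (b + 1) + 2 b + 2` elements. As `a + b < |φ|`, the height is at most `|φ| ^ 2`. The number of
branchings is bounded as well, and so is the number of states.

This gives the small models, and with them the equivalence of satisfiability and finite
satisfiability on the fragment. For the decidability it remains to bound the weights. The conditions
on the weights of a bundle form a homogeneous system of linear inequalities with integral
coefficients, so that Fourier–Motzkin elimination yields small positive integral weights
(`Linear.exists_int_solution`). A bundle with integral weights is a finite object, a certificate for
`φ`, whose code is bounded by a primitive recursive function of the code of `φ`
(`Extraction.exists_encode_le`) and whose correctness is a primitive recursive property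
(`Extraction.primrecPred_certifies`). A bounded search for certificates decides satisfiability.
-/

namespace PCTL

open MeasureTheory ProbabilityTheory
open scoped ENNReal

universe u

/-! ### Reachability probabilities -/

namespace MarkovChain

variable {A : Type u} (M : MarkovChain A)

/-- The run that starts in `s` and continues with `π`. -/
def consRun (s : M.S) (π : ℕ → M.S) : ℕ → M.S
  | 0 => s
  | n + 1 => π n

theorem measurable_consRun (s : M.S) : Measurable (M.consRun s) := by
  rw [measurable_pi_iff]
  rintro (_ | n)
  · exact measurable_const
  · exact measurable_pi_apply n

theorem measurableSet_apply_mem (n : ℕ) (T : Set M.S) : MeasurableSet {π : ℕ → M.S | π n ∈ T} :=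
  measurable_pi_apply n (MeasurableSet.of_discrete (s := T))

/-- The cylinders of finite paths. -/
def cylinders : Set (Set (ℕ → M.S)) :=
  {E | ∃ (ρ : ℕ → M.S) (n : ℕ), E = {π | ∀ i ≤ n, π i = ρ i}}

theorem isPiSystem_cylinders : IsPiSystem M.cylinders := by
  rintro _ ⟨ρ, n, rfl⟩ _ ⟨σ, m, rfl⟩ ⟨π, hπ⟩
  refine ⟨π, max n m, ?_⟩
  ext τ
  simp only [Set.mem_inter_iff, Set.mem_ofPred_eq] at hπ ⊢
  constructor
  · rintro ⟨h₁, h₂⟩ i hi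
    rcases le_max_iff.1 hi with h | h
    · rw [h₁ i h, hπ.1 i h]
    · rw [h₂ i h, hπ.2 i h]
  · intro h
    exact ⟨fun i hi => by rw [h i (hi.trans (le_max_left _ _)), hπ.1 i hi],
      fun i hi => by rw [h i (hi.trans (le_max_right _ _)), hπ.2 i hi]⟩

/-- The cylinders generate the product σ-algebra, because there are only countably many states. -/
theorem generateFrom_cylinders :
    (inferInstance : MeasurableSpace (ℕ → M.S)) = MeasurableSpace.generateFrom M.cylinders := by
  apply le_antisymm
  · refine iSup_le fun n => ?_
    rintro _ ⟨B, -, rfl⟩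
    have : (fun π : ℕ → M.S => π n) ⁻¹' B =
        ⋃ x : {x : Fin (n + 1) → M.S // x (Fin.last n) ∈ B},
          {π | ∀ i ≤ n, π i = x.1 ⟨min i n, by omega⟩} := by
      ext π
      simp only [Set.mem_preimage, Set.mem_iUnion, Set.mem_ofPred_eq]
      constructor
      · intro h
        refine ⟨⟨fun i => π i, h⟩, fun i hi => ?_⟩
        simp [hi]
      · rintro ⟨⟨x, hx⟩, h⟩
        rw [h n le_rfl]
        simpa [Fin.last] using hx
    rw [this]
    refine MeasurableSet.iUnion fun x => MeasurableSpace.measurableSet_generateFrom ?_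
    exact ⟨fun i => x.1 ⟨min i n, by omega⟩, n, rfl⟩
  · refine MeasurableSpace.generateFrom_le ?_
    rintro _ ⟨ρ, n, rfl⟩
    have : {π : ℕ → M.S | ∀ i ≤ n, π i = ρ i} =
        ⋂ i, ⋂ (_ : i ≤ n), {π | π i ∈ ({ρ i} : Set M.S)} := by
      ext π; simp
    rw [this]
    exact MeasurableSet.iInter fun i => MeasurableSet.iInter fun _ =>
      M.measurableSet_apply_mem i _

/-- The first step of a run: a run from `s` consists of `s` and a run from a successor of `s`, which
is drawn from the row of `s`. -/
theorem runMeasure_eq_sum (s : M.S) :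
    M.runMeasure s = Measure.sum fun t => M.P s t • (M.runMeasure t).map (M.consRun s) := by
  classical
  have hmap : ∀ (t : M.S) {E : Set (ℕ → M.S)}, MeasurableSet E →
      ((M.runMeasure t).map (M.consRun s)) E = M.runMeasure t (M.consRun s ⁻¹' E) :=
    fun t E hE => Measure.map_apply (M.measurable_consRun s) hE
  refine ext_of_generate_finite M.cylinders M.generateFrom_cylinders M.isPiSystem_cylinders ?_ ?_
  · rintro _ ⟨ρ, n, rfl⟩
    have hE : MeasurableSet {π : ℕ → M.S | ∀ i ≤ n, π i = ρ i} :=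
      M.generateFrom_cylinders.ge _ (MeasurableSpace.measurableSet_generateFrom ⟨ρ, n, rfl⟩)
    rw [runMeasure_cylinder, Measure.sum_apply _ hE]
    simp only [Measure.smul_apply, smul_eq_mul, hmap _ hE]
    by_cases h0 : ρ 0 = s
    · rw [if_pos h0]
      rcases n with _ | n
      · have : ∀ t, M.runMeasure t (M.consRun s ⁻¹' {π | ∀ i ≤ 0, π i = ρ i}) = 1 := by
          intro t
          have : M.consRun s ⁻¹' {π | ∀ i ≤ 0, π i = ρ i} = Set.univ := by
            ext π; simp [h0, consRun]
          rw [this, measure_univ]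
        simp only [this, mul_one, Finset.range_zero, Finset.prod_empty]
        exact (M.P s).tsum_coe.symm
      · have : ∀ t, M.runMeasure t (M.consRun s ⁻¹' {π | ∀ i ≤ n + 1, π i = ρ i}) =
            if ρ 1 = t then ∏ i ∈ Finset.range n, M.P (ρ (i + 1)) (ρ (i + 1 + 1)) else 0 := by
          intro t
          rw [← runMeasure_cylinder M t (fun i => ρ (i + 1)) n]
          congr 1
          ext π
          simp only [Set.mem_preimage, Set.mem_ofPred_eq]
          constructor
          · intro h i hi
            exact h (i + 1) (by omega)
          · rintro h (_ | i) hi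
            · exact h0.symm
            · exact h i (by omega)
        simp only [this]
        rw [tsum_eq_single (ρ 1)]
        · rw [if_pos rfl, Finset.prod_range_succ', mul_comm, h0]
        · intro t ht
          rw [if_neg (Ne.symm ht), mul_zero]
    · rw [if_neg h0]
      symm
      rw [ENNReal.tsum_eq_zero]
      intro t
      have : M.consRun s ⁻¹' {π | ∀ i ≤ n, π i = ρ i} = ∅ := by
        ext π
        simp only [Set.mem_preimage, Set.mem_ofPred_eq, Set.mem_empty_iff_false, iff_false]
        exact fun h => h0 (h 0 (Nat.zero_le _)).symm
      rw [this, measure_empty, mul_zero]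
  · rw [Measure.sum_apply _ MeasurableSet.univ]
    simp only [Measure.smul_apply, smul_eq_mul, hmap _ MeasurableSet.univ, Set.preimage_univ,
      measure_univ, mul_one]
    exact (M.P s).tsum_coe.symm

theorem runMeasure_apply (s : M.S) {E : Set (ℕ → M.S)} (hE : MeasurableSet E) :
    M.runMeasure s E = ∑' t, M.P s t * M.runMeasure t (M.consRun s ⁻¹' E) := by
  conv_lhs => rw [runMeasure_eq_sum, Measure.sum_apply _ hE]
  refine tsum_congr fun t => ?_
  rw [Measure.smul_apply, Measure.map_apply (M.measurable_consRun s) hE, smul_eq_mul]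

/-- The probability that a run from `s` visits `T`. -/
noncomputable def reach (T : Set M.S) (s : M.S) : ℝ≥0∞ :=
  M.runMeasure s {π | ∃ i, π i ∈ T}

/-- The probability that a run from `s` visits `T` within `n` steps. -/
noncomputable def reachWithin (T : Set M.S) (n : ℕ) (s : M.S) : ℝ≥0∞ :=
  M.runMeasure s {π | ∃ i ≤ n, π i ∈ T}

theorem measurableSet_exists_mem (T : Set M.S) : MeasurableSet {π : ℕ → M.S | ∃ i, π i ∈ T} := by
  have : {π : ℕ → M.S | ∃ i, π i ∈ T} = ⋃ i, {π | π i ∈ T} := by ext; simp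
  rw [this]
  exact MeasurableSet.iUnion fun i => M.measurableSet_apply_mem i T

theorem measurableSet_exists_le_mem (T : Set M.S) (n : ℕ) :
    MeasurableSet {π : ℕ → M.S | ∃ i ≤ n, π i ∈ T} := by
  have : {π : ℕ → M.S | ∃ i ≤ n, π i ∈ T} = ⋃ i, ⋃ (_ : i ≤ n), {π | π i ∈ T} := by ext; simp
  rw [this]
  exact MeasurableSet.iUnion fun i => MeasurableSet.iUnion fun _ => M.measurableSet_apply_mem i T

theorem ae_run_zero (s : M.S) : ∀ᵐ π ∂M.runMeasure s, π 0 = s := by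
  classical
  have h := runMeasure_cylinder M s (fun _ => s) 0
  rw [if_pos rfl, Finset.range_zero, Finset.prod_empty] at h
  have := (prob_compl_eq_zero_iff (μ := M.runMeasure s)
    (M.measurableSet_apply_mem 0 {s})).2 (by rw [← h]; congr 1; ext; simp)
  exact this

theorem reach_le_one (T : Set M.S) (s : M.S) : M.reach T s ≤ 1 := prob_le_one

theorem reach_of_mem {T : Set M.S} {s : M.S} (h : s ∈ T) : M.reach T s = 1 := by
  refine le_antisymm prob_le_one ?_
  rw [← measure_univ (μ := M.runMeasure s)]
  refine measure_mono_ae ?_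
  filter_upwards [M.ae_run_zero s] with π hπ _
  exact ⟨0, by rwa [hπ]⟩

theorem reach_of_notMem {T : Set M.S} {s : M.S} (h : s ∉ T) :
    M.reach T s = ∑' t, M.P s t * M.reach T t := by
  unfold reach
  rw [M.runMeasure_apply s (M.measurableSet_exists_mem T)]
  refine tsum_congr fun t => ?_
  congr 2
  ext π
  simp only [Set.mem_preimage, Set.mem_ofPred_eq]
  constructor
  · rintro ⟨_ | i, hi⟩
    · exact absurd hi h
    · exact ⟨i, hi⟩
  · rintro ⟨i, hi⟩
    exact ⟨i + 1, hi⟩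

theorem reachWithin_zero_of_notMem {T : Set M.S} {s : M.S} (h : s ∉ T) :
    M.reachWithin T 0 s = 0 := by
  rw [reachWithin, ← nonpos_iff_eq_zero, ← measure_empty (μ := M.runMeasure s)]
  refine measure_mono_ae ?_
  filter_upwards [M.ae_run_zero s] with π hπ
  rintro ⟨i, hi, hT⟩
  rw [Nat.le_zero.1 hi, hπ] at hT
  exact h hT

theorem reachWithin_succ_of_notMem {T : Set M.S} {s : M.S} (h : s ∉ T) (n : ℕ) :
    M.reachWithin T (n + 1) s = ∑' t, M.P s t * M.reachWithin T n t := by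
  unfold reachWithin
  rw [M.runMeasure_apply s (M.measurableSet_exists_le_mem T _)]
  refine tsum_congr fun t => ?_
  congr 2
  ext π
  simp only [Set.mem_preimage, Set.mem_ofPred_eq]
  constructor
  · rintro ⟨_ | i, hi, hT⟩
    · exact absurd hT h
    · exact ⟨i, by omega, hT⟩
  · rintro ⟨i, hi, hT⟩
    exact ⟨i + 1, by omega, hT⟩

theorem reachWithin_le_reach (T : Set M.S) (n : ℕ) (s : M.S) :
    M.reachWithin T n s ≤ M.reach T s :=
  measure_mono fun _ ⟨i, _, hi⟩ => ⟨i, hi⟩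

theorem reach_eq_iSup (T : Set M.S) (s : M.S) : M.reach T s = ⨆ n, M.reachWithin T n s := by
  have : {π : ℕ → M.S | ∃ i, π i ∈ T} = ⋃ n, {π | ∃ i ≤ n, π i ∈ T} := by
    ext π
    simp only [Set.mem_ofPred_eq, Set.mem_iUnion]
    exact ⟨fun ⟨i, hi⟩ => ⟨i, i, le_rfl, hi⟩, fun ⟨_, i, _, hi⟩ => ⟨i, hi⟩⟩
  rw [reach, this]
  refine Monotone.measure_iUnion ?_
  intro n m hnm π ⟨i, hi, hT⟩
  exact ⟨i, hi.trans hnm, hT⟩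

theorem reach_mono {T T' : Set M.S} (h : T ⊆ T') (s : M.S) : M.reach T s ≤ M.reach T' s :=
  measure_mono fun _ ⟨i, hi⟩ => ⟨i, h hi⟩

theorem toReal_reach_mono {T T' : Set M.S} (h : T ⊆ T') (s : M.S) :
    (M.reach T s).toReal ≤ (M.reach T' s).toReal :=
  ENNReal.toReal_mono (ne_top_of_le_ne_top ENNReal.one_ne_top (M.reach_le_one T' s))
    (M.reach_mono h s)

/-- `t` is reachable from `s` by transitions of positive probability. -/
def Reachable : M.S → M.S → Prop := Relation.ReflTransGen fun s t => t ∈ M.post s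

theorem reach_eq_zero_of_forall {T : Set M.S} {s : M.S} (h : ∀ t, M.Reachable s t → t ∉ T) :
    M.reach T s = 0 := by
  have key : ∀ n s, (∀ t, M.Reachable s t → t ∉ T) → M.reachWithin T n s = 0 := by
    intro n
    induction n with
    | zero => exact fun s hs => M.reachWithin_zero_of_notMem (hs s .refl)
    | succ n ih =>
      intro s hs
      rw [M.reachWithin_succ_of_notMem (hs s .refl), ENNReal.tsum_eq_zero]
      intro t
      by_cases ht : M.P s t = 0
      · rw [ht, zero_mul]
      · rw [ih t fun u hu => hs u (.head (pos_iff_ne_zero.2 ht) hu), mul_zero]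
  rw [reach_eq_iSup]
  simp [key _ s h]

theorem reach_ne_zero_of_reachable {T : Set M.S} {s t : M.S} (h : M.Reachable s t) (ht : t ∈ T) :
    M.reach T s ≠ 0 := by
  induction h using Relation.ReflTransGen.head_induction_on with
  | refl => rw [M.reach_of_mem ht]; exact one_ne_zero
  | @head a b hab _ ih =>
    by_cases ha : a ∈ T
    · rw [M.reach_of_mem ha]; exact one_ne_zero
    · rw [M.reach_of_notMem ha]
      exact fun h0 => mul_ne_zero (pos_iff_ne_zero.1 hab) ih (ENNReal.tsum_eq_zero.1 h0 b)

theorem reach_ne_zero_iff {T : Set M.S} {s : M.S} :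
    M.reach T s ≠ 0 ↔ ∃ t, M.Reachable s t ∧ t ∈ T := by
  constructor
  · intro h
    by_contra! hc
    exact h (M.reach_eq_zero_of_forall hc)
  · rintro ⟨t, h, ht⟩
    exact M.reach_ne_zero_of_reachable h ht

/-- Almost sure reachability of `T` is inherited by successors as long as `T` is not visited. -/
theorem reach_eq_one_of_post {T : Set M.S} {s t : M.S} (h : M.reach T s = 1) (hs : s ∉ T)
    (ht : t ∈ M.post s) : M.reach T t = 1 := by
  refine le_antisymm (M.reach_le_one T t) ?_
  by_contra! hlt
  have h1 : ∑' u, M.P s u * M.reach T u = 1 := by rw [← M.reach_of_notMem hs, h]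
  have h2 : ∑' u, M.P s u * M.reach T u < ∑' u, M.P s u := by
    refine ENNReal.tsum_lt_tsum (i := t) ?_ (fun u => ?_) ?_
    · rw [h1]; exact ENNReal.one_ne_top
    · exact mul_le_of_le_one_right (zero_le) (M.reach_le_one T u)
    · conv_rhs => rw [← mul_one (M.P s t)]
      exact ENNReal.mul_lt_mul_right (pos_iff_ne_zero.1 ht) ((M.P s).apply_ne_top t) hlt
  rw [h1, (M.P s).tsum_coe] at h2
  exact lt_irrefl _ h2

/-- A run from `s` stays in `T` almost surely if and only if all states reachable from `s` lie
in `T`. -/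
theorem runMeasure_forall_mem_eq_one_iff {T : Set M.S} {s : M.S} :
    M.runMeasure s {π | ∀ i, π i ∈ T} = 1 ↔ ∀ t, M.Reachable s t → t ∈ T := by
  have hc : {π : ℕ → M.S | ∀ i, π i ∈ T} = {π | ∃ i, π i ∈ Tᶜ}ᶜ := by
    ext π; simp
  rw [hc, prob_compl_eq_one_iff (M.measurableSet_exists_mem Tᶜ)]
  change M.reach Tᶜ s = 0 ↔ _
  rw [← not_iff_not, ← ne_eq, M.reach_ne_zero_iff]
  simp

/-- The probability that `x` is the first state of `X` on a run from `s`. -/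
noncomputable def exitProb (X : Set M.S) (s x : M.S) : ℝ≥0∞ :=
  M.runMeasure s {π | ∃ i, (π i ∈ X ∧ π i = x) ∧ ∀ k < i, π k ∉ X}

theorem measurableSet_exit (X : Set M.S) (x : M.S) :
    MeasurableSet {π : ℕ → M.S | ∃ i, (π i ∈ X ∧ π i = x) ∧ ∀ k < i, π k ∉ X} := by
  have : {π : ℕ → M.S | ∃ i, (π i ∈ X ∧ π i = x) ∧ ∀ k < i, π k ∉ X} =
      ⋃ i, ({π | π i ∈ X ∩ {x}} ∩ ⋂ k, ⋂ (_ : k < i), {π | π k ∈ Xᶜ}) := by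
    ext π; simp
  rw [this]
  exact MeasurableSet.iUnion fun i => (M.measurableSet_apply_mem i _).inter
    (MeasurableSet.iInter fun k => MeasurableSet.iInter fun _ => M.measurableSet_apply_mem k _)

theorem tsum_exitProb_le_one (X : Set M.S) (s : M.S) : ∑' x, M.exitProb X s x ≤ 1 := by
  unfold exitProb
  rw [← measure_iUnion]
  · exact prob_le_one
  · intro x y hxy
    rw [Function.onFun, Set.disjoint_left]
    rintro π ⟨i, ⟨hi, rfl⟩, hi'⟩ ⟨j, ⟨hj, rfl⟩, hj'⟩
    rcases lt_trichotomy i j with h | h | h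
    · exact hj' i h hi
    · exact hxy (by rw [h])
    · exact hi' j h hj
  · exact fun x => M.measurableSet_exit X x

theorem exitProb_of_mem {X : Set M.S} {s : M.S} (h : s ∈ X) : M.exitProb X s s = 1 := by
  refine le_antisymm prob_le_one ?_
  rw [← measure_univ (μ := M.runMeasure s)]
  refine measure_mono_ae ?_
  filter_upwards [M.ae_run_zero s] with π hπ _
  exact ⟨0, ⟨by rwa [hπ], hπ⟩, by simp⟩

theorem exitProb_of_notMem {X : Set M.S} {s : M.S} (h : s ∉ X) (x : M.S) :
    M.exitProb X s x = ∑' t, M.P s t * M.exitProb X t x := by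
  unfold exitProb
  rw [M.runMeasure_apply s (M.measurableSet_exit X x)]
  refine tsum_congr fun t => ?_
  congr 2
  ext π
  simp only [Set.mem_preimage, Set.mem_ofPred_eq]
  constructor
  · rintro ⟨_ | i, hi, hk⟩
    · exact absurd hi.1 h
    · exact ⟨i, hi, fun k hki => hk (k + 1) (by omega)⟩
  · rintro ⟨i, hi, hk⟩
    refine ⟨i + 1, hi, ?_⟩
    rintro (_ | k) hki
    · exact h
    · exact hk k (by omega)

theorem exitProb_ne_zero {X : Set M.S} {s x : M.S} (h : M.exitProb X s x ≠ 0) :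
    x ∈ X ∧ M.Reachable s x := by
  have h1 : M.reach (X ∩ {x}) s ≠ 0 := by
    intro h0
    refine h (le_antisymm (le_trans (measure_mono ?_) h0.le) (zero_le))
    rintro π ⟨i, hi, _⟩
    exact ⟨i, hi⟩
  obtain ⟨t, ht, hX, rfl⟩ := M.reach_ne_zero_iff.1 h1
  exact ⟨hX, ht⟩

/-- The probability of visiting `T ⊆ X` is the mean, over the first visited state of `X`, of the
probability of visiting `T` from there (only `≤` is needed). -/
theorem reach_le_tsum_exitProb {T X : Set M.S} (hT : T ⊆ X) (s : M.S) :
    M.reach T s ≤ ∑' x, M.exitProb X s x * M.reach T x := by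
  have hX : ∀ s ∈ X, M.reach T s ≤ ∑' x, M.exitProb X s x * M.reach T x := by
    intro s hs
    refine le_trans ?_ (ENNReal.le_tsum s)
    rw [M.exitProb_of_mem hs, one_mul]
  rw [reach_eq_iSup]
  refine iSup_le fun n => ?_
  induction n generalizing s with
  | zero =>
    by_cases hs : s ∈ X
    · exact (M.reachWithin_le_reach T 0 s).trans (hX s hs)
    · rw [M.reachWithin_zero_of_notMem fun h => hs (hT h)]
      exact zero_le
  | succ n ih =>
    by_cases hs : s ∈ X
    · exact (M.reachWithin_le_reach T _ s).trans (hX s hs)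
    · rw [M.reachWithin_succ_of_notMem fun h => hs (hT h)]
      calc ∑' t, M.P s t * M.reachWithin T n t
          ≤ ∑' t, M.P s t * ∑' x, M.exitProb X t x * M.reach T x := by
            gcongr with t
            exact ih t
        _ = ∑' x, M.exitProb X s x * M.reach T x := by
            simp_rw [← ENNReal.tsum_mul_left]
            rw [ENNReal.tsum_comm]
            refine tsum_congr fun x => ?_
            rw [M.exitProb_of_notMem hs, ← ENNReal.tsum_mul_right]
            simp_rw [mul_assoc]

end MarkovChain

theorem Formula.sat_F_iff {A : Type u} {M : MarkovChain A} {c : Comparison}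
    {q : Set.Icc (0 : ℚ) 1} {φ : Formula A} {s : M.S} :
    (Formula.F c q φ).Sat M s ↔ c.Holds (M.reach {t | φ.Sat M t} s).toReal ((q : ℚ) : ℝ) := Iff.rfl

/-- Staying in a set almost surely depends only on the transitions of positive probability. -/
theorem Formula.sat_G_iff {A : Type u} {M : MarkovChain A} {φ : Formula A} {s : M.S} :
    (Formula.G .ge 1 φ).Sat M s ↔ ∀ t, M.Reachable s t → φ.Sat M t := by
  refine Iff.trans ?_
    (MarkovChain.runMeasure_forall_mem_eq_one_iff M (T := {t | φ.Sat M t}) (s := s))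
  change ((M.runMeasure s).real {π | ∀ i, φ.Sat M (π i)}) ≥ (((1 : Set.Icc (0 : ℚ) 1) : ℚ) : ℝ) ↔
    M.runMeasure s {π | ∀ i, φ.Sat M (π i)} = 1
  rw [Set.Icc.coe_one, Rat.cast_one, Measure.real]
  constructor
  · intro h
    refine le_antisymm prob_le_one ?_
    rwa [ge_iff_le, ← ENNReal.toReal_one, ENNReal.toReal_le_toReal ENNReal.one_ne_top
      (measure_ne_top _ _)] at h
  · intro h
    rw [h, ENNReal.toReal_one]

theorem Formula.IsInner.inFragment {A : Type u} {ψ : Formula A} (h : ψ.IsInner) : ψ.InFragment := by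
  induction h with
  | atom a => exact .atom a
  | natom a => exact .natom a
  | and _ _ h₁ h₂ => exact .and h₁ h₂
  | or _ _ h₁ h₂ => exact .or h₁ h₂
  | F _ h => exact .F _ _ h
  | G h _ => exact .G h

/-! ### Countable convex combinations in finite dimension -/

/-- In a finite-dimensional space a countable convex combination lies in the convex hull. No closure
is needed: a finite set of the vectors spans the space of all of them, and a small change of its
coefficients absorbs the tail of the series. -/
theorem mem_convexHull_of_hasSum {X E : Type*} [NormedAddCommGroup E] [NormedSpace ℝ E]
    [FiniteDimensional ℝ E] {e : X → ℝ} {f : X → E} {y : E} (he : ∀ x, 0 ≤ e x)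
    (h1 : HasSum e 1) (hy : HasSum (fun x => e x • f x) y) :
    y ∈ convexHull ℝ (f '' {x | e x ≠ 0}) := by
  classical
  -- the additional coordinate `1` turns convex combinations into linear ones
  set g : X → E × ℝ := fun x => (f x, 1) with hg
  set s : Set X := {x | e x ≠ 0} with hs
  have hgs : HasSum (fun x => e x • g x) (y, 1) := by
    have := hy.prodMk h1
    simpa [hg] using this
  -- a finite set `F` of indices spans
  obtain ⟨F, hFs, hFspan⟩ : ∃ F : Finset X, (F : Set X) ⊆ s ∧
      Submodule.span ℝ (g '' s) = Submodule.span ℝ (g '' (F : Set X)) := by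
    have hfg : (Submodule.span ℝ (g '' s)).FG := IsNoetherian.noetherian _
    obtain ⟨G, hG, hGspan⟩ := (Submodule.fg_span_iff_fg_span_finset_subset _).1 hfg
    obtain ⟨F, hF, hFG⟩ := Finset.subset_set_image_iff.1 hG
    refine ⟨F, hF, ?_⟩
    rw [hGspan, ← hFG, Finset.coe_image]
  set V := Submodule.span ℝ (g '' s) with hV
  have hgV : ∀ x, e x • g x ∈ V := by
    intro x
    by_cases hx : e x = 0
    · rw [hx, zero_smul]; exact V.zero_mem
    · exact V.smul_mem _ (Submodule.subset_span ⟨x, hx, rfl⟩)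
  -- the linear map that sends coefficients on `F` to combinations
  have hgF : ∀ x : F, g x ∈ V := fun x => Submodule.subset_span ⟨x, hFs x.2, rfl⟩
  let L : (F → ℝ) →ₗ[ℝ] V := Fintype.linearCombination ℝ (fun x : F => (⟨g x, hgF x⟩ : V))
  have hLapp : ∀ c : F → ℝ, ((L c : V) : E × ℝ) = ∑ x : F, c x • g x := by
    intro c
    simp [L, Fintype.linearCombination_apply]
  have hL : Function.Surjective L := by
    rintro ⟨v, hv⟩
    have : v ∈ Submodule.span ℝ (Set.range fun x : F => g x) := by
      convert (hFspan ▸ hv : v ∈ Submodule.span ℝ (g '' (F : Set X))) using 2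
      ext; simp
    obtain ⟨c, hc⟩ := (Submodule.mem_span_range_iff_exists_fun ℝ).1 this
    exact ⟨c, Subtype.ext (by rw [hLapp]; exact hc)⟩
  have hopen : IsOpenMap L := L.isOpenMap_of_finiteDimensional hL
  -- the changes of the coefficients on `F` that keep these positive
  let B : Set (F → ℝ) := {c | ∀ x : F, -e x < c x}
  have hB : IsOpen B := by
    have : B = ⋂ x : F, {c | -e x < c x} := by ext; simp [B]
    rw [this]
    exact isOpen_iInter_of_finite fun x => isOpen_lt continuous_const (continuous_apply x)
  have hB0 : (0 : F → ℝ) ∈ B := by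
    intro x
    have : 0 < e x := lt_of_le_of_ne (he x) (Ne.symm (hFs x.2))
    simpa using this
  have hLB : L '' B ∈ nhds (0 : V) :=
    (hopen B hB).mem_nhds ⟨0, hB0, map_zero L⟩
  -- the tails of the series lie in `V` and tend to `0`; a small one comes from a change in `B`
  have hyV : ((y, 1) : E × ℝ) ∈ V := by
    have hclosed : IsClosed (V : Set (E × ℝ)) := V.closed_of_finiteDimensional
    exact hclosed.mem_of_tendsto hgs
      (Filter.Eventually.of_forall fun G => V.sum_mem fun x _ => hgV x)
  let tail : Finset X → V := fun G =>
    ⟨(y, 1) - ∑ x ∈ G, e x • g x, V.sub_mem hyV (V.sum_mem fun x _ => hgV x)⟩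
  have htail : Filter.Tendsto tail Filter.atTop (nhds 0) := by
    rw [tendsto_subtype_rng]
    have := (tendsto_const_nhds (x := ((y, 1) : E × ℝ))).sub hgs
    simpa using this
  obtain ⟨G, hFG, hG⟩ : ∃ G : Finset X, F ⊆ G ∧ tail G ∈ L '' B := by
    have h := htail.eventually hLB
    obtain ⟨G₀, hG₀⟩ := Filter.eventually_atTop.1 h
    exact ⟨F ∪ G₀, Finset.subset_union_left, hG₀ _ Finset.subset_union_right⟩
  obtain ⟨c, hcB, hc⟩ := hG
  -- the new coefficients
  let d : X → ℝ := fun x => e x + if h : x ∈ F then c ⟨x, h⟩ else 0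
  have hsum : ∑ x ∈ G, d x • g x = (y, 1) := by
    have h2 : ∑ x ∈ G, (if h : x ∈ F then c ⟨x, h⟩ else 0) • g x = ∑ x : F, c x • g x := by
      rw [← Finset.sum_subset hFG, ← Finset.sum_coe_sort F]
      · refine Finset.sum_congr rfl fun x _ => ?_
        rw [dif_pos x.2]
      · intro x _ hx
        rw [dif_neg hx, zero_smul]
    have h3 : ((tail G : V) : E × ℝ) = ∑ x : F, c x • g x := by rw [← hc, hLapp]
    simp only [d, add_smul, Finset.sum_add_distrib, h2, ← h3, tail]
    abel
  have hd0 : ∀ x, 0 ≤ d x := by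
    intro x
    by_cases h : x ∈ F
    · have := hcB ⟨x, h⟩
      simp only [d, dif_pos h]
      linarith
    · simp only [d, dif_neg h, add_zero]
      exact he x
  have hds : ∀ x, x ∉ s → d x = 0 := by
    intro x hx
    have hF : x ∉ F := fun h => hx (hFs h)
    have : e x = 0 := not_not.1 hx
    simp [d, hF, this]
  have hfst : ∑ x ∈ G, d x • f x = y := by
    have := congrArg Prod.fst hsum
    simpa [hg, Prod.fst_sum] using this
  have hsnd : ∑ x ∈ G, d x = 1 := by
    have := congrArg Prod.snd hsum
    simpa [hg, Prod.snd_sum] using this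
  rw [← hfst, ← Finset.sum_filter_of_ne (p := fun x => x ∈ s)]
  · refine (convex_convexHull ℝ _).sum_mem (fun x _ => hd0 x) ?_ fun x hx =>
      subset_convexHull ℝ _ ⟨x, (Finset.mem_filter.1 hx).2, rfl⟩
    rw [← hsnd, Finset.sum_filter_of_ne]
    intro x _ hx
    by_contra h
    exact hx (hds x h)
  · intro x _ hx
    by_contra h
    exact hx (by rw [hds x h, zero_smul])

/-- A subprobability distribution `e` on exits with values `v x ∈ [0,1]^U` can be thinned out to at
most `|U| + 1` branches without lowering the mean of any coordinate; the mass that does not exit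
shows up as a branch `none` of value `0`. -/
theorem exists_finite_branching {X U : Type*} [Fintype U] (e : X → ℝ≥0∞) (he : ∑' x, e x ≤ 1)
    (v : U → X → ℝ≥0∞) (hv : ∀ j x, v j x ≤ 1) :
    ∃ (k : ℕ) (x : Fin k → Option X) (l : Fin k → ℝ), k ≤ Fintype.card U + 1 ∧ (∀ b, 0 < l b) ∧
      ∑ b, l b = 1 ∧ (∀ b y, x b = some y → e y ≠ 0) ∧
      ∀ j, (∑' x, e x * v j x).toReal ≤ ∑ b, l b * ((x b).elim 0 fun y => (v j y).toReal) := by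
  classical
  have hne : ∑' x, e x ≠ ∞ := ne_top_of_le_ne_top ENNReal.one_ne_top he
  -- the missing mass is assigned to `none`, so that the coefficients add up to `1`
  let e' : Option X → ℝ := fun o => o.elim (1 - ∑' x, e x).toReal fun x => (e x).toReal
  let f : Option X → (U → ℝ) := fun o j => o.elim 0 fun x => (v j x).toReal
  have hsome : HasSum (fun x => (e x).toReal) (∑' x, e x).toReal := by
    rw [ENNReal.tsum_toReal_eq fun x => ne_top_of_le_ne_top hne (ENNReal.le_tsum x)]
    exact (ENNReal.summable_toReal hne).hasSum
  have hopt : ∀ {g : Option X → ℝ} {a : ℝ},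
      HasSum (fun x => g (some x)) a → HasSum g (g none + a) := by
    intro g a h
    have h2 : HasSum (fun o : Option X => o.elim 0 fun x => g (some x)) a :=
      ((Option.some_injective X).hasSum_iff (by
        rintro (_ | x) hx
        · rfl
        · exact absurd ⟨x, rfl⟩ hx)).1 h
    have h1 : HasSum (fun o : Option X => o.elim (g none) fun _ => 0) (g none) := by
      have := hasSum_single (f := fun o : Option X => o.elim (g none) fun _ => (0 : ℝ)) none (by
        rintro (_ | x) hx
        · exact absurd rfl hx
        · rfl)
      simpa using this
    convert h1.add h2 using 1
    ext o
    cases o <;> simp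
  have h1 : HasSum e' 1 := by
    have := hopt (g := e') hsome
    convert this using 1
    change 1 = (1 - ∑' x, e x).toReal + (∑' x, e x).toReal
    rw [← ENNReal.toReal_add (ne_top_of_le_ne_top ENNReal.one_ne_top tsub_le_self) hne,
      tsub_add_cancel_of_le he, ENNReal.toReal_one]
  have hle : ∀ j, ∑' x, e x * v j x ≤ 1 := fun j =>
    (ENNReal.tsum_le_tsum fun x => mul_le_of_le_one_right (zero_le) (hv j x)).trans he
  have hy : HasSum (fun o => e' o • f o) fun j => (∑' x, e x * v j x).toReal := by
    rw [Pi.hasSum]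
    intro j
    have hs : HasSum (fun x => (e x * v j x).toReal) (∑' x, e x * v j x).toReal := by
      have hne' : ∑' x, e x * v j x ≠ ∞ := ne_top_of_le_ne_top ENNReal.one_ne_top (hle j)
      rw [ENNReal.tsum_toReal_eq fun x => ne_top_of_le_ne_top hne' (ENNReal.le_tsum x)]
      exact (ENNReal.summable_toReal hne').hasSum
    have := hopt (g := fun o => (e' o • f o) j) (a := (∑' x, e x * v j x).toReal) (by
      simpa [e', f] using hs)
    simpa [e', f] using this
  have hmem := mem_convexHull_of_hasSum (e := e') (f := f) (by
    rintro (_ | x)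
    · exact ENNReal.toReal_nonneg
    · exact ENNReal.toReal_nonneg) h1 hy
  obtain ⟨ι, hι, z, w, hz, hind, hw, hw1, hsum⟩ := eq_pos_convex_span_of_mem_convexHull hmem
  have hcard : Fintype.card ι ≤ Fintype.card U + 1 := by
    refine hind.card_le_finrank_succ.trans ?_
    have := Submodule.finrank_le (vectorSpan ℝ (Set.range z))
    rw [Module.finrank_pi] at this
    omega
  choose o ho hoz using fun i : ι => hz ⟨i, rfl⟩
  let eqv := Fintype.equivFin ι
  refine ⟨Fintype.card ι, fun b => o (eqv.symm b), fun b => w (eqv.symm b), hcard,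
    fun b => hw _, ?_, ?_, ?_⟩
  · rw [← hw1]
    exact Equiv.sum_comp eqv.symm w
  · intro b y hb h0
    change o (eqv.symm b) = some y at hb
    have h2 := ho (eqv.symm b)
    rw [Set.mem_ofPred_eq, hb] at h2
    exact h2 (by simp [e', h0])
  · intro j
    have h2 := congrFun hsum j
    rw [← h2, Finset.sum_apply, ← Equiv.sum_comp eqv.symm]
    refine le_of_eq (Finset.sum_congr rfl fun b _ => ?_)
    rw [Pi.smul_apply, smul_eq_mul, ← hoz]

/-! ### Weighted bundles of lassos -/

/-- An ultimately periodic run: the finite path `stem`, followed by `cyc` repeated forever. -/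
structure Lasso (α : Type) where
  stem : List α
  cyc : List α

namespace Lasso

variable {α : Type}

/-- The positions of the lasso, in the order in which they are visited first. -/
def full (p : Lasso α) : List α := p.stem ++ p.cyc

/-- The positions that are visited at the time `d` or later. -/
def fut (p : Lasso α) (d : ℕ) : List α := p.stem.drop d ++ p.cyc

/-- `q` agrees with `p` up to the position `d`, that is, `q` passes through the tree node formed
by the first `d + 1` positions of `p`. -/
def Through (p : Lasso α) (d : ℕ) (q : Lasso α) : Prop := p.full.take (d + 1) <+: q.full

/-- From the start of the cycle on, exactly the elements of the cycle are visited. -/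
theorem fut_of_le {p : Lasso α} {d : ℕ} (h : p.stem.length ≤ d) : p.fut d = p.cyc := by
  simp [fut, List.drop_eq_nil_of_le h]

theorem fut_succ_subset (p : Lasso α) (d : ℕ) : p.fut (d + 1) ⊆ p.fut d := by
  intro y hy
  simp only [fut, List.mem_append] at hy ⊢
  refine hy.imp_left fun h => ?_
  exact (List.drop_sublist_drop_left p.stem (Nat.le_succ d)).subset h

theorem mem_fut_of_getElem? {p : Lasso α} {d : ℕ} {x : α} (h : p.full[d]? = some x) :
    x ∈ p.fut d := by
  simp only [fut, full, List.mem_append] at h ⊢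
  rcases lt_or_ge d p.stem.length with hd | hd
  · left
    rw [List.getElem?_append_left hd] at h
    rw [← Nat.add_zero d, ← List.getElem?_drop] at h
    exact List.mem_of_getElem? h
  · right
    rw [List.getElem?_append_right hd] at h
    exact List.mem_of_getElem? h

theorem mem_fut_succ {p : Lasso α} {d : ℕ} {x y : α} (h : p.full[d]? = some x)
    (hy : y ∈ p.fut d) (hne : y ≠ x) : y ∈ p.fut (d + 1) := by
  rcases lt_or_ge d p.stem.length with hd | hd
  · simp only [fut, full, List.mem_append] at h hy ⊢
    refine hy.imp_left fun hy => ?_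
    rw [List.getElem?_append_left hd, List.getElem?_eq_getElem hd, Option.some_inj] at h
    rw [List.drop_eq_getElem_cons hd, List.mem_cons, h] at hy
    exact hy.resolve_left hne
  · rw [fut_of_le hd] at hy
    rwa [fut_of_le (hd.trans (Nat.le_succ d))]

theorem stem_length_lt {p : Lasso α} (h : p.cyc ≠ []) : p.stem.length < p.full.length := by
  rw [full, List.length_append]
  have := List.length_pos_iff.2 h
  omega

end Lasso

namespace Bundle

variable {A : Type u} {α ι : Type}

open Classical in
/-- The weight of the indices that satisfy `P`. -/
noncomputable def massOf [Fintype ι] (w : ι → ℝ) (P : ι → Prop) : ℝ := ∑ j with P j, w j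

theorem massOf_congr [Fintype ι] {w : ι → ℝ} {P Q : ι → Prop} (h : ∀ j, P j ↔ Q j) :
    massOf w P = massOf w Q := by
  rw [show P = Q from funext fun j => propext (h j)]

theorem massOf_mono [Fintype ι] {w : ι → ℝ} {P Q : ι → Prop} (hw : ∀ i, 0 < w i)
    (h : ∀ j, P j → Q j) : massOf w P ≤ massOf w Q := by
  classical
  refine Finset.sum_le_sum_of_subset_of_nonneg ?_ fun i _ _ => (hw i).le
  intro j
  simpa using h j

theorem massOf_of_forall [Fintype ι] {w : ι → ℝ} {P : ι → Prop} (h : ∀ j, P j) :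
    massOf w P = ∑ j, w j := by
  classical
  simp [massOf, h]

theorem massOf_nonneg [Fintype ι] {w : ι → ℝ} (hw : ∀ i, 0 < w i) (P : ι → Prop) :
    0 ≤ massOf w P :=
  Finset.sum_nonneg fun i _ => (hw i).le

/-- The weight of the lassos through the node `d` of `q`. -/
noncomputable def passMass [Fintype ι] (w : ι → ℝ) (p : ι → Lasso α) (q : Lasso α) (d : ℕ) : ℝ :=
  massOf w fun j => q.Through d (p j)

/-- The weight of the lassos through the node `d` of `q` that visit `Q` at this node or later. -/
noncomputable def hitMass [Fintype ι] (w : ι → ℝ) (p : ι → Lasso α) (q : Lasso α) (d : ℕ)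
    (Q : α → Prop) : ℝ :=
  massOf w fun j => q.Through d (p j) ∧ ∃ y ∈ (p j).fut d, Q y

/-- The condition that the claim `χ`, made at the position `d` of the lasso `q` by its element `x`,
imposes on the bundle `(w, p)`; `C y` is the set of formulae that the element `y` claims. The runs
that pass through a node continue along the lassos through it with probabilities proportional to
their weights. -/
noncomputable def ClaimOk [Fintype ι] (C : α → Set (Formula A)) (w : ι → ℝ) (p : ι → Lasso α)
    (q : Lasso α) (d : ℕ) (x : α) : Formula A → Prop
  | .atom a => Formula.natom a ∉ C x
  | .natom a => Formula.atom a ∉ C x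
  | .and φ ψ => φ ∈ C x ∧ ψ ∈ C x
  | .or φ ψ => φ ∈ C x ∨ ψ ∈ C x
  | .F c b φ => c.Holds (hitMass w p q d fun y => φ ∈ C y) (((b : ℚ) : ℝ) * passMass w p q d)
  | .G _ _ φ => ∀ y ∈ q.fut d, φ ∈ C y

/-- A weighted family of lassos, arranged as a tree by common prefixes, that branches only before
the cycles and in which every claim of an element is justified. The field `nonbranching` says that a
lasso through the first node of a cycle is the lasso of this cycle; the same lasso may occur more
than once in the family. -/
structure Valid [Fintype ι] (C : α → Set (Formula A)) (w : ι → ℝ) (p : ι → Lasso α) : Prop where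
  w_pos : ∀ i, 0 < w i
  cyc_ne : ∀ i, (p i).cyc ≠ []
  nonbranching : ∀ i j, (p i).Through (p i).stem.length (p j) → p j = p i
  claims : ∀ i d x, (p i).full[d]? = some x → ∀ χ ∈ C x, ClaimOk C w p (p i) d x χ

/-! ### The Markov chain of a bundle -/

/-- A condition on weights becomes a condition on probabilities after division by the weight `m` of
the node. -/
theorem _root_.PCTL.Comparison.holds_of_mul {c : Comparison} {x r q m : ℝ} (h : c.Holds x (q * m))
    (hx : x ≤ m * r) (hm : 0 < m) : c.Holds r q := by
  cases c with
  | ge =>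
    have : q * m ≤ m * r := le_trans h hx
    rw [mul_comm] at this
    exact le_of_mul_le_mul_left this hm
  | gt =>
    have : q * m < m * r := lt_of_lt_of_le h hx
    rw [mul_comm] at this
    exact lt_of_mul_lt_mul_left this hm.le

/-- The nodes of the tree formed by the lassos: their nonempty prefixes. -/
@[ext]
structure Node (p : ι → Lasso α) : Type where
  val : List α
  ne_nil : val ≠ []
  exists_prefix : ∃ i, val <+: (p i).full

variable {C : α → Set (Formula A)} {w : ι → ℝ} {p : ι → Lasso α}

theorem Node.length_pos (u : Node p) : 0 < u.1.length := List.length_pos_iff.2 u.2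

/-- The node that follows `u` along the lasso `p j`; after the last element of the lasso, this is
the node at the start of the cycle. -/
def nextList (p : ι → Lasso α) (u : List α) (j : ι) : List α :=
  if u.length < (p j).full.length then (p j).full.take (u.length + 1)
  else (p j).full.take ((p j).stem.length + 1)

open Classical in
/-- The node that follows `u` along the lasso `p j`, if this lasso passes through `u` (otherwise the
node `u` itself). -/
noncomputable def step (u : Node p) (j : ι) : Node p :=
  if h : u.1 <+: (p j).full then
    { val := nextList p u.1 j
      ne_nil := by
        have h0 : 0 < (p j).full.length := lt_of_lt_of_le u.length_pos h.length_le
        unfold nextList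
        split_ifs <;> rw [← List.length_pos_iff, List.length_take] <;> omega
      exists_prefix := by
        refine ⟨j, ?_⟩
        unfold nextList
        split_ifs <;> exact List.take_prefix _ _ }
  else u

/-- The weight of the lassos through a node. -/
noncomputable def nodeMass [Fintype ι] (w : ι → ℝ) (u : Node p) : ℝ :=
  massOf w fun j => u.1 <+: (p j).full

theorem nodeMass_pos [Fintype ι] (hw : ∀ i, 0 < w i) (u : Node p) : 0 < nodeMass w u := by
  classical
  obtain ⟨i, hi⟩ := u.3
  exact Finset.sum_pos (fun j _ => hw j) ⟨i, by simpa using hi⟩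

open Classical in
/-- The conditional distribution of the lasso, given that it passes through `u`. -/
noncomputable def lassoPMF [Fintype ι] (hw : ∀ i, 0 < w i) (u : Node p) : PMF ι :=
  PMF.ofFintype (fun j => ENNReal.ofReal (if u.1 <+: (p j).full then w j / nodeMass w u else 0)) (by
    rw [← ENNReal.ofReal_sum_of_nonneg, ← Finset.sum_filter, ← Finset.sum_div,
      show (∑ j with u.1 <+: (p j).full, w j) = nodeMass w u by unfold nodeMass massOf; congr!,
      div_self (nodeMass_pos hw u).ne', ENNReal.ofReal_one]
    intro j _
    split_ifs
    · exact div_nonneg (hw j).le (nodeMass_pos hw u).le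
    · exact le_rfl)

theorem lassoPMF_ne_zero [Fintype ι] (hw : ∀ i, 0 < w i) {u : Node p} {j : ι}
    (h : lassoPMF hw u j ≠ 0) : u.1 <+: (p j).full := by
  classical
  by_contra hc
  exact h (by simp [lassoPMF, hc])

theorem lassoPMF_pos [Fintype ι] (hw : ∀ i, 0 < w i) {u : Node p} {j : ι} (h : u.1 <+: (p j).full) :
    lassoPMF hw u j ≠ 0 := by
  classical
  simp only [lassoPMF, PMF.ofFintype_apply, if_pos h, ne_eq, ENNReal.ofReal_eq_zero, not_le]
  exact div_pos (hw j) (nodeMass_pos hw u)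

instance [Finite ι] : Finite (Node p) := by
  classical
  have : Finite {u : List α // ∃ i, u <+: (p i).full} := by
    have h : {u : List α | ∃ i, u <+: (p i).full} = ⋃ i, {u | u ∈ (p i).full.inits} := by
      ext; simp
    have : {u : List α | ∃ i, u <+: (p i).full}.Finite := by
      rw [h]
      exact Set.finite_iUnion fun i => List.finite_toSet _
    exact this
  exact Finite.of_injective
    (fun u : Node p => (⟨u.1, u.3⟩ : {u : List α // ∃ i, u <+: (p i).full}))
    fun u v h => Node.ext (congrArg (fun x => x.1) h)

/-- The last element of a node. -/
def Node.last (u : Node p) : α := u.1.getLast u.2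

theorem Node.getElem?_last {u : Node p} {j : ι} (h : u.1 <+: (p j).full) :
    (p j).full[u.1.length - 1]? = some u.last := by
  have hl := u.length_pos
  have h1 := h.getElem (i := u.1.length - 1) (by omega)
  rw [List.getElem?_eq_getElem (by have := h.length_le; omega), ← h1]
  exact congrArg some (List.getLast_eq_getElem u.2).symm

/-- The Markov chain of a bundle: a run draws a lasso according to the weights and follows it. Its
states are the nodes, so that lassos are told apart only when they branch. -/
noncomputable abbrev chain [Fintype ι] (C : α → Set (Formula A)) (hw : ∀ i, 0 < w i)
    (root : Node p) : MarkovChain A where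
  S := Node p
  countable := Finite.to_countable
  P u := (lassoPMF hw u).map (step u)
  init := root
  L u := {a | Formula.atom a ∈ C u.last}

theorem tsum_map_mul {X Y : Type*} [Fintype X] (μ : PMF X) (f : X → Y) (h : Y → ℝ≥0∞) :
    ∑' y, (μ.map f) y * h y = ∑ x, μ x * h (f x) := by
  classical
  simp_rw [PMF.map_apply, ← ENNReal.tsum_mul_right]
  rw [ENNReal.tsum_comm, tsum_fintype]
  refine Finset.sum_congr rfl fun x _ => ?_
  rw [tsum_eq_single (f x)]
  · simp
  · intro y hy
    rw [if_neg hy, zero_mul]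

theorem reach_eq_sum [Fintype ι] (hw : ∀ i, 0 < w i) (root : Node p) {T : Set (Node p)} {u : Node p}
    (hu : u ∉ T) : (chain C hw root).reach T u =
      ∑ j, lassoPMF hw u j * (chain C hw root).reach T (step u j) := by
  rw [MarkovChain.reach_of_notMem _ hu]
  exact tsum_map_mul (lassoPMF hw u) (step u) _

theorem mem_post_iff [Fintype ι] (hw : ∀ i, 0 < w i) (root : Node p) {u v : Node p} :
    v ∈ (chain C hw root).post u ↔ ∃ j, u.1 <+: (p j).full ∧ step u j = v := by
  change 0 < ((lassoPMF hw u).map (step u)) v ↔ _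
  rw [pos_iff_ne_zero, ← PMF.mem_support_iff, PMF.support_map]
  constructor
  · rintro ⟨j, hj, rfl⟩
    exact ⟨j, lassoPMF_ne_zero hw hj, rfl⟩
  · rintro ⟨j, hj, rfl⟩
    exact ⟨j, lassoPMF_pos hw hj, rfl⟩

theorem step_val {u : Node p} {j : ι} (h : u.1 <+: (p j).full) :
    (step u j).1 = nextList p u.1 j := by
  rw [step, dif_pos h]

theorem step_val_of_lt {u : Node p} {j : ι} (h : u.1 <+: (p j).full)
    (hl : u.1.length < (p j).full.length) :
    (step u j).1 = (p j).full.take (u.1.length + 1) := by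
  rw [step_val h, nextList, if_pos hl]

theorem step_val_of_eq {u : Node p} {j : ι} (h : u.1 = (p j).full) :
    (step u j).1 = (p j).full.take ((p j).stem.length + 1) := by
  rw [step_val (h ▸ List.prefix_rfl), nextList, if_neg (by rw [h]; exact lt_irrefl _)]

theorem step_prefix {u : Node p} {j : ι} (h : u.1 <+: (p j).full) :
    (step u j).1 <+: (p j).full := by
  rw [step_val h, nextList]
  split_ifs <;> exact List.take_prefix _ _

/-- Only one lasso passes through a node of a cycle. -/
theorem Valid.eq_of_prefix [Fintype ι] (hv : Valid C w p) {u : List α} {i j : ι}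
    (hi : u <+: (p i).full) (hj : u <+: (p j).full)
    (hl : (p i).stem.length < u.length) : p j = p i := by
  refine hv.nonbranching i j ?_
  have : (p i).full.take ((p i).stem.length + 1) <+: u := by
    rw [List.prefix_iff_eq_take.1 hi]
    exact List.take_prefix_take_left (by omega)
  exact this.trans hj

theorem Valid.reach_cycle_step [Fintype ι] (hv : Valid C w p) (root : Node p) {T : Set (Node p)}
    {u : Node p} {i : ι} (hi : u.1 <+: (p i).full)
    (hl : (p i).stem.length < u.1.length) (hu : u ∉ T) :
    (chain C hv.w_pos root).reach T u = (chain C hv.w_pos root).reach T (step u i) := by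
  rw [reach_eq_sum hv.w_pos root hu]
  have : ∀ j, lassoPMF hv.w_pos u j * (chain C hv.w_pos root).reach T (step u j) =
      lassoPMF hv.w_pos u j * (chain C hv.w_pos root).reach T (step u i) := by
    intro j
    by_cases hj : u.1 <+: (p j).full
    · have hp := hv.eq_of_prefix hi hj hl
      have : step u j = step u i :=
        Node.ext (by rw [step_val hj, step_val hi, nextList, nextList, hp])
      rw [this]
    · have : lassoPMF hv.w_pos u j = 0 := by
        by_contra h
        exact hj (lassoPMF_ne_zero _ h)
      rw [this, zero_mul, zero_mul]
  rw [Finset.sum_congr rfl fun j _ => this j, ← Finset.sum_mul,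
    ← tsum_fintype (L := .unconditional _), (lassoPMF hv.w_pos u).tsum_coe, one_mul]

/-- On a cycle, all elements of the cycle are visited. -/
theorem Valid.reach_cycle [Fintype ι] (hv : Valid C w p) (root : Node p) {Q : α → Prop} {i : ι}
    {y : α} (hy : y ∈ (p i).cyc) (hQ : Q y) (u : Node p) (hi : u.1 <+: (p i).full)
    (hl : (p i).stem.length < u.1.length) :
    (chain C hv.w_pos root).reach {v : Node p | Q v.last} u = 1 := by
  obtain ⟨e, he, hye⟩ : ∃ e, (p i).stem.length ≤ e ∧ (p i).full[e]? = some y := by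
    obtain ⟨n, hn⟩ := List.mem_iff_getElem?.1 hy
    refine ⟨(p i).stem.length + n, Nat.le_add_right _ _, ?_⟩
    rw [Lasso.full, List.getElem?_append_right (Nat.le_add_right _ _), Nat.add_sub_cancel_left, hn]
  have hel : e < (p i).full.length := (List.getElem?_eq_some_iff.1 hye).1
  -- up to the position `e` the run reaches it by going forward
  have h1 : ∀ n (u : Node p), u.1 <+: (p i).full → (p i).stem.length < u.1.length →
      u.1.length + n = e + 1 → (chain C hv.w_pos root).reach {v : Node p | Q v.last} u = 1 := by
    intro n
    induction n with
    | zero =>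
      intro u hi hl hn
      refine MarkovChain.reach_of_mem _ ?_
      have := Node.getElem?_last hi
      rw [show u.1.length - 1 = e by omega, hye, Option.some_inj] at this
      change Q u.last
      rwa [← this]
    | succ n ih =>
      intro u hi hl hn
      by_cases hu : u ∈ {v : Node p | Q v.last}
      · exact MarkovChain.reach_of_mem _ hu
      · rw [hv.reach_cycle_step root hi hl hu]
        have hs : (step u i).1.length = u.1.length + 1 := by
          rw [step_val_of_lt hi (by omega), List.length_take]
          omega
        exact ih _ (step_prefix hi) (by omega) (by omega)
  -- from later positions it returns to the start of the cycle
  have h2 : ∀ n (u : Node p), u.1 <+: (p i).full → (p i).stem.length < u.1.length →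
      u.1.length + n = (p i).full.length →
      (chain C hv.w_pos root).reach {v : Node p | Q v.last} u = 1 := by
    intro n
    induction n with
    | zero =>
      intro u hi hl hn
      by_cases hu : u ∈ {v : Node p | Q v.last}
      · exact MarkovChain.reach_of_mem _ hu
      · rw [hv.reach_cycle_step root hi hl hu]
        have hs : (step u i).1.length = (p i).stem.length + 1 := by
          rw [step_val_of_eq (hi.eq_of_length (by omega)), List.length_take]
          omega
        exact h1 (e + 1 - ((p i).stem.length + 1)) _ (step_prefix hi) (by omega) (by omega)
    | succ n ih =>
      intro u hi hl hn
      by_cases hu : u ∈ {v : Node p | Q v.last}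
      · exact MarkovChain.reach_of_mem _ hu
      · rw [hv.reach_cycle_step root hi hl hu]
        have hs : (step u i).1.length = u.1.length + 1 := by
          rw [step_val_of_lt hi (by omega), List.length_take]
          omega
        exact ih _ (step_prefix hi) (by omega) (by omega)
  exact h2 ((p i).full.length - u.1.length) u hi hl (by have := hi.length_le; omega)

/-- The probability of visiting `Q` is at least the relative weight of the lassos that do. Before
the end of the lassos this follows by backward induction on the length of the node, because the
transitions out of a node split the lassos through it according to their next nodes. At the end,
only one lasso is left, and its cycle is visited completely. -/
theorem Valid.hitMass_le_reach [Fintype ι] (hv : Valid C w p) (root : Node p) {Q : α → Prop}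
    (u : Node p) :
    massOf w (fun j => u.1 <+: (p j).full ∧ ∃ y ∈ (p j).fut (u.1.length - 1), Q y) ≤
      nodeMass w u * ((chain C hv.w_pos root).reach {v : Node p | Q v.last} u).toReal := by
  classical
  set T : Set (Node p) := {v : Node p | Q v.last} with hT
  set N := Finset.univ.sup fun i => (p i).full.length with hN
  have hNle : ∀ i, (p i).full.length ≤ N := fun i =>
    Finset.le_sup (f := fun i => (p i).full.length) (Finset.mem_univ i)
  have one : ∀ u : Node p, (chain C hv.w_pos root).reach T u = 1 →
      massOf w (fun j => u.1 <+: (p j).full ∧ ∃ y ∈ (p j).fut (u.1.length - 1), Q y) ≤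
      nodeMass w u * ((chain C hv.w_pos root).reach T u).toReal := by
    intro u hu
    rw [hu, ENNReal.toReal_one, mul_one]
    exact massOf_mono hv.w_pos fun j h => h.1
  obtain ⟨n, hn⟩ : ∃ n, N < u.1.length + n := ⟨N + 1, by omega⟩
  induction n generalizing u with
  | zero =>
    obtain ⟨i, hi⟩ := u.3
    have h1 := hi.length_le
    have h2 := hNle i
    omega
  | succ n ih =>
    by_cases hu : u ∈ T
    · exact one u (MarkovChain.reach_of_mem _ hu)
    by_cases hfull : ∃ i, u.1 = (p i).full
    · obtain ⟨i, hi⟩ := hfull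
      have hl : (p i).stem.length < u.1.length := by
        rw [hi]; exact Lasso.stem_length_lt (hv.cyc_ne i)
      have hpi : u.1 <+: (p i).full := hi ▸ List.prefix_rfl
      by_cases hy : ∃ y ∈ (p i).cyc, Q y
      · obtain ⟨y, hy, hQ⟩ := hy
        exact one u (hv.reach_cycle root hy hQ u hpi hl)
      · rw [massOf, Finset.sum_eq_zero]
        · exact mul_nonneg (nodeMass_pos hv.w_pos u).le ENNReal.toReal_nonneg
        · intro j hjm
          simp only [Finset.mem_filter, Finset.mem_univ, true_and] at hjm
          obtain ⟨hj, hQ⟩ := hjm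
          exfalso
          rw [hv.eq_of_prefix hpi hj hl, Lasso.fut_of_le (by omega)] at hQ
          exact hy hQ
    · have hlt : ∀ j, u.1 <+: (p j).full → u.1.length < (p j).full.length := fun j hj =>
        lt_of_le_of_ne hj.length_le fun h => hfull ⟨j, hj.eq_of_length h⟩
      -- the mean value property at `u`
      have hmean : nodeMass w u * ((chain C hv.w_pos root).reach T u).toReal =
          ∑ j with u.1 <+: (p j).full,
            w j * ((chain C hv.w_pos root).reach T (step u j)).toReal := by
        rw [reach_eq_sum hv.w_pos root hu, ENNReal.toReal_sum, Finset.mul_sum, Finset.sum_filter]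
        · refine Finset.sum_congr rfl fun j _ => ?_
          rw [ENNReal.toReal_mul]
          by_cases hj : u.1 <+: (p j).full
          · rw [if_pos hj, lassoPMF, PMF.ofFintype_apply, if_pos hj, ENNReal.toReal_ofReal
              (div_nonneg (hv.w_pos j).le (nodeMass_pos hv.w_pos u).le)]
            have := (nodeMass_pos hv.w_pos u).ne'
            field_simp
          · rw [if_neg hj, lassoPMF, PMF.ofFintype_apply, if_neg hj]
            simp
        · intro j _
          exact ENNReal.mul_ne_top (PMF.apply_ne_top _ _)
            (ne_top_of_le_ne_top ENNReal.one_ne_top (MarkovChain.reach_le_one _ _ _))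
      have : Fintype (Node p) := Fintype.ofFinite _
      -- both sums are grouped by the successors of `u`
      rw [hmean, massOf, ← Finset.sum_fiberwise _ (step u),
        ← Finset.sum_fiberwise (Finset.filter _ _) (step u)]
      refine Finset.sum_le_sum fun v _ => ?_
      by_cases hemp : ∃ j, u.1 <+: (p j).full ∧ step u j = v
      · obtain ⟨i, hi, hiv⟩ := hemp
        have hval := step_val_of_lt hi (hlt i hi)
        rw [hiv] at hval
        have hvlen : v.1.length = u.1.length + 1 := by
          rw [hval, List.length_take]
          have := hlt i hi
          omega
        have huv : u.1 <+: v.1 := by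
          rw [hval]
          exact List.prefix_take_iff.2 ⟨hi, Nat.le_succ _⟩
        have hfib : ∀ j, v.1 <+: (p j).full ↔ (u.1 <+: (p j).full ∧ step u j = v) := by
          intro j
          constructor
          · intro hj
            have huj := huv.trans hj
            refine ⟨huj, Node.ext ?_⟩
            rw [step_val_of_lt huj (hlt j huj), ← hvlen]
            exact (List.prefix_iff_eq_take.1 hj).symm
          · rintro ⟨hj, rfl⟩
            exact step_prefix hj
        have hih := ih v (by omega)
        refine le_trans ?_ (hih.trans (le_of_eq ?_))
        · refine Finset.sum_le_sum_of_subset_of_nonneg ?_ fun j _ _ => (hv.w_pos j).le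
          intro j
          simp only [Finset.mem_filter, Finset.mem_univ, true_and]
          rintro ⟨⟨hj, y, hy, hQ⟩, hjv⟩
          refine ⟨(hfib j).2 ⟨hj, hjv⟩, y, ?_, hQ⟩
          have hul := u.length_pos
          rw [hvlen, show u.1.length + 1 - 1 = u.1.length - 1 + 1 by omega]
          refine Lasso.mem_fut_succ (Node.getElem?_last hj) hy ?_
          rintro rfl
          exact hu hQ
        · rw [nodeMass, massOf, Finset.sum_mul, Finset.filter_filter]
          refine Finset.sum_congr ?_ ?_
          · ext j
            simp only [Finset.mem_filter, Finset.mem_univ, true_and]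
            exact hfib j
          · intro j hj
            rw [(Finset.mem_filter.1 hj).2.2]
      · rw [Finset.sum_eq_zero, Finset.sum_eq_zero]
        · intro j hj
          simp only [Finset.mem_filter, Finset.mem_univ, true_and] at hj
          exact absurd ⟨j, hj⟩ hemp
        · intro j hj
          simp only [Finset.mem_filter, Finset.mem_univ, true_and] at hj
          exact absurd ⟨j, hj.1.1, hj.2⟩ hemp

/-- A claim `G ψ` at a node is a claim of `ψ` at all nodes that are reachable from it. -/
theorem Valid.claim_of_reachable [Fintype ι] (hv : Valid C w p) (root : Node p) {c : Comparison}
    {b : Set.Icc (0 : ℚ) 1} {ψ : Formula A} {u v : Node p} (hu : Formula.G c b ψ ∈ C u.last)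
    (h : (chain C hv.w_pos root).Reachable u v) : ψ ∈ C v.last := by
  have key : ∀ j, v.1 <+: (p j).full → ∀ y ∈ (p j).fut (v.1.length - 1), ψ ∈ C y := by
    change Relation.ReflTransGen _ u v at h
    induction h with
    | refl =>
      intro j hj
      exact hv.claims j _ _ (Node.getElem?_last hj) _ hu
    | @tail a b _ hab ih =>
      intro j hj y hy
      obtain ⟨i, hi, rfl⟩ := (mem_post_iff hv.w_pos root).1 hab
      have hapos : 0 < a.1.length := Node.length_pos a
      rcases lt_or_ge a.1.length (p i).full.length with hlt | hge
      · have hval := step_val_of_lt hi hlt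
        have hlen : (step a i).1.length = a.1.length + 1 := by
          rw [hval, List.length_take]
          omega
        have haj : a.1 <+: (p j).full := by
          refine List.IsPrefix.trans ?_ hj
          rw [hval]
          exact List.prefix_take_iff.2 ⟨hi, Nat.le_succ _⟩
        refine ih j haj y ?_
        rw [hlen, show a.1.length + 1 - 1 = a.1.length - 1 + 1 by omega] at hy
        exact Lasso.fut_succ_subset _ _ hy
      · have hai := hi.eq_of_length_le hge
        have hval := step_val_of_eq hai
        have hst := Lasso.stem_length_lt (hv.cyc_ne i)
        have hlen : (step a i).1.length = (p i).stem.length + 1 := by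
          rw [hval, List.length_take]
          omega
        have hp := hv.eq_of_prefix (step_prefix hi) hj (by omega)
        refine ih i hi y ?_
        rw [hp, hlen, Lasso.fut_of_le (by omega)] at hy
        rw [Lasso.fut_of_le (by rw [hai]; omega)]
        exact hy
  obtain ⟨j, hj⟩ := v.3
  exact key j hj _ (Lasso.mem_fut_of_getElem? (Node.getElem?_last hj))

/-- The claims of a valid bundle are true in its Markov chain. -/
theorem Valid.sat [Fintype ι] (hv : Valid C w p) (root : Node p) {φ : Formula A}
    (hφ : φ.InFragment) (u : Node p) (hu : φ ∈ C u.last) : φ.Sat (chain C hv.w_pos root) u := by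
  have claim : ∀ {χ : Formula A} (u : Node p), χ ∈ C u.last →
      ∃ i, u.1 <+: (p i).full ∧ ClaimOk C w p (p i) (u.1.length - 1) u.last χ := by
    intro χ u hu
    obtain ⟨i, hi⟩ := u.3
    exact ⟨i, hi, hv.claims i _ _ (Node.getElem?_last hi) _ hu⟩
  induction φ generalizing u with
  | atom a => exact hu
  | natom a =>
    obtain ⟨i, -, h⟩ := claim u hu
    exact h
  | and φ ψ ih₁ ih₂ =>
    cases hφ with
    | and hφ hψ =>
      obtain ⟨i, -, h⟩ := claim u hu
      exact ⟨ih₁ hφ u h.1, ih₂ hψ u h.2⟩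
  | or φ ψ ih₁ ih₂ =>
    cases hφ with
    | or hφ hψ =>
      obtain ⟨i, -, h⟩ := claim u hu
      exact h.imp (ih₁ hφ u) (ih₂ hψ u)
  | G c b φ ih =>
    cases hφ with
    | G hφ =>
      exact Formula.sat_G_iff.2 fun v hv' =>
        ih hφ.inFragment v (hv.claim_of_reachable root hu hv')
  | F c b φ ih =>
    cases hφ with
    | F c b hφ =>
      classical
      obtain ⟨i, hi, h⟩ := claim u hu
      have hpos := nodeMass_pos hv.w_pos u
      have hthr : ∀ j, (p i).Through (u.1.length - 1) (p j) ↔ u.1 <+: (p j).full := by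
        intro j
        have := u.length_pos
        rw [Lasso.Through, Nat.sub_add_cancel (by omega), ← List.prefix_iff_eq_take.1 hi]
      have hpass : passMass w p (p i) (u.1.length - 1) = nodeMass w u := massOf_congr hthr
      have hhit : hitMass w p (p i) (u.1.length - 1) (fun y => φ ∈ C y) ≤ nodeMass w u *
          ((chain C hv.w_pos root).reach {v : Node p | φ ∈ C v.last} u).toReal := by
        refine le_of_eq_of_le ?_ (hv.hitMass_le_reach (Q := fun y => φ ∈ C y) root u)
        exact massOf_congr fun j => and_congr_left fun _ => hthr j
      have hsub : {v : Node p | φ ∈ C v.last} ⊆ {v : Node p | φ.Sat (chain C hv.w_pos root) v} :=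
        fun v hv' => ih hφ v hv'
      have hreach := (chain C hv.w_pos root).toReal_reach_mono hsub u
      have hF : c.Holds (hitMass w p (p i) (u.1.length - 1) fun y => φ ∈ C y) _ := h
      rw [hpass] at hF
      exact Formula.sat_F_iff.2 (Comparison.holds_of_mul hF
        (hhit.trans (mul_le_mul_of_nonneg_left hreach hpos.le)) hpos)

/-- A node is determined by a lasso through it and by its length. -/
theorem card_node_le [Fintype ι] {L : ℕ} (hL : ∀ i, (p i).full.length ≤ L) :
    Nat.card (Node p) ≤ Fintype.card ι * L := by
  classical
  have hinj : Function.Injective (fun u : Node p =>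
      ((⟨u.3.choose, ⟨u.1.length - 1, by
        have h1 := u.3.choose_spec.length_le
        have h2 := hL u.3.choose
        have h3 := u.length_pos
        omega⟩⟩) : ι × Fin L)) := by
    intro u v h
    rw [Prod.mk.injEq, Fin.mk.injEq] at h
    have h3 := u.length_pos
    have h4 := v.length_pos
    have hl : u.1.length = v.1.length := by omega
    have hu := List.prefix_iff_eq_take.1 u.3.choose_spec
    have hv := List.prefix_iff_eq_take.1 v.3.choose_spec
    rw [← h.1, ← hl] at hv
    exact Node.ext (hu.trans hv.symm)
  have := Nat.card_le_card_of_injective _ hinj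
  simpa using this

theorem dropLast_take_of_le {l : List α} {n : ℕ} (h : n ≤ l.length) :
    (l.take n).dropLast = l.take (n - 1) := by
  rw [List.dropLast_eq_take, List.take_take, List.length_take]
  congr 1
  omega

theorem exists_dropLast_prefix (u : Node p) : ∃ i, u.1.dropLast <+: (p i).full := by
  obtain ⟨i, hi⟩ := u.3
  exact ⟨i, (List.dropLast_prefix _).trans hi⟩

/-- The parent of a node; a node of length `1` is its own parent. -/
def Node.parent (u : Node p) : Node p :=
  if h : 1 < u.1.length then
    { val := u.1.dropLast
      ne_nil := by
        rw [← List.length_pos_iff, List.length_dropLast]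
        omega
      exists_prefix := exists_dropLast_prefix u }
  else u

theorem Node.parent_iterate (u : Node p) {k : ℕ} (hk : k < u.1.length) :
    (Node.parent^[k] u).1 = u.1.take (u.1.length - k) := by
  induction k with
  | zero => simp
  | succ k ih =>
    have ih := ih (by omega)
    have hlen : (Node.parent^[k] u).1.length = u.1.length - k := by
      rw [ih, List.length_take]; omega
    rw [Function.iterate_succ_apply', Node.parent, dif_pos (by omega)]
    change (Node.parent^[k] u).1.dropLast = _
    rw [ih, dropLast_take_of_le (by omega)]
    congr 1

/-- If all lassos start with the same element, their Markov chain is a tree with back edges. -/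
theorem Valid.hasHeight [Fintype ι] [Nonempty ι] (hv : Valid C w p) (root : Node p)
    (hroot : root.1.length = 1) (hhead : ∀ i, root.1 <+: (p i).full) {L : ℕ}
    (hL : ∀ i, (p i).full.length ≤ L + 1) :
    ∃ h ≤ L, (chain C hv.w_pos root).HasHeight h := by
  have hne : ∀ u : Node p, u ≠ root → 1 < u.1.length := by
    intro u hu
    by_contra hc
    obtain ⟨i, hi⟩ := u.3
    have := u.length_pos
    refine hu (Node.ext ?_)
    rw [List.prefix_iff_eq_take.1 hi, List.prefix_iff_eq_take.1 (hhead i)]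
    congr 1
    omega
  have hpar : ∀ u : Node p, 1 < u.1.length → u.parent.1 = u.1.dropLast := by
    intro u hu
    rw [Node.parent, dif_pos hu]
  have htree : (chain C hv.w_pos root).IsTreeWithBackEdges Node.parent
      fun u : Node p => u.1.length - 1 := by
    refine ⟨?_, ?_, ?_, ?_, ?_⟩
    · exact dif_neg (by rw [show (chain C hv.w_pos root).init = root from rfl]; omega)
    · change root.1.length - 1 = 0
      omega
    · intro u hu
      have hu1 := hne u hu
      obtain ⟨i, hi⟩ := u.3
      have hpre : u.parent.1 <+: (p i).full := by
        rw [hpar u hu1]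
        exact (List.dropLast_prefix _).trans hi
      refine (mem_post_iff hv.w_pos root).2 ⟨i, hpre, Node.ext ?_⟩
      have hl : u.parent.1.length + 1 = u.1.length := by
        rw [hpar u hu1, List.length_dropLast]
        omega
      rw [step_val_of_lt hpre (by have := hi.length_le; omega), hl]
      exact (List.prefix_iff_eq_take.1 hi).symm
    · intro u hu
      have hu1 := hne u hu
      change u.1.length - 1 = u.parent.1.length - 1 + 1
      rw [hpar u hu1, List.length_dropLast]
      omega
    · intro u v huv
      obtain ⟨i, hi, rfl⟩ := (mem_post_iff hv.w_pos root).1 huv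
      have hu0 : 0 < u.1.length := Node.length_pos u
      rcases lt_or_ge u.1.length (p i).full.length with hlt | hge
      · left
        have hval := step_val_of_lt hi hlt
        have hlen : (step u i).1.length = u.1.length + 1 := by
          rw [hval, List.length_take]
          omega
        refine ⟨fun h => ?_, Node.ext ?_⟩
        · change step u i = root at h
          rw [h] at hlen
          omega
        · rw [hpar (step u i) (by omega), hval, dropLast_take_of_le (by omega)]
          exact (List.prefix_iff_eq_take.1 hi).symm
      · right
        have hui := hi.eq_of_length_le hge
        have hst := Lasso.stem_length_lt (hv.cyc_ne i)
        have hul : u.1.length = (p i).full.length := by rw [hui]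
        refine ⟨u.1.length - ((p i).stem.length + 1), Node.ext ?_⟩
        refine (Node.parent_iterate u (by omega)).trans ?_
        rw [step_val_of_eq hui, ← hui]
        congr 1
        omega
  have hle : ∀ u : Node p, u.1.length - 1 ≤ L := by
    intro u
    obtain ⟨i, hi⟩ := u.3
    have h1 := hi.length_le
    have h2 := hL i
    omega
  have : Nonempty (Node p) := ⟨root⟩
  obtain ⟨u, hu⟩ := Finite.exists_max fun u : Node p => u.1.length - 1
  exact ⟨u.1.length - 1, hle u, Node.parent, _, htree, hu, u, rfl⟩

end Bundle

/-! ### Operations on bundles -/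

namespace Lasso

variable {α : Type}

/-- The lasso `p`, with the element `x` put in front. -/
def prepend (x : α) (p : Lasso α) : Lasso α := ⟨x :: p.stem, p.cyc⟩

@[simp] theorem full_prepend (x : α) (p : Lasso α) : (p.prepend x).full = x :: p.full := rfl

theorem through_prepend_zero (x : α) (p q : Lasso α) : (p.prepend x).Through 0 (q.prepend x) := by
  simp [Through]

theorem through_prepend_succ (x : α) (p q : Lasso α) (d : ℕ) :
    (p.prepend x).Through (d + 1) (q.prepend x) ↔ p.Through d q := by
  simp [Through]

theorem Through.zero {p q : Lasso α} {d : ℕ} (h : p.Through d q) : p.Through 0 q :=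
  (List.take_prefix_take_left (by omega)).trans h

end Lasso

namespace Bundle

variable {A : Type u} {α : Type} {C : α → Set (Formula A)}

/-- The weight of the lassos that visit `Q`. -/
noncomputable def hitTotal {ι : Type} [Fintype ι] (w : ι → ℝ) (p : ι → Lasso α) (Q : α → Prop) :
    ℝ :=
  massOf w fun j => ∃ y ∈ (p j).full, Q y

section

variable {ι : Type} [Fintype ι] {w : ι → ℝ} {p : ι → Lasso α}

theorem hitTotal_prepend_le (hw : ∀ i, 0 < w i) (x : α) (Q : α → Prop) :
    hitTotal w p Q ≤ hitTotal w (fun i => (p i).prepend x) Q :=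
  massOf_mono hw fun _ ⟨y, hy, hQ⟩ => ⟨y, List.mem_cons_of_mem _ hy, hQ⟩

theorem passMass_prepend_zero (x : α) (q : Lasso α) :
    passMass w (fun i => (p i).prepend x) (q.prepend x) 0 = ∑ i, w i :=
  massOf_of_forall fun _ => Lasso.through_prepend_zero _ _ _

theorem hitMass_prepend_zero (x : α) (q : Lasso α) (Q : α → Prop) :
    hitMass w (fun i => (p i).prepend x) (q.prepend x) 0 Q =
      hitTotal w (fun i => (p i).prepend x) Q :=
  massOf_congr fun _ => and_iff_right (Lasso.through_prepend_zero _ _ _)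

theorem passMass_prepend_succ (x : α) (q : Lasso α) (d : ℕ) :
    passMass w (fun i => (p i).prepend x) (q.prepend x) (d + 1) = passMass w p q d :=
  massOf_congr fun _ => Lasso.through_prepend_succ _ _ _ _

theorem hitMass_prepend_succ (x : α) (q : Lasso α) (d : ℕ) (Q : α → Prop) :
    hitMass w (fun i => (p i).prepend x) (q.prepend x) (d + 1) Q = hitMass w p q d Q :=
  massOf_congr fun _ => and_congr_left fun _ => Lasso.through_prepend_succ _ _ _ _

/-- If the claims of `x` are justified by the lassos prolonged by `x`, then these form a valid
bundle again: the claims of the other elements only move up by one position. -/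
theorem Valid.prepend (hv : Valid C w p) {x : α}
    (hx : ∀ i, ∀ χ ∈ C x, ClaimOk C w (fun i => (p i).prepend x) ((p i).prepend x) 0 x χ) :
    Valid C w fun i => (p i).prepend x where
  w_pos := hv.w_pos
  cyc_ne := hv.cyc_ne
  nonbranching i j h := by
    have h' : (p i).Through (p i).stem.length (p j) :=
      (Lasso.through_prepend_succ x _ _ _).1 h
    rw [hv.nonbranching i j h']
  claims i d y hy χ hχ := by
    rcases d with _ | d
    · obtain rfl : x = y := by simpa using hy
      exact hx i χ hχ
    · have h := hv.claims i d y (by simpa using hy) χ hχ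
      cases χ with
      | F c b φ =>
        change c.Holds _ _ at h
        change c.Holds _ _
        rwa [passMass_prepend_succ, hitMass_prepend_succ]
      | atom a => exact h
      | natom a => exact h
      | and φ ψ => exact h
      | or φ ψ => exact h
      | G c b φ => exact h

end

section

variable {β : Type} [Fintype β] {ι : β → Type} [∀ b, Fintype (ι b)] {w : ∀ b, ι b → ℝ}
  {p : ∀ b, ι b → Lasso α} {l : β → ℝ}

theorem massOf_sigma (P : (Σ b, ι b) → Prop) :
    massOf (fun x : Σ b, ι b => l x.1 * w x.1 x.2) P =
      ∑ b, l b * massOf (w b) fun j => P ⟨b, j⟩ := by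
  classical
  rw [massOf, Finset.sum_filter, Fintype.sum_sigma]
  refine Finset.sum_congr rfl fun b _ => ?_
  rw [massOf, Finset.mul_sum, Finset.sum_filter]

theorem massOf_sigma_single {P : (Σ b, ι b) → Prop} (b : β) (hP : ∀ x, P x → x.1 = b) :
    massOf (fun x : Σ b, ι b => l x.1 * w x.1 x.2) P =
      l b * massOf (w b) fun j => P ⟨b, j⟩ := by
  classical
  rw [massOf_sigma, Finset.sum_eq_single b]
  · intro b' _ hb'
    rw [massOf, Finset.filter_false_of_mem fun j _ h => hb' (hP _ h), Finset.sum_empty, mul_zero]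
  · intro h
    exact absurd (Finset.mem_univ b) h

/-- Valid bundles whose lassos start with different elements can be mixed with any positive
weights. -/
theorem Valid.mix (hv : ∀ b, Valid C (w b) (p b)) (hl : ∀ b, 0 < l b)
    (hd : ∀ b b' i j, (p b i).Through 0 (p b' j) → b' = b) :
    Valid C (fun x : Σ b, ι b => l x.1 * w x.1 x.2) fun x => p x.1 x.2 where
  w_pos x := mul_pos (hl x.1) ((hv x.1).w_pos x.2)
  cyc_ne x := (hv x.1).cyc_ne x.2
  nonbranching := by
    rintro ⟨b, i⟩ ⟨b', j⟩ h
    obtain rfl := hd b b' i j h.zero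
    exact (hv b').nonbranching i j h
  claims := by
    classical
    rintro ⟨b, i⟩ d x hx χ hχ
    have h := (hv b).claims i d x hx χ hχ
    cases χ with
    | F c q φ =>
      change c.Holds _ _ at h
      change c.Holds (hitMass _ (fun x : Σ b, ι b => p x.1 x.2) (p b i) d _)
        (_ * passMass _ (fun x : Σ b, ι b => p x.1 x.2) (p b i) d)
      have h1 : passMass (fun x : Σ b, ι b => l x.1 * w x.1 x.2)
          (fun x : Σ b, ι b => p x.1 x.2) (p b i) d = l b * passMass (w b) (p b) (p b i) d :=
        massOf_sigma_single (P := fun x => (p b i).Through d (p x.1 x.2)) b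
          fun x hx => hd _ _ _ _ hx.zero
      have h2 : hitMass (fun x : Σ b, ι b => l x.1 * w x.1 x.2)
          (fun x : Σ b, ι b => p x.1 x.2) (p b i) d (fun y => φ ∈ C y) =
          l b * hitMass (w b) (p b) (p b i) d fun y => φ ∈ C y :=
        massOf_sigma_single
          (P := fun x => (p b i).Through d (p x.1 x.2) ∧ ∃ y ∈ (p x.1 x.2).fut d, φ ∈ C y) b
          fun x hx => hd _ _ _ _ hx.1.zero
      rw [h1, h2]
      cases c with
      | ge =>
        change _ ≤ _ at h
        change _ ≤ _
        rw [mul_left_comm]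
        exact mul_le_mul_of_nonneg_left h (hl b).le
      | gt =>
        change _ < _ at h
        change _ < _
        rw [mul_left_comm]
        exact mul_lt_mul_of_pos_left h (hl b)
    | atom a => exact h
    | natom a => exact h
    | and φ ψ => exact h
    | or φ ψ => exact h
    | G c b φ => exact h

theorem hitTotal_mix (Q : α → Prop) :
    hitTotal (fun x : Σ b, ι b => l x.1 * w x.1 x.2) (fun x : Σ b, ι b => p x.1 x.2) Q =
      ∑ b, l b * hitTotal (w b) (p b) Q :=
  massOf_sigma _

end

end Bundle

/-! ### Extraction of a bundle from a model -/

namespace Formula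

variable {A : Type u}

/-- The number of operators `F` outside the scope of `G`. -/
def outerF : Formula A → ℕ
  | atom _ => 0
  | natom _ => 0
  | and φ ψ => φ.outerF + ψ.outerF
  | or φ ψ => φ.outerF + ψ.outerF
  | F _ _ φ => φ.outerF + 1
  | G _ _ _ => 0

/-- A set of inner formulae that contains the immediate subformulae of its members. -/
structure InnerClosed (I : Finset (Formula A)) : Prop where
  inner : ∀ χ ∈ I, IsInner χ
  and_mem : ∀ {φ ψ}, and φ ψ ∈ I → φ ∈ I ∧ ψ ∈ I
  or_mem : ∀ {φ ψ}, or φ ψ ∈ I → φ ∈ I ∧ ψ ∈ I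
  F_mem : ∀ {c q φ}, F c q φ ∈ I → φ ∈ I
  G_mem : ∀ {c q φ}, G c q φ ∈ I → φ ∈ I

/-- All subformulae lie in `D`, and those of the form `G ψ` outside the scope of `G` lie in `I`. -/
def Within (I D : Finset (Formula A)) : Formula A → Prop
  | atom a => atom a ∈ D
  | natom a => natom a ∈ D
  | and φ ψ => and φ ψ ∈ D ∧ Within I D φ ∧ Within I D ψ
  | or φ ψ => or φ ψ ∈ D ∧ Within I D φ ∧ Within I D ψ
  | F c q φ => F c q φ ∈ D ∧ Within I D φ
  | G c q φ => G c q φ ∈ D ∧ G c q φ ∈ I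

theorem Within.mem {I D : Finset (Formula A)} {φ : Formula A} (h : Within I D φ) : φ ∈ D := by
  cases φ with
  | atom a => exact h
  | natom a => exact h
  | and φ ψ => exact h.1
  | or φ ψ => exact h.1
  | F c q φ => exact h.1
  | G c q φ => exact h.1

/-- The measure of a set of pending goals: the number of operators `F` of the formulae `F φ` outside
the scope of `G`. The summand `1` is for the outer `F`, so that the measure drops when a reached
goal `φ` is replaced by the goals in `φ`, and so that it bounds the number of goals. -/
def weight (U : Finset (Formula A)) : ℕ := ∑ φ ∈ U, (φ.outerF + 1)

theorem weight_union_le [DecidableEq (Formula A)] (U V : Finset (Formula A)) :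
    weight (U ∪ V) ≤ weight U + weight V := by
  unfold weight
  rw [← Finset.sum_union_inter]
  exact Nat.le_add_right _ _

theorem card_le_weight (U : Finset (Formula A)) : U.card ≤ weight U := by
  rw [weight, Finset.card_eq_sum_ones]
  exact Finset.sum_le_sum fun φ _ => Nat.le_add_left _ _

end Formula

namespace Extraction

open Formula PCTL.Bundle

variable {A : Type u} (M : MarkovChain A)

/-- The immediate subformulae on which the truth of `χ` depends lie in `O`; the argument of `F` may
instead be pending, that is, lie in `U`. -/
def Unfolds (I O U : Finset (Formula A)) : Formula A → Prop
  | .and φ ψ => φ ∈ O ∧ ψ ∈ O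
  | .or φ ψ => φ ∈ O ∨ ψ ∈ O
  | .F _ _ φ => φ ∈ O ∨ φ ∈ U
  | .G c q φ => Formula.G c q φ ∈ I
  | _ => True

theorem Unfolds.mono {I O O' U U' : Finset (Formula A)} {χ : Formula A} (h : Unfolds I O U χ)
    (hO : O ⊆ O') (hU : U ⊆ U') : Unfolds I O' U' χ := by
  cases χ with
  | F c q φ => exact Or.imp (fun h => hO h) (fun h => hU h) h
  | atom a => trivial
  | natom a => trivial
  | and φ ψ => exact ⟨hO h.1, hO h.2⟩
  | or φ ψ => exact Or.imp (fun h => hO h) (fun h => hO h) h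
  | G c q φ => exact h

/-- `O` is a set of true claims, closed under unfolding, with the pending goals `U`. -/
def Justified (I : Finset (Formula A)) (m : M.S) (O U : Finset (Formula A)) : Prop :=
  ∀ χ ∈ O, χ.Sat M m ∧ Unfolds I O U χ

/-- The members of `U` are goals that are not reached yet. -/
def Pending (I D : Finset (Formula A)) (m : M.S) (U : Finset (Formula A)) : Prop :=
  ∀ φ ∈ U, ¬ φ.Sat M m ∧ Within I D φ

variable {M} {I D : Finset (Formula A)} {m : M.S}

theorem Justified.mono {O U U' : Finset (Formula A)} (h : Justified M I m O U) (hU : U ⊆ U') :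
    Justified M I m O U' :=
  fun χ hχ => ⟨(h χ hχ).1, (h χ hχ).2.mono subset_rfl hU⟩

theorem Justified.union [DecidableEq (Formula A)] {O O' U : Finset (Formula A)}
    (h : Justified M I m O U) (h' : Justified M I m O' U) : Justified M I m (O ∪ O') U := by
  intro χ hχ
  rcases Finset.mem_union.1 hχ with hχ | hχ
  · exact ⟨(h χ hχ).1, (h χ hχ).2.mono Finset.subset_union_left subset_rfl⟩
  · exact ⟨(h' χ hχ).1, (h' χ hχ).2.mono Finset.subset_union_right subset_rfl⟩

theorem Pending.union [DecidableEq (Formula A)] {U U' : Finset (Formula A)}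
    (h : Pending M I D m U) (h' : Pending M I D m U') : Pending M I D m (U ∪ U') := by
  intro χ hχ
  rcases Finset.mem_union.1 hχ with hχ | hχ
  · exact h χ hχ
  · exact h' χ hχ

theorem Justified.cons [DecidableEq (Formula A)] {O U : Finset (Formula A)} {χ : Formula A}
    (h : Justified M I m O U) (hχ : χ.Sat M m) (h' : Unfolds I O U χ) :
    Justified M I m (insert χ O) U := by
  intro ψ hψ
  rcases Finset.mem_insert.1 hψ with rfl | hψ
  · exact ⟨hχ, h'.mono (Finset.subset_insert _ _) subset_rfl⟩
  · exact ⟨(h ψ hψ).1, (h ψ hψ).2.mono (Finset.subset_insert _ _) subset_rfl⟩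

/-- A true formula can be justified by true subformulae and by pending goals that contain fewer
operators `F`. -/
theorem exists_justified {φ : Formula A} (hφ : Within I D φ) (hs : φ.Sat M m) :
    ∃ O U, φ ∈ O ∧ O ⊆ D ∧ Justified M I m O U ∧ Pending M I D m U ∧ weight U ≤ φ.outerF := by
  classical
  have hnil : Justified M I m ∅ ∅ := fun χ hχ => absurd hχ (Finset.notMem_empty χ)
  have hnil' : Pending M I D m ∅ := fun χ hχ => absurd hχ (Finset.notMem_empty χ)
  induction φ with
  | atom a =>
    refine ⟨{.atom a}, ∅, Finset.mem_singleton_self _, ?_, ?_, hnil', Nat.le_refl 0⟩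
    · rw [Finset.singleton_subset_iff]; exact hφ
    · exact hnil.cons hs trivial
  | natom a =>
    refine ⟨{.natom a}, ∅, Finset.mem_singleton_self _, ?_, ?_, hnil', Nat.le_refl 0⟩
    · rw [Finset.singleton_subset_iff]; exact hφ
    · exact hnil.cons hs trivial
  | and φ ψ ih₁ ih₂ =>
    obtain ⟨O₁, U₁, h₁, hD₁, hJ₁, hP₁, hw₁⟩ := ih₁ hφ.2.1 hs.1
    obtain ⟨O₂, U₂, h₂, hD₂, hJ₂, hP₂, hw₂⟩ := ih₂ hφ.2.2 hs.2
    refine ⟨insert (.and φ ψ) (O₁ ∪ O₂), U₁ ∪ U₂, Finset.mem_insert_self _ _, ?_, ?_,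
      hP₁.union hP₂, (weight_union_le _ _).trans (Nat.add_le_add hw₁ hw₂)⟩
    · exact Finset.insert_subset hφ.mem (Finset.union_subset hD₁ hD₂)
    · exact ((hJ₁.mono Finset.subset_union_left).union
        (hJ₂.mono Finset.subset_union_right)).cons hs
        ⟨Finset.mem_union_left _ h₁, Finset.mem_union_right _ h₂⟩
  | or φ ψ ih₁ ih₂ =>
    rcases hs with hs | hs
    · obtain ⟨O₁, U₁, h₁, hD₁, hJ₁, hP₁, hw₁⟩ := ih₁ hφ.2.1 hs
      exact ⟨insert (.or φ ψ) O₁, U₁, Finset.mem_insert_self _ _,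
        Finset.insert_subset hφ.mem hD₁, hJ₁.cons (χ := .or φ ψ) (Or.inl hs) (Or.inl h₁), hP₁,
        hw₁.trans (Nat.le_add_right _ _)⟩
    · obtain ⟨O₁, U₁, h₁, hD₁, hJ₁, hP₁, hw₁⟩ := ih₂ hφ.2.2 hs
      exact ⟨insert (.or φ ψ) O₁, U₁, Finset.mem_insert_self _ _,
        Finset.insert_subset hφ.mem hD₁, hJ₁.cons (χ := .or φ ψ) (Or.inr hs) (Or.inr h₁), hP₁,
        hw₁.trans (Nat.le_add_left _ _)⟩
  | F c q φ ih =>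
    by_cases h : φ.Sat M m
    · obtain ⟨O₁, U₁, h₁, hD₁, hJ₁, hP₁, hw₁⟩ := ih hφ.2 h
      exact ⟨insert (.F c q φ) O₁, U₁, Finset.mem_insert_self _ _,
        Finset.insert_subset hφ.mem hD₁, hJ₁.cons (χ := .F c q φ) hs (Or.inl h₁), hP₁,
        hw₁.trans (Nat.le_succ _)⟩
    · refine ⟨{.F c q φ}, {φ}, Finset.mem_singleton_self _, ?_, ?_, ?_, ?_⟩
      · rw [Finset.singleton_subset_iff]; exact hφ.mem
      · exact (hnil.mono (Finset.empty_subset {φ})).cons hs (Or.inr (Finset.mem_singleton_self _))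
      · intro χ hχ
        rw [Finset.mem_singleton.1 hχ]
        exact ⟨h, hφ.2⟩
      · simp [weight, outerF]
  | G c q φ =>
    refine ⟨{.G c q φ}, ∅, Finset.mem_singleton_self _, ?_, ?_, hnil', Nat.le_refl 0⟩
    · rw [Finset.singleton_subset_iff]; exact hφ.mem
    · exact hnil.cons hs hφ.2

/-- The goals of `V` that are reached in `m` can be replaced by justified claims and smaller
goals. -/
theorem exists_justified_of_goals (V : Finset (Formula A)) (hV : ∀ φ ∈ V, Within I D φ) (m : M.S) :
    ∃ O U, (∀ φ ∈ V, φ.Sat M m → φ ∈ O) ∧ (∀ φ ∈ V, ¬ φ.Sat M m → φ ∈ U) ∧ O ⊆ D ∧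
      Justified M I m O U ∧ Pending M I D m U ∧ weight U ≤ weight V ∧
      ((∃ φ ∈ V, φ.Sat M m) → weight U < weight V) := by
  classical
  induction V using Finset.induction_on with
  | empty =>
    exact ⟨∅, ∅, by simp, by simp, by simp, fun χ hχ => absurd hχ (Finset.notMem_empty χ),
      fun χ hχ => absurd hχ (Finset.notMem_empty χ), le_rfl, by simp⟩
  | insert φ V hφV ih =>
    obtain ⟨O, U, hO, hU, hD, hJ, hP, hw, hw'⟩ :=
      ih fun ψ hψ => hV ψ (Finset.mem_insert_of_mem hψ)
    have hwi : weight (insert φ V) = φ.outerF + 1 + weight V := Finset.sum_insert hφV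
    have hφ := hV φ (Finset.mem_insert_self _ _)
    by_cases hs : φ.Sat M m
    · obtain ⟨O', U', h', hD', hJ', hP', hw''⟩ := exists_justified hφ hs
      have hlt : weight (U' ∪ U) < weight (insert φ V) := by
        have := weight_union_le U' U
        omega
      refine ⟨O' ∪ O, U' ∪ U, ?_, ?_, Finset.union_subset hD' hD,
        (hJ'.mono Finset.subset_union_left).union (hJ.mono Finset.subset_union_right),
        hP'.union hP, hlt.le, fun _ => hlt⟩
      · intro ψ hψ hψs
        rcases Finset.mem_insert.1 hψ with rfl | hψ
        · exact Finset.mem_union_left _ h'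
        · exact Finset.mem_union_right _ (hO ψ hψ hψs)
      · intro ψ hψ hψs
        rcases Finset.mem_insert.1 hψ with rfl | hψ
        · exact absurd hs hψs
        · exact Finset.mem_union_right _ (hU ψ hψ hψs)
    · have hle : weight (insert φ U) ≤ φ.outerF + 1 + weight U := by
        have := weight_union_le {φ} U
        rw [← Finset.insert_eq] at this
        simpa [weight] using this
      refine ⟨O, insert φ U, ?_, ?_, hD, hJ.mono (Finset.subset_insert _ _), ?_, by omega, ?_⟩
      · intro ψ hψ hψs
        rcases Finset.mem_insert.1 hψ with rfl | hψ
        · exact absurd hψs hs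
        · exact hO ψ hψ hψs
      · intro ψ hψ hψs
        rcases Finset.mem_insert.1 hψ with rfl | hψ
        · exact Finset.mem_insert_self _ _
        · exact Finset.mem_insert_of_mem (hU ψ hψ hψs)
      · intro ψ hψ
        rcases Finset.mem_insert.1 hψ with rfl | hψ
        · exact ⟨hs, hφ⟩
        · exact hP ψ hψ
      · rintro ⟨ψ, hψ, hψs⟩
        rcases Finset.mem_insert.1 hψ with rfl | hψ
        · exact absurd hψs hs
        · have := hw' ⟨ψ, hψ, hψs⟩
          omega

/-! ### Compressed paths and terminal states -/

theorem sat_F_one_iff {ψ : Formula A} {s : M.S} :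
    (Formula.F .ge 1 ψ).Sat M s ↔ M.reach {t | ψ.Sat M t} s = 1 := by
  rw [Formula.sat_F_iff]
  change (((1 : Set.Icc (0 : ℚ) 1) : ℚ) : ℝ) ≤ _ ↔ _
  rw [Set.Icc.coe_one, Rat.cast_one]
  have hne : M.reach {t | ψ.Sat M t} s ≠ ∞ :=
    ne_top_of_le_ne_top ENNReal.one_ne_top (M.reach_le_one _ _)
  constructor
  · intro h
    refine le_antisymm (M.reach_le_one _ _) ?_
    rwa [← ENNReal.toReal_one, ENNReal.toReal_le_toReal ENNReal.one_ne_top hne] at h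
  · intro h
    rw [h, ENNReal.toReal_one]

open Classical in
/-- The number of formulae `F_{=1} ψ` in `I`. -/
noncomputable def goalCount (I : Finset (Formula A)) : ℕ :=
  (I.filter fun χ => ∃ ψ, χ = .F .ge 1 ψ).card

variable (M I) in
/-- `cs` is a compression of a path from `s` to `x` (both excluded): every claim `F_{=1} ψ` of one
of its states is fulfilled later in `cs` or handed over to `x`. -/
def ChainOk (x : M.S) : M.S → List M.S → Prop
  | s, [] => M.Reachable s x ∧ ∀ ψ, Formula.F .ge 1 ψ ∈ I → (Formula.F .ge 1 ψ).Sat M s →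
      ψ.Sat M s ∨ (Formula.F .ge 1 ψ).Sat M x
  | s, c :: cs => (M.Reachable s c ∧ ∀ ψ, Formula.F .ge 1 ψ ∈ I → (Formula.F .ge 1 ψ).Sat M s →
      ψ.Sat M s ∨ (∃ y ∈ c :: cs, ψ.Sat M y) ∨ (Formula.F .ge 1 ψ).Sat M x) ∧ ChainOk x c cs

theorem ChainOk.goals {x s : M.S} {cs : List M.S} (h : ChainOk M I x s cs) {ψ : Formula A}
    (hψ : Formula.F .ge 1 ψ ∈ I) (hs : (Formula.F .ge 1 ψ).Sat M s) :
    ψ.Sat M s ∨ (∃ y ∈ cs, ψ.Sat M y) ∨ (Formula.F .ge 1 ψ).Sat M x := by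
  cases cs with
  | nil => exact (h.2 ψ hψ hs).imp_right Or.inr
  | cons c cs => exact h.1.2 ψ hψ hs

/-- Every path compresses to one with at most as many intermediate states as there are formulae
`F_{=1} ψ` in `I`: it suffices to keep, from the end of the path backwards, the states that fulfil
a `ψ` which no kept state fulfils. -/
theorem exists_chainOk {s x : M.S} (h : M.Reachable s x) :
    ∃ cs, ChainOk M I x s cs ∧ cs.length ≤ goalCount I := by
  classical
  suffices h : ∃ cs, ChainOk M I x s cs ∧
      cs.length ≤ (I.filter fun χ => ∃ ψ, χ = .F .ge 1 ψ ∧ ∃ y ∈ cs, ψ.Sat M y).card by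
    obtain ⟨cs, h₁, h₂⟩ := h
    refine ⟨cs, h₁, h₂.trans (Finset.card_le_card ?_)⟩
    intro χ
    simp only [Finset.mem_filter]
    rintro ⟨hχ, ψ, rfl, -⟩
    exact ⟨hχ, ψ, rfl⟩
  induction h using Relation.ReflTransGen.head_induction_on with
  | refl => exact ⟨[], ⟨.refl, fun ψ _ h => Or.inr h⟩, Nat.zero_le _⟩
  | @head s s' hs hs' ih =>
    obtain ⟨cs, hcs, hlen⟩ := ih
    have hpost : ∀ ψ : Formula A, (Formula.F .ge 1 ψ).Sat M s → ¬ ψ.Sat M s →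
        (Formula.F .ge 1 ψ).Sat M s' := by
      intro ψ h₁ h₂
      rw [sat_F_one_iff] at h₁ ⊢
      exact M.reach_eq_one_of_post h₁ h₂ hs
    by_cases hkeep : ∀ ψ, Formula.F .ge 1 ψ ∈ I → ψ.Sat M s' →
        (∃ y ∈ cs, ψ.Sat M y) ∨ (Formula.F .ge 1 ψ).Sat M x
    · refine ⟨cs, ?_, hlen⟩
      have key : ∀ ψ, Formula.F .ge 1 ψ ∈ I → (Formula.F .ge 1 ψ).Sat M s →
          ψ.Sat M s ∨ (∃ y ∈ cs, ψ.Sat M y) ∨ (Formula.F .ge 1 ψ).Sat M x := by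
        intro ψ hψ h₁
        by_cases h₂ : ψ.Sat M s
        · exact Or.inl h₂
        · right
          rcases hcs.goals hψ (hpost ψ h₁ h₂) with h₃ | h₃
          · exact hkeep ψ hψ h₃
          · exact h₃
      cases cs with
      | nil => exact ⟨.head hs hcs.1, fun ψ hψ h => (key ψ hψ h).imp_right
          fun h => h.resolve_left (by simp)⟩
      | cons c cs => exact ⟨⟨.head hs hcs.1.1, key⟩, hcs.2⟩
    · push Not at hkeep
      obtain ⟨ψ₀, hψ₀, hs₀, hn₀, -⟩ := hkeep
      refine ⟨s' :: cs, ⟨⟨.single hs, ?_⟩, hcs⟩, ?_⟩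
      · intro ψ hψ h₁
        by_cases h₂ : ψ.Sat M s
        · exact Or.inl h₂
        · right
          rcases hcs.goals hψ (hpost ψ h₁ h₂) with h₃ | ⟨y, hy, h₃⟩ | h₃
          · exact Or.inl ⟨s', by simp, h₃⟩
          · exact Or.inl ⟨y, List.mem_cons_of_mem _ hy, h₃⟩
          · exact Or.inr h₃
      · rw [List.length_cons]
        refine Nat.succ_le_of_lt (hlen.trans_lt (Finset.card_lt_card ?_))
        rw [Finset.ssubset_iff_of_subset]
        · refine ⟨.F .ge 1 ψ₀, ?_, ?_⟩
          · exact Finset.mem_filter.2 ⟨hψ₀, ψ₀, rfl, s', by simp, hs₀⟩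
          · rw [Finset.mem_filter]
            rintro ⟨-, ψ, h, y, hy, hψ⟩
            rw [Formula.F.injEq] at h
            exact hn₀ y hy (h.2.2 ▸ hψ)
        · intro χ
          simp only [Finset.mem_filter]
          rintro ⟨hχ, ψ, rfl, y, hy, hψ⟩
          exact ⟨hχ, ψ, rfl, y, List.mem_cons_of_mem _ hy, hψ⟩

/-- From every state one reaches a state from which no formula `G ψ` of `I` becomes true anymore: on
transitions, formulae `G ψ` that are true remain true, so that a reachable state with the largest
number of them will do. -/
theorem exists_terminal (s : M.S) :
    ∃ t, M.Reachable s t ∧ ∀ u, M.Reachable t u → ∀ ψ, Formula.G .ge 1 ψ ∈ I →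
      (Formula.G .ge 1 ψ).Sat M u → (Formula.G .ge 1 ψ).Sat M t := by
  classical
  let n : M.S → ℕ := fun t => (I.filter fun χ => ∃ ψ, χ = .G .ge 1 ψ ∧ χ.Sat M t).card
  have hn : ∀ t, n t ≤ I.card := fun t => Finset.card_filter_le _ _
  obtain ⟨t, ht, hmax⟩ : ∃ t, M.Reachable s t ∧ ∀ u, M.Reachable s u → n u ≤ n t := by
    by_contra! hc
    have : ∀ k, ∃ t, M.Reachable s t ∧ k ≤ n t := by
      intro k
      induction k with
      | zero => exact ⟨s, .refl, Nat.zero_le _⟩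
      | succ k ih =>
        obtain ⟨t, ht, hk⟩ := ih
        obtain ⟨u, hu, hlt⟩ := hc t ht
        exact ⟨u, hu, by omega⟩
    obtain ⟨t, -, h⟩ := this (I.card + 1)
    have := hn t
    omega
  refine ⟨t, ht, fun u hu ψ hψ hsat => ?_⟩
  have hsub : (I.filter fun χ => ∃ ψ, χ = .G .ge 1 ψ ∧ χ.Sat M t) ⊆
      I.filter fun χ => ∃ ψ, χ = .G .ge 1 ψ ∧ χ.Sat M u := by
    intro χ
    simp only [Finset.mem_filter]
    rintro ⟨hχ, ψ, rfl, h⟩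
    refine ⟨hχ, ψ, rfl, ?_⟩
    rw [Formula.sat_G_iff] at h ⊢
    exact fun v hv => h v (hu.trans hv)
  have heq := Finset.eq_of_subset_of_card_le hsub (hmax u (ht.trans hu))
  have hmem : Formula.G .ge 1 ψ ∈ I.filter fun χ => ∃ ψ, χ = .G .ge 1 ψ ∧ χ.Sat M u :=
    Finset.mem_filter.2 ⟨hψ, ψ, rfl, hsat⟩
  rw [← heq] at hmem
  obtain ⟨-, -, -, h⟩ := Finset.mem_filter.1 hmem
  exact h

end Extraction

/-! ### Building the bundle -/

namespace Extraction

open Formula PCTL.Bundle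

variable {A : Type u} [Primcodable A] {M : MarkovChain A} {I D : Finset (Formula A)} {T : ℕ}

/-- The formulae claimed by an element, which consists of a tag and a list of codes of formulae. -/
def claimsOf (x : ℕ × List ℕ) : Set (Formula A) := {χ | χ.code ∈ x.2}

/-- The element with the given tag and claims. The tags keep the first elements of different
branches apart, even if their claims agree, so that the branches can be mixed. -/
noncomputable def elt (tag : ℕ) (s : Finset (Formula A)) : ℕ × List ℕ :=
  (tag, s.toList.map Formula.code)

theorem mem_claimsOf_elt {tag : ℕ} {s : Finset (Formula A)} {χ : Formula A} :
    χ ∈ claimsOf (elt tag s) ↔ χ ∈ s := by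
  change χ.code ∈ s.toList.map Formula.code ↔ _
  rw [List.mem_map]
  constructor
  · rintro ⟨ψ, hψ, h⟩
    rw [← Formula.code_injective h]
    exact Finset.mem_toList.1 hψ
  · exact fun h => ⟨χ, Finset.mem_toList.2 h, rfl⟩

open Classical in
/-- The formulae of `I` that are true in `s`. -/
noncomputable def trueIn (I : Finset (Formula A)) (s : M.S) : Finset (Formula A) :=
  I.filter fun χ => χ.Sat M s

omit [Primcodable A] in
theorem mem_trueIn {s : M.S} {χ : Formula A} : χ ∈ trueIn I s ↔ χ ∈ I ∧ χ.Sat M s := by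
  classical
  exact Finset.mem_filter

variable (M I D T) in
/-- A valid bundle of total weight `1` whose elements represent states reachable from `s`: they
claim all formulae of `I` that are true in such a state, and only formulae of `D`. Their tags are at
most `T`, and the lassos have at most `L` elements. -/
structure Forest (s : M.S) (L : ℕ) {ι : Type} [Fintype ι] (w : ι → ℝ)
    (p : ι → Lasso (ℕ × List ℕ)) : Prop where
  valid : Valid (claimsOf (A := A)) w p
  total : ∑ i, w i = 1
  grounded : ∀ i, ∀ y ∈ (p i).full, ∃ t, M.Reachable s t ∧ ∀ ψ ∈ I, ψ.Sat M t → ψ ∈ claimsOf y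
  length_le : ∀ i, (p i).full.length ≤ L
  content : ∀ i, ∀ y ∈ (p i).full, ∃ tag ≤ T, ∃ c ⊆ D, y = elt tag c

/-- All lassos claim `ψ` somewhere. -/
def AllHit {ι : Type} (p : ι → Lasso (ℕ × List ℕ)) (ψ : Formula A) : Prop :=
  ∀ i, ∃ y ∈ (p i).full, ψ ∈ claimsOf y

/-- The first element of every lasso carries the tag `tag`. -/
def Tagged {ι : Type} (p : ι → Lasso (ℕ × List ℕ)) (tag : ℕ) : Prop :=
  ∀ i, ∃ y, (p i).full.head? = some y ∧ y.1 = tag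

variable {ι : Type} [Fintype ι] {w : ι → ℝ} {p : ι → Lasso (ℕ × List ℕ)} {L : ℕ}

theorem Forest.of_reachable {s t : M.S} (h : Forest M I D T t L w p) (hr : M.Reachable s t) :
    Forest M I D T s L w p where
  valid := h.valid
  total := h.total
  grounded i y hy := by
    obtain ⟨u, hu, h⟩ := h.grounded i y hy
    exact ⟨u, hr.trans hu, h⟩
  length_le := h.length_le
  content := h.content

theorem Forest.mono {s : M.S} {L' : ℕ} (h : Forest M I D T s L w p) (hL : L ≤ L') :
    Forest M I D T s L' w p where
  valid := h.valid
  total := h.total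
  grounded := h.grounded
  length_le i := (h.length_le i).trans hL
  content := h.content

theorem _root_.PCTL.Comparison.Holds.mono {c : Comparison} {x y q : ℝ} (h : c.Holds x q)
    (hxy : x ≤ y) : c.Holds y q := by
  cases c with
  | ge => exact le_trans h hxy
  | gt => exact lt_of_lt_of_le h hxy

omit [Primcodable A] in
theorem eq_of_F_mem (hI : InnerClosed I) {c : Comparison} {q : Set.Icc (0 : ℚ) 1} {φ : Formula A}
    (h : Formula.F c q φ ∈ I) : Formula.F c q φ = .F .ge 1 φ := by
  cases hI.inner _ h
  rfl

omit [Primcodable A] in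
theorem eq_of_G_mem (hI : InnerClosed I) {c : Comparison} {q : Set.Icc (0 : ℚ) 1} {φ : Formula A}
    (h : Formula.G c q φ ∈ I) : Formula.G c q φ = .G .ge 1 φ := by
  cases hI.inner _ h
  rfl

/-- An element that claims the true formulae of `I` and further justified formulae can be put in
front of a bundle, provided that the bundle takes care of the goals that are open in this
element. -/
theorem Forest.prepend [DecidableEq (Formula A)] (hI : InnerClosed I) (hID : I ⊆ D) {s : M.S}
    (h : Forest M I D T s L w p)
    (hF : ∀ ψ, Formula.F .ge 1 ψ ∈ I → (Formula.F .ge 1 ψ).Sat M s → ψ.Sat M s ∨ AllHit p ψ)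
    {O U : Finset (Formula A)} (hO : Justified M I s O U) (hOD : O ⊆ D)
    (hU : ∀ φ ∈ U, (M.reach {t | φ.Sat M t} s).toReal ≤ hitTotal w p fun y => φ ∈ claimsOf y)
    {tag : ℕ} (htag : tag ≤ T) :
    Forest M I D T s (L + 1) w fun i => (p i).prepend (elt tag (trueIn I s ∪ O)) where
  valid := by
    refine h.valid.prepend fun i χ hχ => ?_
    have hsat : ∀ χ ∈ trueIn I s ∪ O, χ.Sat M s := by
      intro χ hχ
      rcases Finset.mem_union.1 hχ with h | h
      · exact (mem_trueIn.1 h).2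
      · exact (hO χ h).1
    rw [mem_claimsOf_elt] at hχ
    -- goals that are reached at once, or by all lassos, are reached with probability `1`
    have hone : ∀ φ, (φ ∈ trueIn I s ∪ O ∨ AllHit p φ) →
        hitTotal w (fun i => (p i).prepend (elt tag (trueIn I s ∪ O)))
          (fun y => φ ∈ claimsOf y) = 1 := by
      intro φ hφ
      rw [← h.total]
      refine massOf_of_forall fun j => ?_
      rcases hφ with hφ | hφ
      · exact ⟨_, List.mem_cons_self, mem_claimsOf_elt.2 hφ⟩
      · obtain ⟨y, hy, hyφ⟩ := hφ j
        exact ⟨y, List.mem_cons_of_mem _ hy, hyφ⟩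
    have hreach : ∀ φ : Formula A, (M.reach {t | φ.Sat M t} s).toReal ≤ 1 := by
      intro φ
      rw [← ENNReal.toReal_one]
      exact ENNReal.toReal_mono ENNReal.one_ne_top (M.reach_le_one _ _)
    cases χ with
    | atom a =>
      change Formula.natom a ∉ claimsOf _
      rw [mem_claimsOf_elt]
      exact fun hn => hsat _ hn (hsat _ hχ)
    | natom a =>
      change Formula.atom a ∉ claimsOf _
      rw [mem_claimsOf_elt]
      exact fun hn => hsat _ hχ (hsat _ hn)
    | and φ ψ =>
      change φ ∈ claimsOf _ ∧ ψ ∈ claimsOf _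
      rw [mem_claimsOf_elt, mem_claimsOf_elt]
      have hs := hsat _ hχ
      rcases Finset.mem_union.1 hχ with h | h
      · have hm := hI.and_mem (mem_trueIn.1 h).1
        exact ⟨Finset.mem_union_left _ (mem_trueIn.2 ⟨hm.1, hs.1⟩),
          Finset.mem_union_left _ (mem_trueIn.2 ⟨hm.2, hs.2⟩)⟩
      · exact ⟨Finset.mem_union_right _ (hO _ h).2.1, Finset.mem_union_right _ (hO _ h).2.2⟩
    | or φ ψ =>
      change φ ∈ claimsOf _ ∨ ψ ∈ claimsOf _
      rw [mem_claimsOf_elt, mem_claimsOf_elt]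
      have hs := hsat _ hχ
      rcases Finset.mem_union.1 hχ with h | h
      · have hm := hI.or_mem (mem_trueIn.1 h).1
        exact hs.imp (fun hs => Finset.mem_union_left _ (mem_trueIn.2 ⟨hm.1, hs⟩))
          fun hs => Finset.mem_union_left _ (mem_trueIn.2 ⟨hm.2, hs⟩)
      · exact Or.imp (fun h => Finset.mem_union_right _ h) (fun h => Finset.mem_union_right _ h)
          (hO _ h).2
    | F c q φ =>
      change c.Holds (hitMass _ (fun i => (p i).prepend _) ((p i).prepend _) 0 _)
        (_ * passMass _ (fun i => (p i).prepend _) ((p i).prepend _) 0)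
      rw [hitMass_prepend_zero, passMass_prepend_zero, h.total, mul_one]
      refine (Formula.sat_F_iff.1 (hsat _ hχ)).mono ?_
      rcases Finset.mem_union.1 hχ with hm | hm
      · obtain ⟨hmI, hs⟩ := mem_trueIn.1 hm
        have heq := eq_of_F_mem hI hmI
        rw [hone φ]
        · exact hreach φ
        · rcases hF φ (heq ▸ hmI) (heq ▸ hs) with h1 | h1
          · exact Or.inl (Finset.mem_union_left _ (mem_trueIn.2 ⟨hI.F_mem hmI, h1⟩))
          · exact Or.inr h1
      · rcases (hO _ hm).2 with h1 | h1
        · rw [hone φ (Or.inl (Finset.mem_union_right _ h1))]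
          exact hreach φ
        · exact (hU φ h1).trans (hitTotal_prepend_le h.valid.w_pos _ _)
    | G c q φ =>
      have hmI : Formula.G c q φ ∈ I := by
        rcases Finset.mem_union.1 hχ with hm | hm
        · exact (mem_trueIn.1 hm).1
        · exact (hO _ hm).2
      have hall := Formula.sat_G_iff.1 (eq_of_G_mem hI hmI ▸ hsat _ hχ)
      intro y hy
      rcases List.mem_cons.1 hy with rfl | hy
      · rw [mem_claimsOf_elt]
        exact Finset.mem_union_left _ (mem_trueIn.2 ⟨hI.G_mem hmI, hall s .refl⟩)
      · obtain ⟨t, ht, hty⟩ := h.grounded i y hy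
        exact hty φ (hI.G_mem hmI) (hall t ht)
  total := h.total
  grounded i y hy := by
    rcases List.mem_cons.1 hy with rfl | hy
    · exact ⟨s, .refl, fun ψ hψ hs =>
        mem_claimsOf_elt.2 (Finset.mem_union_left _ (mem_trueIn.2 ⟨hψ, hs⟩))⟩
    · exact h.grounded i y hy
  length_le i := by
    rw [Lasso.full_prepend, List.length_cons]
    exact Nat.succ_le_succ (h.length_le i)
  content i y hy := by
    classical
    rcases List.mem_cons.1 hy with rfl | hy
    · refine ⟨tag, htag, _, Finset.union_subset ?_ hOD, rfl⟩
      exact (Finset.filter_subset _ _).trans hID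
    · exact h.content i y hy

/-- A compressed path can be put in front of a bundle. -/
theorem exists_forest_of_chainOk (hI : InnerClosed I) (hID : I ⊆ D) {tag : ℕ} (htag : tag ≤ T)
    {x : M.S} (hx : Forest M I D T x L w p) (ht : Tagged p tag)
    (hF : ∀ ψ, Formula.F .ge 1 ψ ∈ I → (Formula.F .ge 1 ψ).Sat M x → AllHit p ψ)
    {s : M.S} {cs : List M.S} (hcs : ChainOk M I x s cs) :
    ∃ p' : ι → Lasso (ℕ × List ℕ), Forest M I D T s (L + cs.length) w p' ∧ Tagged p' tag ∧
      (∀ ψ, Formula.F .ge 1 ψ ∈ I → (Formula.F .ge 1 ψ).Sat M s → ψ.Sat M s ∨ AllHit p' ψ) ∧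
      ∀ Q, hitTotal w p Q ≤ hitTotal w p' Q := by
  classical
  suffices h : ∃ p' : ι → Lasso (ℕ × List ℕ), Forest M I D T s (L + cs.length) w p' ∧
      Tagged p' tag ∧ (∀ Q, hitTotal w p Q ≤ hitTotal w p' Q) ∧
      ∀ ψ ∈ I, ((∃ y ∈ cs, ψ.Sat M y) ∨ AllHit p ψ) → AllHit p' ψ by
    obtain ⟨p', h₁, h₂, h₃, h₄⟩ := h
    refine ⟨p', h₁, h₂, fun ψ hψ hs => ?_, h₃⟩
    have hψI := hI.F_mem hψ
    rcases hcs.goals hψ hs with h | h | h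
    · exact Or.inl h
    · exact Or.inr (h₄ ψ hψI (Or.inl h))
    · exact Or.inr (h₄ ψ hψI (Or.inr (hF ψ hψ h)))
  induction cs generalizing s with
  | nil =>
    refine ⟨p, hx.of_reachable hcs.1, ht, fun Q => le_rfl, ?_⟩
    rintro ψ - (⟨y, hy, -⟩ | h)
    · simp at hy
    · exact h
  | cons c cs ih =>
    obtain ⟨p', h₁, h₂, h₃, h₄⟩ := ih hcs.2
    have hgoal : ∀ ψ, Formula.F .ge 1 ψ ∈ I → (Formula.F .ge 1 ψ).Sat M c →
        ψ.Sat M c ∨ AllHit p' ψ := by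
      intro ψ hψ hs
      have hψI := hI.F_mem hψ
      rcases hcs.2.goals hψ hs with h | h | h
      · exact Or.inl h
      · exact Or.inr (h₄ ψ hψI (Or.inl h))
      · exact Or.inr (h₄ ψ hψI (Or.inr (hF ψ hψ h)))
    have hpre := h₁.prepend hI hID hgoal (O := ∅) (U := ∅) (by simp [Justified]) (by simp)
      (by simp) htag
    refine ⟨_, (hpre.of_reachable hcs.1.1).mono (by rw [List.length_cons]; omega), ?_, ?_, ?_⟩
    · exact fun i => ⟨_, rfl, rfl⟩
    · exact fun Q => (h₃ Q).trans (hitTotal_prepend_le h₁.valid.w_pos _ _)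
    · intro ψ hψ hh i
      by_cases hc : ψ.Sat M c
      · exact ⟨_, List.mem_cons_self,
          mem_claimsOf_elt.2 (Finset.mem_union_left _ (mem_trueIn.2 ⟨hψ, hc⟩))⟩
      · have : AllHit p' ψ := by
          refine h₄ ψ hψ (hh.imp_left ?_)
          rintro ⟨y, hy, hs⟩
          rcases List.mem_cons.1 hy with rfl | hy
          · exact absurd hs hc
          · exact ⟨y, hy, hs⟩
        obtain ⟨y, hy, hyψ⟩ := this i
        exact ⟨y, List.mem_cons_of_mem _ hy, hyψ⟩

/-- A state from which no further formula `G ψ` becomes true is the start of a cycle that visits a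
witness for every goal `ψ` of a formula `F_{=1} ψ` that is still reachable. -/
theorem exists_forest_of_terminal (hI : InnerClosed I) (hID : I ⊆ D) {tag : ℕ} (htag : tag ≤ T)
    {t : M.S} (ht : ∀ u, M.Reachable t u → ∀ ψ, Formula.G .ge 1 ψ ∈ I →
      (Formula.G .ge 1 ψ).Sat M u → (Formula.G .ge 1 ψ).Sat M t) :
    ∃ p : Unit → Lasso (ℕ × List ℕ), Forest M I D T t (goalCount I + 1) (fun _ => 1) p ∧
      Tagged p tag ∧
      ∀ ψ, Formula.F .ge 1 ψ ∈ I → (Formula.F .ge 1 ψ).Sat M t → AllHit p ψ := by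
  classical
  -- a witness for each `F_{=1} ψ`; the cycle consists of `t` and of these witnesses
  have hwit : ∀ χ : Formula A, ∃ y, M.Reachable t y ∧ ∀ ψ, χ = .F .ge 1 ψ →
      (∃ y, M.Reachable t y ∧ ψ.Sat M y) → ψ.Sat M y := by
    intro χ
    by_cases h : ∃ ψ, χ = .F .ge 1 ψ ∧ ∃ y, M.Reachable t y ∧ ψ.Sat M y
    · obtain ⟨ψ, rfl, y, hy, hs⟩ := h
      refine ⟨y, hy, fun ψ' h' _ => ?_⟩
      rw [Formula.F.injEq] at h'
      exact h'.2.2 ▸ hs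
    · exact ⟨t, .refl, fun ψ h₁ h₂ => absurd ⟨ψ, h₁, h₂⟩ h⟩
  choose wit hreach hwit using hwit
  set ys : List M.S := t :: ((I.filter fun χ => ∃ ψ, χ = .F .ge 1 ψ).toList.map wit) with hys
  have hysr : ∀ y ∈ ys, M.Reachable t y := by
    intro y hy
    rcases List.mem_cons.1 hy with rfl | hy
    · exact .refl
    · obtain ⟨χ, -, rfl⟩ := List.mem_map.1 hy
      exact hreach χ
  have hgoal : ∀ ψ, Formula.F .ge 1 ψ ∈ I → ∀ y, M.Reachable t y →
      (Formula.F .ge 1 ψ).Sat M y → ∃ z ∈ ys, ψ.Sat M z := by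
    intro ψ hψ y hy hs
    rw [sat_F_one_iff] at hs
    have h0 : M.reach {t | ψ.Sat M t} y ≠ 0 := by rw [hs]; exact one_ne_zero
    obtain ⟨z, hz, hzs⟩ := M.reach_ne_zero_iff.1 h0
    refine ⟨wit (.F .ge 1 ψ), List.mem_cons_of_mem _ (List.mem_map_of_mem ?_),
      hwit _ ψ rfl ⟨z, hy.trans hz, hzs⟩⟩
    exact Finset.mem_toList.2 (Finset.mem_filter.2 ⟨hψ, ψ, rfl⟩)
  set p : Unit → Lasso (ℕ × List ℕ) := fun _ =>
    ⟨[], ys.map fun y => elt tag (trueIn I y)⟩ with hp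
  have hmem : ∀ (i : Unit) (x : ℕ × List ℕ), x ∈ (p i).full →
      ∃ y ∈ ys, x = elt tag (trueIn I y) := by
    intro i x hx
    obtain ⟨y, hy, rfl⟩ := List.mem_map.1 hx
    exact ⟨y, hy, rfl⟩
  have hfull : ∀ (i : Unit) (y : M.S), y ∈ ys → elt tag (trueIn I y) ∈ (p i).full := fun i y hy =>
    List.mem_map.2 ⟨y, hy, rfl⟩
  have hfut : ∀ i d, (p i).fut d = (p i).full := fun i d => by
    rw [Lasso.fut_of_le (Nat.zero_le d)]
    rfl
  refine ⟨p, ⟨⟨fun _ => one_pos, ?_, fun _ _ _ => rfl, ?_⟩, by simp, ?_, ?_, ?_⟩, ?_, ?_⟩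
  · intro i
    simp [hp, hys]
  · intro i d x hx χ hχ
    obtain ⟨y, hy, rfl⟩ := hmem i x (List.mem_of_getElem? hx)
    rw [mem_claimsOf_elt, mem_trueIn] at hχ
    obtain ⟨hχI, hs⟩ := hχ
    cases χ with
    | atom a =>
      change Formula.natom a ∉ claimsOf _
      rw [mem_claimsOf_elt, mem_trueIn]
      exact fun hn => hn.2 hs
    | natom a =>
      change Formula.atom a ∉ claimsOf _
      rw [mem_claimsOf_elt, mem_trueIn]
      exact fun hn => hs hn.2
    | and φ ψ =>
      change φ ∈ claimsOf _ ∧ ψ ∈ claimsOf _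
      rw [mem_claimsOf_elt, mem_claimsOf_elt, mem_trueIn, mem_trueIn]
      exact ⟨⟨(hI.and_mem hχI).1, hs.1⟩, (hI.and_mem hχI).2, hs.2⟩
    | or φ ψ =>
      change φ ∈ claimsOf _ ∨ ψ ∈ claimsOf _
      rw [mem_claimsOf_elt, mem_claimsOf_elt, mem_trueIn, mem_trueIn]
      exact hs.imp (fun h => ⟨(hI.or_mem hχI).1, h⟩) fun h => ⟨(hI.or_mem hχI).2, h⟩
    | F c q φ =>
      have heq := eq_of_F_mem hI hχI
      obtain ⟨z, hz, hzs⟩ := hgoal φ (heq ▸ hχI) y (hysr y hy) (heq ▸ hs)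
      rw [Formula.F.injEq] at heq
      obtain ⟨rfl, rfl, -⟩ := heq
      change (((1 : Set.Icc (0 : ℚ) 1) : ℚ) : ℝ) * passMass _ _ _ _ ≤ hitMass _ _ _ _ _
      rw [Set.Icc.coe_one, Rat.cast_one, one_mul]
      change _ ≤ hitMass (fun _ => 1) p (p i) d fun y => φ ∈ claimsOf y
      refine massOf_mono (fun _ => one_pos) fun j hj => ⟨hj, elt tag (trueIn I z), ?_,
        mem_claimsOf_elt.2 (mem_trueIn.2 ⟨hI.F_mem hχI, hzs⟩)⟩
      rw [hfut j d]
      exact hfull j z hz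
    | G c q φ =>
      have heq := eq_of_G_mem hI hχI
      -- by the choice of `t`, the formula is true in `t` already, hence `φ` on the whole cycle
      have hG := ht y (hysr y hy) φ (heq ▸ hχI) (heq ▸ hs)
      intro x hx
      rw [hfut i d] at hx
      obtain ⟨z, hz, rfl⟩ := hmem i x hx
      rw [mem_claimsOf_elt, mem_trueIn]
      exact ⟨hI.G_mem hχI, Formula.sat_G_iff.1 hG z (hysr z hz)⟩
  · intro i x hx
    obtain ⟨y, hy, rfl⟩ := hmem i x hx
    exact ⟨y, hysr y hy, fun ψ hψ hs => mem_claimsOf_elt.2 (mem_trueIn.2 ⟨hψ, hs⟩)⟩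
  · intro i
    simp [hp, hys, Lasso.full, goalCount]
  · intro i x hx
    obtain ⟨y, hy, rfl⟩ := hmem i x hx
    exact ⟨tag, htag, _, (Finset.filter_subset _ _).trans hID, rfl⟩
  · exact fun i => ⟨_, rfl, rfl⟩
  · intro ψ hψ hs i
    obtain ⟨z, hz, hzs⟩ := hgoal ψ hψ t .refl hs
    exact ⟨_, hfull i z hz, mem_claimsOf_elt.2 (mem_trueIn.2 ⟨hI.F_mem hψ, hzs⟩)⟩

/-- Bundles with distinct tags can be mixed. -/
theorem Forest.mix {β : Type} [Fintype β] {ι : β → Type} [∀ b, Fintype (ι b)] {w : ∀ b, ι b → ℝ}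
    {p : ∀ b, ι b → Lasso (ℕ × List ℕ)} {l : β → ℝ} {s : M.S} {tag : β → ℕ}
    (h : ∀ b, Forest M I D T s L (w b) (p b)) (ht : ∀ b, Tagged (p b) (tag b))
    (hinj : Function.Injective tag) (hl : ∀ b, 0 < l b) (hl1 : ∑ b, l b = 1) :
    Forest M I D T s L (fun x : Σ b, ι b => l x.1 * w x.1 x.2) fun x => p x.1 x.2 where
  valid := by
    refine Valid.mix (fun b => (h b).valid) hl fun b b' i j hij => ?_
    obtain ⟨y, hy, hyt⟩ := ht b i
    obtain ⟨z, hz, hzt⟩ := ht b' j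
    rw [Lasso.Through] at hij
    cases h₁ : (p b i).full with
    | nil => rw [h₁] at hy; simp at hy
    | cons y' l₁ =>
      cases h₂ : (p b' j).full with
      | nil => rw [h₂] at hz; simp at hz
      | cons z' l₂ =>
        rw [h₁] at hy hij
        rw [h₂] at hz hij
        simp only [List.head?_cons, Option.some_inj] at hy hz
        subst hy hz
        have : y' = z' := by simpa using hij
        exact hinj (by rw [← hyt, ← hzt, this])
  total := by
    rw [Fintype.sum_sigma, ← hl1]
    refine Finset.sum_congr rfl fun b _ => ?_
    change ∑ j, l b * w b j = l b
    rw [← Finset.mul_sum, (h b).total, mul_one]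
  grounded x := (h x.1).grounded x.2
  length_le x := (h x.1).length_le x.2
  content x := (h x.1).content x.2

/-- The heart of the extraction. From the state `m` with pending goals `U` let the model run until
one of the goals is reached. The distribution of the state in which this happens is replaced by one
on at most `|U| + 1` such states that is as good for all goals; the part of the mass that reaches no
goal is sent to a cycle. The branches are compressed paths, and after a branch the measure of the
pending goals has decreased. With `B = goalCount I`, a lasso consists of the element for `m`, of at
most `B` elements on the way to the next exit, and so on, for at most `n` exits, and finally of at
most `B` elements before a cycle of at most `B + 1`. -/
theorem exists_forest (hI : InnerClosed I) (hID : I ⊆ D) :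
    ∀ (n : ℕ) (m : M.S) (O U : Finset (Formula A)) (tag : ℕ), weight U = n → weight U ≤ T →
      tag ≤ T → O ⊆ D → Justified M I m O U → Pending M I D m U →
      ∃ (ι : Type) (_ : Fintype ι) (w : ι → ℝ) (p : ι → Lasso (ℕ × List ℕ))
        (c : Finset (Formula A)),
        Forest M I D T m (n * (goalCount I + 1) + 2 * goalCount I + 2) w p ∧
        Fintype.card ι ≤ (T + 1) ^ (n + 1) ∧ O ⊆ c ∧ (∀ χ ∈ I, χ.Sat M m → χ ∈ c) ∧
        (∀ i, (p i).full.head? = some (elt tag c)) ∧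
        (∀ ψ, Formula.F .ge 1 ψ ∈ I → (Formula.F .ge 1 ψ).Sat M m → AllHit p ψ) ∧
        ∀ φ ∈ U, (M.reach {t | φ.Sat M t} m).toReal ≤ hitTotal w p fun y => φ ∈ claimsOf y := by
  classical
  intro n
  induction n using Nat.strong_induction_on with
  | _ n ih =>
  intro m O U tag hn hUT htag hOD hJ hP
  set B := goalCount I with hB
  set X : Set M.S := {x | ∃ φ ∈ U, φ.Sat M x} with hX
  obtain ⟨k, x, l, hk, hl, hl1, hxe, hmean⟩ := exists_finite_branching (U := {φ // φ ∈ U})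
    (M.exitProb X m) (M.tsum_exitProb_le_one X m) (fun φ y => M.reach {t | φ.1.Sat M t} y)
    fun φ y => M.reach_le_one _ _
  have hkT : k ≤ T + 1 := by
    rw [Fintype.card_coe] at hk
    have := card_le_weight U
    omega
  -- the branches
  have hbranch : ∀ b : Fin k, ∃ (ι : Type) (_ : Fintype ι) (w : ι → ℝ)
      (p : ι → Lasso (ℕ × List ℕ)),
      Forest M I D T m (n * (B + 1) + 2 * B + 1) w p ∧ Tagged p b ∧
      Fintype.card ι ≤ (T + 1) ^ n ∧
      (∀ ψ, Formula.F .ge 1 ψ ∈ I → (Formula.F .ge 1 ψ).Sat M m → ψ.Sat M m ∨ AllHit p ψ) ∧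
      ∀ φ ∈ U, ((x b).elim 0 fun y => (M.reach {t | φ.Sat M t} y).toReal) ≤
        hitTotal w p fun y => φ ∈ claimsOf y := by
    intro b
    have hbT : (b : ℕ) ≤ T := by have := b.2; omega
    cases hxb : x b with
    | none =>
      -- no goal is reached on this branch, so that it only has to respect the claims in `I`
      obtain ⟨t, hmt, ht⟩ := exists_terminal (I := I) m
      obtain ⟨cs, hcs, hlen⟩ := exists_chainOk (I := I) hmt
      obtain ⟨p, hp, htg, hF⟩ := exists_forest_of_terminal hI hID hbT ht
      obtain ⟨p', hp', htg', hF', -⟩ := exists_forest_of_chainOk hI hID hbT hp htg hF hcs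
      refine ⟨Unit, inferInstance, _, p', hp'.mono ?_, htg', ?_, hF', ?_⟩
      · have : 0 ≤ n * (B + 1) := Nat.zero_le _
        omega
      · simpa using Nat.one_le_pow n (T + 1) (Nat.succ_pos T)
      · exact fun φ _ => massOf_nonneg hp'.valid.w_pos _
    | some y =>
      -- a goal is reached in `y`, and the construction is repeated there
      obtain ⟨hyX, hmy⟩ := M.exitProb_ne_zero (hxe b y hxb)
      obtain ⟨O', U', hO', hU', hD', hJ', hP', -, hlt⟩ :=
        exists_justified_of_goals (I := I) (D := D) U (fun φ hφ => (hP φ hφ).2) y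
      have hlt := hlt hyX
      obtain ⟨ι, hι, w, p, c, hp, hcard, hOc, hIc, hhead, hF, hhit⟩ :=
        ih (weight U') (by omega) y O' U' b rfl (by omega) hbT hD' hJ' hP'
      obtain ⟨cs, hcs, hlen⟩ := exists_chainOk (I := I) hmy
      obtain ⟨p', hp', htg', hF', hle⟩ := exists_forest_of_chainOk hI hID hbT hp
        (fun i => ⟨_, hhead i, rfl⟩) hF hcs
      refine ⟨ι, hι, w, p', hp'.mono ?_, htg', ?_, hF', ?_⟩
      · have h1 : (weight U' + 1) * (B + 1) ≤ n * (B + 1) :=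
          Nat.mul_le_mul_right _ (by omega)
        rw [Nat.succ_mul] at h1
        omega
      · exact hcard.trans (Nat.pow_le_pow_right (Nat.succ_pos T) (by omega))
      · intro φ hφ
        change (M.reach {t | φ.Sat M t} y).toReal ≤ _
        by_cases hs : φ.Sat M y
        · refine le_trans ?_ (hle _)
          have : hitTotal w p (fun y => φ ∈ claimsOf y) = 1 := by
            rw [← hp.total]
            refine massOf_of_forall fun i => ⟨elt b c, ?_, mem_claimsOf_elt.2 (hOc (hO' φ hφ hs))⟩
            exact List.mem_of_mem_head? (hhead i)
          rw [this, ← ENNReal.toReal_one]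
          exact ENNReal.toReal_mono ENNReal.one_ne_top (M.reach_le_one _ _)
        · exact (hhit φ (hU' φ hφ hs)).trans (hle _)
  choose ι hι w p hforest htagged hcard hF hhit using hbranch
  have hmix := Forest.mix hforest htagged (fun b b' h => Fin.ext h) hl hl1
  have hgoals : ∀ φ ∈ U, (M.reach {t | φ.Sat M t} m).toReal ≤
      hitTotal (fun y : Σ b, ι b => l y.1 * w y.1 y.2) (fun y => p y.1 y.2)
        fun y => φ ∈ claimsOf y := by
    intro φ hφ
    have h1 : M.reach {t | φ.Sat M t} m ≤
        ∑' y, M.exitProb X m y * M.reach {t | φ.Sat M t} y :=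
      M.reach_le_tsum_exitProb (T := {t | φ.Sat M t}) (X := X) (fun t ht => ⟨φ, hφ, ht⟩) m
    have h2 : ∑' y, M.exitProb X m y * M.reach {t | φ.Sat M t} y ≠ ∞ := by
      refine ne_top_of_le_ne_top ENNReal.one_ne_top (le_trans ?_ (M.tsum_exitProb_le_one X m))
      exact ENNReal.tsum_le_tsum fun y => mul_le_of_le_one_right zero_le (M.reach_le_one _ _)
    refine (ENNReal.toReal_mono h2 h1).trans ((hmean ⟨φ, hφ⟩).trans ?_)
    rw [hitTotal_mix]
    exact Finset.sum_le_sum fun b _ => mul_le_mul_of_nonneg_left (hhit b φ hφ) (hl b).le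
  have hgoalsF : ∀ ψ, Formula.F .ge 1 ψ ∈ I → (Formula.F .ge 1 ψ).Sat M m →
      ψ.Sat M m ∨ AllHit (fun y : Σ b, ι b => p y.1 y.2) ψ := by
    intro ψ hψ hs
    by_cases h : ψ.Sat M m
    · exact Or.inl h
    · exact Or.inr fun y => (hF y.1 ψ hψ hs).resolve_left h y.2
  have hroot := hmix.prepend hI hID hgoalsF hJ hOD hgoals htag
  refine ⟨Σ b, ι b, inferInstance, _, _, trueIn I m ∪ O, hroot.mono (by omega), ?_,
    Finset.subset_union_right,
    fun χ hχ hs => Finset.mem_union_left _ (mem_trueIn.2 ⟨hχ, hs⟩), fun i => rfl, ?_, ?_⟩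
  · rw [Fintype.card_sigma]
    calc ∑ b, Fintype.card (ι b) ≤ ∑ _b : Fin k, (T + 1) ^ n := Finset.sum_le_sum fun b _ => hcard b
      _ = k * (T + 1) ^ n := by simp
      _ ≤ (T + 1) * (T + 1) ^ n := Nat.mul_le_mul_right _ hkT
      _ = (T + 1) ^ (n + 1) := by rw [pow_succ, mul_comm]
  · intro ψ hψ hs i
    rcases hgoalsF ψ hψ hs with h | h
    · exact ⟨_, List.mem_cons_self, mem_claimsOf_elt.2
        (Finset.mem_union_left _ (mem_trueIn.2 ⟨hI.F_mem hψ, h⟩))⟩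
    · obtain ⟨y, hy, hyψ⟩ := h i
      exact ⟨y, List.mem_cons_of_mem _ hy, hyψ⟩
  · exact fun φ hφ => (hgoals φ hφ).trans (hitTotal_prepend_le hmix.valid.w_pos _ _)

end Extraction

/-! ### Subformulae and the extraction theorem -/

namespace Formula

section Subs

open scoped Classical

variable {A : Type u}

/-- The set of the subformulae of a formula. -/
noncomputable def subs : Formula A → Finset (Formula A)
  | atom a => {atom a}
  | natom a => {natom a}
  | and φ ψ => insert (and φ ψ) (subs φ ∪ subs ψ)
  | or φ ψ => insert (or φ ψ) (subs φ ∪ subs ψ)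
  | F c q φ => insert (F c q φ) (subs φ)
  | G c q φ => insert (G c q φ) (subs φ)

/-- The set of the subformulae that are of the form `G ψ` or lie in the scope of a `G`. -/
noncomputable def innerSubs : Formula A → Finset (Formula A)
  | atom _ => ∅
  | natom _ => ∅
  | and φ ψ => innerSubs φ ∪ innerSubs ψ
  | or φ ψ => innerSubs φ ∪ innerSubs ψ
  | F _ _ φ => innerSubs φ
  | G c q φ => subs (G c q φ)

theorem self_mem_subs (φ : Formula A) : φ ∈ subs φ := by
  cases φ <;> simp [subs]

theorem subs_subset {φ χ : Formula A} (h : χ ∈ subs φ) : subs χ ⊆ subs φ := by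
  induction φ with
  | atom a => rw [subs, Finset.mem_singleton] at h; rw [h]
  | natom a => rw [subs, Finset.mem_singleton] at h; rw [h]
  | and φ ψ h₁ h₂ | or φ ψ h₁ h₂ =>
    rw [subs, Finset.mem_insert, Finset.mem_union] at h
    rcases h with rfl | h | h
    · exact subset_rfl
    · exact (h₁ h).trans (Finset.subset_union_left.trans (Finset.subset_insert _ _))
    · exact (h₂ h).trans (Finset.subset_union_right.trans (Finset.subset_insert _ _))
  | F c q φ ih | G c q φ ih =>
    rw [subs, Finset.mem_insert] at h
    rcases h with rfl | h
    · exact subset_rfl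
    · exact (ih h).trans (Finset.subset_insert _ _)

theorem subs_subset_innerSubs {φ χ : Formula A} (h : χ ∈ innerSubs φ) : subs χ ⊆ innerSubs φ := by
  induction φ with
  | atom a | natom a => exact absurd h (Finset.notMem_empty _)
  | and φ ψ h₁ h₂ | or φ ψ h₁ h₂ =>
    rcases Finset.mem_union.1 h with h | h
    · exact (h₁ h).trans Finset.subset_union_left
    · exact (h₂ h).trans Finset.subset_union_right
  | F c q φ ih => exact ih h
  | G c q φ ih => exact subs_subset h

theorem innerSubs_subset_subs (φ : Formula A) : innerSubs φ ⊆ subs φ := by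
  induction φ with
  | atom a | natom a => exact Finset.empty_subset _
  | and φ ψ h₁ h₂ | or φ ψ h₁ h₂ =>
    exact (Finset.union_subset_union h₁ h₂).trans (Finset.subset_insert _ _)
  | F c q φ ih => exact ih.trans (Finset.subset_insert _ _)
  | G c q φ ih => exact subset_rfl

theorem IsInner.of_mem_subs {φ χ : Formula A} (hφ : φ.IsInner) (h : χ ∈ subs φ) : χ.IsInner := by
  induction hφ with
  | atom a => rw [subs, Finset.mem_singleton] at h; rw [h]; exact .atom a
  | natom a => rw [subs, Finset.mem_singleton] at h; rw [h]; exact .natom a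
  | and hφ hψ h₁ h₂ =>
    rw [subs, Finset.mem_insert, Finset.mem_union] at h
    rcases h with rfl | h | h
    exacts [.and hφ hψ, h₁ h, h₂ h]
  | or hφ hψ h₁ h₂ =>
    rw [subs, Finset.mem_insert, Finset.mem_union] at h
    rcases h with rfl | h | h
    exacts [.or hφ hψ, h₁ h, h₂ h]
  | F hφ ih =>
    rw [subs, Finset.mem_insert] at h
    rcases h with rfl | h
    exacts [.F hφ, ih h]
  | G hφ ih =>
    rw [subs, Finset.mem_insert] at h
    rcases h with rfl | h
    exacts [.G hφ, ih h]

theorem InFragment.isInner_of_mem_innerSubs {φ χ : Formula A} (hφ : φ.InFragment)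
    (h : χ ∈ innerSubs φ) : χ.IsInner := by
  induction hφ with
  | atom a | natom a => exact absurd h (Finset.notMem_empty _)
  | and _ _ h₁ h₂ | or _ _ h₁ h₂ => exact (Finset.mem_union.1 h).elim h₁ h₂
  | F c q _ ih => exact ih h
  | G hψ => exact (IsInner.G hψ).of_mem_subs h

theorem InFragment.innerClosed {φ : Formula A} (hφ : φ.InFragment) :
    InnerClosed (innerSubs φ) where
  inner _ h := hφ.isInner_of_mem_innerSubs h
  and_mem h :=
    ⟨subs_subset_innerSubs h (by simp [subs, self_mem_subs]),
      subs_subset_innerSubs h (by simp [subs, self_mem_subs])⟩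
  or_mem h :=
    ⟨subs_subset_innerSubs h (by simp [subs, self_mem_subs]),
      subs_subset_innerSubs h (by simp [subs, self_mem_subs])⟩
  F_mem h := subs_subset_innerSubs h (by simp [subs, self_mem_subs])
  G_mem h := subs_subset_innerSubs h (by simp [subs, self_mem_subs])

theorem within_of_subset {I D : Finset (Formula A)} {φ : Formula A} (hD : subs φ ⊆ D)
    (hI : innerSubs φ ⊆ I) : Within I D φ := by
  induction φ with
  | atom a | natom a => exact hD (self_mem_subs _)
  | and φ ψ h₁ h₂ | or φ ψ h₁ h₂ =>
    refine ⟨hD (self_mem_subs _), h₁ ?_ ?_, h₂ ?_ ?_⟩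
    · exact (subs_subset (by simp [subs, self_mem_subs])).trans hD
    · exact Finset.subset_union_left.trans hI
    · exact (subs_subset (by simp [subs, self_mem_subs])).trans hD
    · exact Finset.subset_union_right.trans hI
  | F c q φ ih =>
    exact ⟨hD (self_mem_subs _), ih ((subs_subset (by simp [subs, self_mem_subs])).trans hD) hI⟩
  | G c q φ ih => exact ⟨hD (self_mem_subs _), hI (self_mem_subs _)⟩

theorem card_subs_le (φ : Formula A) : (subs φ).card ≤ φ.length := by
  induction φ with
  | atom a | natom a => exact (Finset.card_singleton _).le
  | and φ ψ h₁ h₂ | or φ ψ h₁ h₂ =>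
    refine (Finset.card_insert_le _ _).trans (Nat.succ_le_succ ?_)
    exact (Finset.card_union_le _ _).trans (Nat.add_le_add h₁ h₂)
  | F c q φ ih | G c q φ ih => exact (Finset.card_insert_le _ _).trans (Nat.succ_le_succ ih)

theorem goalCount_union_le (s t : Finset (Formula A)) :
    Extraction.goalCount (s ∪ t) ≤ Extraction.goalCount s + Extraction.goalCount t := by
  unfold Extraction.goalCount
  rw [Finset.filter_union]
  exact Finset.card_union_le _ _

theorem goalCount_insert_le (χ : Formula A) (s : Finset (Formula A)) :
    Extraction.goalCount (insert χ s) ≤ Extraction.goalCount s + 1 := by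
  have h := goalCount_union_le {χ} s
  have h1 : Extraction.goalCount {χ} ≤ 1 :=
    (Finset.card_filter_le _ _).trans (Finset.card_singleton _).le
  rw [Finset.insert_eq]
  omega

theorem goalCount_subs_lt (φ : Formula A) : Extraction.goalCount (subs φ) < φ.length := by
  induction φ with
  | atom a | natom a =>
    simp [subs, length, Extraction.goalCount, Finset.filter_singleton]
  | and φ ψ h₁ h₂ | or φ ψ h₁ h₂ =>
    have := goalCount_union_le (subs φ) (subs ψ)
    refine (goalCount_insert_le _ _).trans_lt ?_
    simp only [length]
    omega
  | F c q φ ih | G c q φ ih => exact (goalCount_insert_le _ _).trans_lt (Nat.succ_lt_succ ih)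

/-- The operators `F` counted on the left are different, and at least one literal is left over. -/
theorem outerF_add_goalCount_lt (φ : Formula A) :
    φ.outerF + Extraction.goalCount (innerSubs φ) < φ.length := by
  induction φ with
  | atom a | natom a => simp [innerSubs, outerF, length, Extraction.goalCount]
  | and φ ψ h₁ h₂ | or φ ψ h₁ h₂ =>
    have := goalCount_union_le (innerSubs φ) (innerSubs ψ)
    simp only [length, outerF, innerSubs]
    omega
  | F c q φ ih =>
    simp only [length, outerF, innerSubs]
    omega
  | G c q φ ih =>
    simp only [outerF, innerSubs]
    rw [zero_add]
    exact goalCount_subs_lt _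

variable [Primcodable A]

theorem code_le_of_mem_subs {φ χ : Formula A} (h : χ ∈ subs φ) : χ.code ≤ φ.code := by
  induction φ with
  | atom a | natom a => rw [subs, Finset.mem_singleton] at h; rw [h]
  | and φ ψ h₁ h₂ | or φ ψ h₁ h₂ =>
    rw [subs, Finset.mem_insert, Finset.mem_union] at h
    rcases h with rfl | h | h
    · exact le_rfl
    · exact (h₁ h).trans ((Nat.left_le_pair _ _).trans (Nat.right_le_pair _ _))
    · exact (h₂ h).trans ((Nat.right_le_pair _ _).trans (Nat.right_le_pair _ _))
  | F c q φ ih | G c q φ ih =>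
    rw [subs, Finset.mem_insert] at h
    rcases h with rfl | h
    · exact le_rfl
    · exact (ih h).trans ((Nat.right_le_pair _ _).trans (Nat.right_le_pair _ _))

theorem length_le_code (φ : Formula A) : φ.length ≤ φ.code + 1 := by
  induction φ with
  | atom a | natom a => exact Nat.succ_le_succ (Nat.zero_le _)
  | and φ ψ h₁ h₂ =>
    have h := Nat.add_le_pair φ.code ψ.code
    have h' := Nat.add_le_pair 2 (Nat.pair φ.code ψ.code)
    simp only [length, code]
    omega
  | or φ ψ h₁ h₂ =>
    have h := Nat.add_le_pair φ.code ψ.code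
    have h' := Nat.add_le_pair 3 (Nat.pair φ.code ψ.code)
    simp only [length, code]
    omega
  | F c q φ ih =>
    have h := Nat.add_le_pair (Nat.pair c.code (ratCode q)) φ.code
    have h' := Nat.add_le_pair 4 (Nat.pair (Nat.pair c.code (ratCode q)) φ.code)
    simp only [length, code]
    omega
  | G c q φ ih =>
    have h := Nat.add_le_pair (Nat.pair c.code (ratCode q)) φ.code
    have h' := Nat.add_le_pair 5 (Nat.pair (Nat.pair c.code (ratCode q)) φ.code)
    simp only [length, code]
    omega

end Subs

end Formula

namespace Extraction

open Formula PCTL.Bundle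

variable {A : Type u} [Primcodable A]

/-- A bundle all of whose lassos start with the same element, which claims `φ`. -/
structure Proves {ι : Type} [Fintype ι] (φ : Formula A) (w : ι → ℝ) (p : ι → Lasso (ℕ × List ℕ)) :
    Prop where
  valid : Valid (claimsOf (A := A)) w p
  nonempty : Nonempty ι
  head : ∃ x, φ ∈ claimsOf x ∧ ∀ i, (p i).full.head? = some x

/-- A satisfiable formula of the fragment is proved by a bundle of bounded size. -/
theorem exists_proves {φ : Formula A} (hφ : φ.InFragment) (hs : φ.Satisfiable) :
    ∃ (ι : Type) (_ : Fintype ι) (w : ι → ℝ) (p : ι → Lasso (ℕ × List ℕ)), Proves φ w p ∧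
      Fintype.card ι ≤ (φ.length + 1) ^ (φ.length + 1) ∧
      (∀ i, (p i).full.length ≤ φ.length ^ 2 + 1) ∧
      ∀ i, ∀ y ∈ (p i).full, y.1 ≤ φ.length ∧ y.2.length ≤ φ.length ∧
        ∀ r ∈ y.2, r ≤ φ.code ∧ ∃ χ : Formula A, χ.code = r := by
  obtain ⟨M, hM⟩ := hs
  have hI := hφ.innerClosed
  have hID := innerSubs_subset_subs φ
  obtain ⟨O, U, hφO, hOD, hJ, hP, hU⟩ :=
    exists_justified (I := innerSubs φ) (within_of_subset subset_rfl subset_rfl) hM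
  have hlt := outerF_add_goalCount_lt φ
  obtain ⟨ι, hι, w, p, c, hf, hcard, hOc, -, hhead, -, -⟩ :=
    exists_forest (T := φ.length) hI hID (weight U) M.init O U 0 rfl (by omega) (Nat.zero_le _) hOD
      hJ hP
  refine ⟨ι, hι, w, p, ⟨hf.valid, ?_, elt 0 c, mem_claimsOf_elt.2 (hOc hφO), hhead⟩, ?_, ?_, ?_⟩
  · by_contra hne
    rw [not_nonempty_iff] at hne
    have := hf.total
    rw [Finset.univ_eq_empty, Finset.sum_empty] at this
    exact zero_ne_one this
  · exact hcard.trans (Nat.pow_le_pow_right (Nat.succ_pos _) (by omega))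
  · intro i
    refine (hf.length_le i).trans ?_
    generalize weight U = a at *
    generalize goalCount (innerSubs φ) = b at *
    -- `a (b + 1) + 2 b + 2 ≤ (a + b + 1) ^ 2 + 1`
    have h1 : a + b + 1 ≤ φ.length := by omega
    have h2 := Nat.pow_le_pow_left h1 2
    nlinarith [Nat.zero_le a, Nat.zero_le b, Nat.zero_le (a * a), Nat.zero_le (a * b),
      Nat.zero_le (b * b)]
  · intro i y hy
    obtain ⟨tag, htag, s, hs, rfl⟩ := hf.content i y hy
    refine ⟨htag, ?_, ?_⟩
    · change (s.toList.map Formula.code).length ≤ _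
      rw [List.length_map, Finset.length_toList]
      exact (Finset.card_le_card hs).trans (card_subs_le φ)
    · intro r hr
      obtain ⟨χ, hχ, rfl⟩ := List.mem_map.1 hr
      exact ⟨code_le_of_mem_subs (hs (Finset.mem_toList.1 hχ)), χ, rfl⟩

/-- A formula of the fragment that is proved by a bundle has a model on the tree of the bundle. -/
theorem Proves.exists_model {ι : Type} [Fintype ι] {φ : Formula A} {w : ι → ℝ}
    {p : ι → Lasso (ℕ × List ℕ)} (h : Proves φ w p) (hφ : φ.InFragment) {L : ℕ}
    (hL : ∀ i, (p i).full.length ≤ L + 1) :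
    ∃ M : MarkovChain A, φ.Sat M M.init ∧ (∃ l ≤ L, M.HasHeight l) ∧ Finite M.S ∧
      Nat.card M.S ≤ Fintype.card ι * (L + 1) := by
  have := h.nonempty
  obtain ⟨x, hx, hhead⟩ := h.head
  have hpre : ∀ i, [x] <+: (p i).full := by
    intro i
    obtain ⟨l, hl⟩ := List.head?_eq_some_iff.1 (hhead i)
    exact ⟨l, hl.symm⟩
  let root : Node p := ⟨[x], List.cons_ne_nil _ _, Classical.arbitrary ι, hpre _⟩
  refine ⟨chain claimsOf h.valid.w_pos root, ?_, ?_, ?_, ?_⟩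
  · exact h.valid.sat root hφ root hx
  · exact h.valid.hasHeight root rfl hpre hL
  · exact inferInstanceAs (Finite (Node p))
  · exact card_node_le hL

end Extraction

/-! ### Small integer solutions of homogeneous linear systems -/

namespace Linear

/-- `v ≥ 0`, and `v > 0` if the flag is set. -/
def NonnegOrPos {R : Type*} [Zero R] [LE R] [LT R] (strict : Bool) (v : R) : Prop :=
  0 ≤ v ∧ (strict = true → 0 < v)

/-- A bound on the coefficients after the elimination of `N` variables. -/
def growth (K N : ℕ) : ℕ := (fun k => 2 * k ^ 2)^[N] K

/-- A bound on the solutions in `N` variables if all coefficients that arise in the elimination are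
bounded by `K`. -/
def solBound (K : ℕ) : ℕ → ℕ
  | 0 => 0
  | N + 1 => 2 * (N * K * (K.factorial * solBound K N) + 1) + 2 * (K.factorial * solBound K N)

theorem le_two_mul_sq (k : ℕ) : k ≤ 2 * k ^ 2 := by
  rcases Nat.eq_zero_or_pos k with rfl | h
  · simp
  · nlinarith

theorem le_growth (K N : ℕ) : K ≤ growth K N :=
  Function.id_le_iterate_of_id_le (f := fun k => 2 * k ^ 2) le_two_mul_sq N K

theorem abs_sum_mul_le {N : ℕ} {a z : Fin N → ℤ} {K B : ℕ} (ha : ∀ i, |a i| ≤ K)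
    (hz : ∀ i, |z i| ≤ B) : |∑ i, a i * z i| ≤ N * K * B := by
  calc |∑ i, a i * z i| ≤ ∑ i, |a i * z i| := Finset.abs_sum_le_sum_abs _ _
    _ ≤ ∑ _i : Fin N, (K * B : ℤ) := Finset.sum_le_sum fun i _ => by
        rw [abs_mul]
        exact mul_le_mul (ha i) (hz i) (abs_nonneg _) (Int.natCast_nonneg _)
    _ = N * K * B := by simp [mul_assoc]

/-- Fourier–Motzkin elimination with explicit bounds: a homogeneous system of integral inequalities
with a real solution has a small integral one. The coefficients of the system are bounded by `k`,
those of the systems obtained by elimination by `K`. The bound on the solution does not depend on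
the number of inequalities, which may be infinite. -/
theorem exists_int_solution (K : ℕ) : ∀ (N k : ℕ) (S : Set (Bool × (Fin N → ℤ))), growth k N ≤ K →
    (∀ c ∈ S, ∀ i, |c.2 i| ≤ k) →
    (∃ x : Fin N → ℝ, ∀ c ∈ S, NonnegOrPos c.1 (∑ i, (c.2 i : ℝ) * x i)) →
    ∃ z : Fin N → ℤ, (∀ i, |z i| ≤ solBound K N) ∧ ∀ c ∈ S, NonnegOrPos c.1 (∑ i, c.2 i * z i) := by
  intro N
  induction N with
  | zero =>
    rintro k S - - ⟨x, hx⟩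
    refine ⟨fun i => i.elim0, fun i => i.elim0, fun c hc => ?_⟩
    have := hx c hc
    simp only [Finset.univ_eq_empty, Finset.sum_empty, NonnegOrPos, lt_irrefl] at this ⊢
    exact ⟨le_rfl, this.2⟩
  | succ N ih =>
    rintro k S hk hS ⟨x, hx⟩
    have hkK : k ≤ K := (le_growth k (N + 1)).trans hk
    -- the constraints without the first variable, and the sums of those that cancel it
    let S' : Set (Bool × (Fin N → ℤ)) := {c | (∃ d ∈ S, d.2 0 = 0 ∧ c = (d.1, Fin.tail d.2)) ∨
      ∃ l ∈ S, ∃ u ∈ S, 0 < l.2 0 ∧ u.2 0 < 0 ∧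
        c = (l.1 || u.1, fun i => -u.2 0 * l.2 i.succ + l.2 0 * u.2 i.succ)}
    obtain ⟨y, hyB, hy⟩ := ih (2 * k ^ 2) S' hk (by
      rintro c (⟨d, hd, -, rfl⟩ | ⟨l, hl, u, hu, -, -, rfl⟩) i
      · have h1 := hS d hd i.succ
        have h2 : (k : ℤ) ≤ ((2 * k ^ 2 : ℕ) : ℤ) := by exact_mod_cast le_two_mul_sq k
        exact h1.trans h2
      · change |-u.2 0 * l.2 i.succ + l.2 0 * u.2 i.succ| ≤ _
        refine (abs_add_le _ _).trans ?_
        rw [abs_mul, abs_mul, abs_neg]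
        have h1 := mul_le_mul (hS u hu 0) (hS l hl i.succ) (abs_nonneg _) (Int.natCast_nonneg k)
        have h2 := mul_le_mul (hS l hl 0) (hS u hu i.succ) (abs_nonneg _) (Int.natCast_nonneg k)
        push_cast
        linarith) (by
      refine ⟨Fin.tail x, ?_⟩
      rintro c (⟨d, hd, hd0, rfl⟩ | ⟨l, hl, u, hu, hl0, hu0, rfl⟩)
      · have := hx d hd
        rw [Fin.sum_univ_succ, hd0, Int.cast_zero, zero_mul, zero_add] at this
        exact this
      · have hl1 := hx l hl
        have hu1 := hx u hu
        have hsum : ∑ i, (((-u.2 0 * l.2 i.succ + l.2 0 * u.2 i.succ : ℤ)) : ℝ) * Fin.tail x i =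
            -(u.2 0 : ℝ) * (∑ i, (l.2 i : ℝ) * x i) + (l.2 0 : ℝ) * ∑ i, (u.2 i : ℝ) * x i := by
          rw [Fin.sum_univ_succ, Fin.sum_univ_succ, mul_add, mul_add, Finset.mul_sum,
            Finset.mul_sum]
          have : ∑ i, (((-u.2 0 * l.2 i.succ + l.2 0 * u.2 i.succ : ℤ)) : ℝ) * Fin.tail x i =
              ∑ i : Fin N, -(u.2 0 : ℝ) * (l.2 i.succ * x i.succ) +
              ∑ i : Fin N, (l.2 0 : ℝ) * (u.2 i.succ * x i.succ) := by
            rw [← Finset.sum_add_distrib]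
            refine Finset.sum_congr rfl fun i _ => ?_
            rw [Fin.tail]
            push_cast
            ring
          rw [this]
          ring
        have hl0' : (0 : ℝ) < l.2 0 := by exact_mod_cast hl0
        have hu0' : (0 : ℝ) < -(u.2 0 : ℝ) := by
          have : (u.2 0 : ℝ) < 0 := by exact_mod_cast hu0
          linarith
        change NonnegOrPos _ (∑ i, (((-u.2 0 * l.2 i.succ + l.2 0 * u.2 i.succ : ℤ)) : ℝ) *
          Fin.tail x i)
        rw [hsum]
        have n1 := mul_nonneg hu0'.le hl1.1
        have n2 := mul_nonneg hl0'.le hu1.1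
        refine ⟨add_nonneg n1 n2, fun hs => ?_⟩
        rcases Bool.or_eq_true_iff.1 hs with hs | hs
        · exact add_pos_of_pos_of_nonneg (mul_pos hu0' (hl1.2 hs)) n2
        · exact add_pos_of_nonneg_of_pos n1 (mul_pos hl0' (hu1.2 hs)))
    -- scaled by `K!`, the solution makes all bounds on the first variable integral
    set F : ℕ := K.factorial with hF
    have hFpos : 0 < (F : ℤ) := by exact_mod_cast K.factorial_pos
    have hdvd : ∀ a : ℤ, a ≠ 0 → |a| ≤ k → a ∣ F := by
      intro a ha hak
      rw [← Int.natAbs_dvd, Int.natCast_dvd_natCast]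
      refine Nat.dvd_factorial (Int.natAbs_pos.2 ha) ?_
      have : (a.natAbs : ℤ) ≤ k := by rwa [Int.natCast_natAbs]
      omega
    let v : (Fin (N + 1) → ℤ) → ℤ := fun a => ∑ i : Fin N, a i.succ * (F * y i)
    have hv : ∀ a, v a = F * ∑ i : Fin N, a i.succ * y i := by
      intro a
      rw [Finset.mul_sum]
      exact Finset.sum_congr rfl fun i _ => by ring
    set R : ℕ := N * K * (F * solBound K N) with hR
    have hvR : ∀ c ∈ S, |v c.2| ≤ R := by
      intro c hc
      have := abs_sum_mul_le (a := fun i => c.2 i.succ) (z := fun i => F * y i) (K := K)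
        (B := F * solBound K N) (fun i => (hS c hc i.succ).trans (by exact_mod_cast hkK))
        (fun i => by
          rw [abs_mul, abs_of_pos hFpos]
          push_cast
          exact mul_le_mul_of_nonneg_left (hyB i) hFpos.le)
      rw [hR]
      exact_mod_cast this
    have hquot : ∀ a b w : ℤ, 0 < a → a * b = w → |w| ≤ R → |b| ≤ R := by
      intro a b w ha hab hw
      rw [← hab, abs_mul, abs_of_pos ha] at hw
      nlinarith [abs_nonneg b]
    -- the lower and the upper bounds on the first variable; the additional bounds `±(R + 1)` are
    -- weaker than all others and ensure that both kinds exist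
    let Lo : ℤ → Prop := fun b => b = -(R + 1) ∨ ∃ l ∈ S, 0 < l.2 0 ∧ l.2 0 * b = -v l.2
    let Up : ℤ → Prop := fun b => b = R + 1 ∨ ∃ u ∈ S, u.2 0 < 0 ∧ -u.2 0 * b = v u.2
    have hLoB : ∀ b, Lo b → -(R + 1) ≤ b ∧ b ≤ R := by
      rintro b (rfl | ⟨l, hl, hl0, hb⟩)
      · constructor <;> linarith [Int.natCast_nonneg R]
      · have := abs_le.1 (hquot _ _ _ hl0 hb (by rw [abs_neg]; exact hvR l hl))
        constructor <;> linarith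
    have hUpB : ∀ b, Up b → -R ≤ b ∧ b ≤ R + 1 := by
      rintro b (rfl | ⟨u, hu, hu0, hb⟩)
      · constructor <;> linarith [Int.natCast_nonneg R]
      · have := abs_le.1 (hquot _ _ _ (neg_pos.2 hu0) hb (hvR u hu))
        constructor <;> linarith
    obtain ⟨m, hm, hmax⟩ := Int.exists_greatest_of_bdd (P := Lo) ⟨R, fun b hb => (hLoB b hb).2⟩
      ⟨_, Or.inl rfl⟩
    obtain ⟨M, hM, hmin⟩ := Int.exists_least_of_bdd (P := Up) ⟨-R, fun b hb => (hUpB b hb).1⟩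
      ⟨_, Or.inl rfl⟩
    have hLU : ∀ l ∈ S, 0 < l.2 0 → ∀ b, l.2 0 * b = -v l.2 → ∀ u ∈ S, u.2 0 < 0 →
        ∀ b', -u.2 0 * b' = v u.2 → b ≤ b' ∧ ((l.1 || u.1) = true → b < b') := by
      intro l hl hl0 b hb u hu hu0 b' hb'
      have h := hy _ (Or.inr ⟨l, hl, u, hu, hl0, hu0, rfl⟩)
      have hsum : ∑ i, (-u.2 0 * l.2 i.succ + l.2 0 * u.2 i.succ) * y i =
          -u.2 0 * (∑ i : Fin N, l.2 i.succ * y i) + l.2 0 * ∑ i : Fin N, u.2 i.succ * y i := by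
        rw [Finset.mul_sum, Finset.mul_sum, ← Finset.sum_add_distrib]
        exact Finset.sum_congr rfl fun i _ => by ring
      have hprod : (F : ℤ) * ∑ i, (-u.2 0 * l.2 i.succ + l.2 0 * u.2 i.succ) * y i =
          (l.2 0 * -u.2 0) * (b' - b) := by
        rw [hsum, mul_add, mul_left_comm, mul_left_comm (F : ℤ) (l.2 0), ← hv, ← hv, ← hb',
          ← neg_neg (v l.2), ← hb]
        ring
      have hpos : 0 < l.2 0 * -u.2 0 := mul_pos hl0 (neg_pos.2 hu0)
      constructor
      · have := mul_nonneg hFpos.le h.1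
        rw [hprod] at this
        linarith [nonneg_of_mul_nonneg_right this hpos]
      · intro hs
        have := mul_pos hFpos (h.2 hs)
        rw [hprod] at this
        linarith [(pos_iff_pos_of_mul_pos this).1 hpos]
    -- the first variable is put halfway between the bounds; doubling all values keeps it integral
    refine ⟨Fin.cons (m + M) fun i => 2 * (F * y i), ?_, ?_⟩
    · have e : ((solBound K (N + 1) : ℕ) : ℤ) = 2 * (R + 1) + 2 * (F * solBound K N) := by
        rw [solBound, hR, hF]
        push_cast
        ring
      have e0 : (0 : ℤ) ≤ F * solBound K N := by positivity
      intro i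
      rw [e]
      refine Fin.cases ?_ (fun i => ?_) i
      · rw [Fin.cons_zero, abs_le]
        have := hLoB m hm
        have := hUpB M hM
        constructor <;> linarith
      · rw [Fin.cons_succ, abs_mul, abs_mul, abs_of_pos hFpos, abs_two]
        have := mul_le_mul_of_nonneg_left (hyB i) hFpos.le
        linarith [Int.natCast_nonneg R]
    · intro c hc
      have hval : ∑ i, c.2 i * (Fin.cons (m + M) fun i => 2 * (F * y i) : Fin (N + 1) → ℤ) i =
          c.2 0 * (m + M) + 2 * v c.2 := by
        rw [Fin.sum_univ_succ, Fin.cons_zero, Finset.mul_sum]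
        congr 1
        exact Finset.sum_congr rfl fun i _ => by rw [Fin.cons_succ]; ring
      rw [hval]
      rcases lt_trichotomy (c.2 0) 0 with h0 | h0 | h0
      · obtain ⟨e, he⟩ := hdvd _ h0.ne (hS c hc 0)
        have hb : -c.2 0 * (-e * ∑ i : Fin N, c.2 i.succ * y i) = v c.2 := by
          rw [hv, he]; ring
        set b := -e * ∑ i : Fin N, c.2 i.succ * y i
        have h1 : M ≤ b := hmin b (Or.inr ⟨c, hc, h0, hb⟩)
        have h2 : m ≤ b ∧ (c.1 = true → m < b) := by
          rcases hm with rfl | ⟨l, hl, hl0, hlm⟩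
          · have := (hUpB b (Or.inr ⟨c, hc, h0, hb⟩)).1
            exact ⟨by linarith, fun _ => by linarith⟩
          · exact (hLU l hl hl0 m hlm c hc h0 b hb).imp_right fun h hs => h (by simp [hs])
        rw [← hb]
        constructor
        · nlinarith
        · intro hs
          nlinarith [h2.2 hs]
      · have := hy _ (Or.inl ⟨c, hc, h0, rfl⟩)
        rw [h0, zero_mul, zero_add, hv]
        refine ⟨?_, fun hs => ?_⟩
        · exact mul_nonneg zero_le_two (mul_nonneg hFpos.le this.1)
        · exact mul_pos zero_lt_two (mul_pos hFpos (this.2 hs))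
      · obtain ⟨e, he⟩ := hdvd _ h0.ne' (hS c hc 0)
        have hb : c.2 0 * (-e * ∑ i : Fin N, c.2 i.succ * y i) = -v c.2 := by
          rw [hv, he]; ring
        set b := -e * ∑ i : Fin N, c.2 i.succ * y i
        have h1 : b ≤ m := hmax b (Or.inr ⟨c, hc, h0, hb⟩)
        have h2 : b ≤ M ∧ (c.1 = true → b < M) := by
          rcases hM with rfl | ⟨u, hu, hu0, huM⟩
          · have := (hLoB b (Or.inr ⟨c, hc, h0, hb⟩)).2
            exact ⟨by linarith, fun _ => by linarith⟩
          · exact (hLU c hc h0 b hb u hu hu0 M huM).imp_right fun h hs => h (by simp [hs])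
        have hb' : v c.2 = -(c.2 0 * b) := by rw [hb, neg_neg]
        rw [hb']
        constructor
        · nlinarith
        · intro hs
          nlinarith [h2.2 hs]

end Linear

/-! ### Integral weights and certificates -/

theorem num_nonneg (q : Set.Icc (0 : ℚ) 1) : 0 ≤ (q : ℚ).num := Rat.num_nonneg.2 q.2.1

theorem num_le_den (q : Set.Icc (0 : ℚ) 1) : (q : ℚ).num ≤ (q : ℚ).den := by
  have h := q.2.2
  rw [← Rat.num_div_den (q : ℚ), div_le_one (by exact_mod_cast (q : ℚ).den_pos)] at h
  exact_mod_cast h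

/-- The encoding of the integers sends a nonnegative integer `k` to `2 * k`. -/
theorem ratCode_eq (q : Set.Icc (0 : ℚ) 1) :
    ratCode q = Nat.pair (2 * (q : ℚ).num.toNat) (q : ℚ).den := by
  have h : ((q : ℚ).num.toNat : ℤ) = (q : ℚ).num := Int.toNat_of_nonneg (num_nonneg q)
  rw [ratCode, ← h]
  rfl

namespace Comparison

/-- Whether the comparison is strict. -/
def strict : Comparison → Bool
  | .ge => false
  | .gt => true

/-- After multiplication by the denominator of `q`, a comparison is an integral linear
inequality. -/
theorem holds_iff {c : Comparison} {q : Set.Icc (0 : ℚ) 1} {x m : ℝ} :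
    c.Holds x (((q : ℚ) : ℝ) * m) ↔
      Linear.NonnegOrPos c.strict (((q : ℚ).den : ℝ) * x - ((q : ℚ).num : ℝ) * m) := by
  have hd : (0 : ℝ) < (q : ℚ).den := by exact_mod_cast (q : ℚ).den_pos
  have hq : (((q : ℚ) : ℝ)) * (q : ℚ).den = (q : ℚ).num := by
    exact_mod_cast Rat.mul_den_eq_num (q : ℚ)
  have e : ((q : ℚ).den : ℝ) * x - ((q : ℚ).num : ℝ) * m =
      (q : ℚ).den * (x - ((q : ℚ) : ℝ) * m) := by rw [← hq]; ring
  rw [e]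
  cases c with
  | ge =>
    simp only [Holds, Linear.NonnegOrPos, strict, Bool.false_eq_true, false_imp_iff, and_true]
    rw [mul_nonneg_iff_of_pos_left hd, sub_nonneg]
  | gt =>
    simp only [Holds, Linear.NonnegOrPos, strict, true_imp_iff]
    rw [mul_pos_iff_of_pos_left hd, mul_nonneg_iff_of_pos_left hd, sub_pos]
    exact ⟨fun h => ⟨sub_nonneg.2 h.le, h⟩, fun h => h.2⟩

end Comparison

namespace Bundle

theorem massOf_comp {ι κ : Type} [Fintype ι] [Fintype κ] (e : κ ≃ ι) (w : ι → ℝ) (P : ι → Prop) :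
    massOf (w ∘ e) (P ∘ e) = massOf w P := by
  classical
  simp only [massOf, Finset.sum_filter]
  exact e.sum_comp fun i => if P i then w i else 0

theorem massOf_eq_sum {ι : Type} [Fintype ι] (w : ι → ℝ) (P : ι → Prop) [DecidablePred P] :
    massOf w P = ∑ i, if P i then w i else 0 := by
  rw [← Finset.sum_filter]
  unfold massOf
  congr

end Bundle

namespace Extraction

open Formula PCTL.Bundle

variable {A : Type u} [Primcodable A]

theorem Proves.reindex {ι κ : Type} [Fintype ι] [Fintype κ] {φ : Formula A} {w : ι → ℝ}
    {p : ι → Lasso (ℕ × List ℕ)} (h : Proves φ w p) (e : κ ≃ ι) : Proves φ (w ∘ e) (p ∘ e) where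
  valid :=
    { w_pos := fun i => h.valid.w_pos _
      cyc_ne := fun i => h.valid.cyc_ne _
      nonbranching := fun i j => h.valid.nonbranching _ _
      claims := by
        intro i d x hx χ hχ
        have hc := h.valid.claims (e i) d x hx χ hχ
        cases χ with
        | atom a | natom a | and φ ψ | or φ ψ | G c q φ => exact hc
        | F c q φ =>
          have h1 := massOf_comp e w fun j => (p (e i)).Through d (p j)
          have h2 := massOf_comp e w fun j =>
            (p (e i)).Through d (p j) ∧ ∃ y ∈ (p j).fut d, φ ∈ claimsOf y
          change c.Holds (massOf (w ∘ e) ((fun j =>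
            (p (e i)).Through d (p j) ∧ ∃ y ∈ (p j).fut d, φ ∈ claimsOf y) ∘ e))
            (((q : ℚ) : ℝ) * massOf (w ∘ e) ((fun j => (p (e i)).Through d (p j)) ∘ e))
          rw [h1, h2]
          exact hc }
  nonempty := h.nonempty.map e.symm
  head := by
    obtain ⟨x, hx, hh⟩ := h.head
    exact ⟨x, hx, fun i => hh _⟩

open Classical in
/-- The coefficient of the weight of the lasso `r` in the inequality that expresses the claim `F q
φ`, made at the position `d` of the lasso `l`. -/
noncomputable def coef (q : Set.Icc (0 : ℚ) 1) (φ : Formula A) (l : Lasso (ℕ × List ℕ)) (d : ℕ)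
    (r : Lasso (ℕ × List ℕ)) : ℤ :=
  (if l.Through d r ∧ ∃ y ∈ r.fut d, φ ∈ claimsOf y then ((q : ℚ).den : ℤ) else 0) -
    if l.Through d r then (q : ℚ).num else 0

theorem abs_coef_le (q : Set.Icc (0 : ℚ) 1) (φ : Formula A) (l : Lasso (ℕ × List ℕ)) (d : ℕ)
    (r : Lasso (ℕ × List ℕ)) : |coef q φ l d r| ≤ (q : ℚ).den := by
  have h0 := num_nonneg q
  have h1 := num_le_den q
  rw [coef, abs_le]
  split_ifs <;> constructor <;> omega

theorem sum_coef_mul {ι : Type} [Fintype ι] (q : Set.Icc (0 : ℚ) 1) (φ : Formula A)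
    (l : Lasso (ℕ × List ℕ)) (d : ℕ) (w : ι → ℝ) (p : ι → Lasso (ℕ × List ℕ)) :
    ∑ i, (coef q φ l d (p i) : ℝ) * w i =
      ((q : ℚ).den : ℝ) * hitMass w p l d (fun y => φ ∈ claimsOf y) -
        ((q : ℚ).num : ℝ) * passMass w p l d := by
  classical
  rw [hitMass, passMass, massOf_eq_sum, massOf_eq_sum, Finset.mul_sum, Finset.mul_sum,
    ← Finset.sum_sub_distrib]
  refine Finset.sum_congr rfl fun i _ => ?_
  rw [coef, Int.cast_sub, sub_mul]
  congr 1 <;> split_ifs <;> simp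

theorem den_le_code (c : Comparison) (q : Set.Icc (0 : ℚ) 1) (φ : Formula A) :
    (q : ℚ).den ≤ (Formula.F c q φ).code :=
  (Nat.right_le_pair _ _).trans ((Nat.right_le_pair _ _).trans
    ((Nat.left_le_pair _ _).trans (Nat.right_le_pair _ _)))

/-- The weights of a bundle can be replaced by small positive integers. -/
theorem Proves.exists_nat {N : ℕ} {φ : Formula A} {w : Fin N → ℝ}
    {p : Fin N → Lasso (ℕ × List ℕ)} (h : Proves φ w p) {n : ℕ}
    (hn : ∀ i, ∀ y ∈ (p i).full, ∀ r ∈ y.2, r ≤ n) {K : ℕ} (hK : Linear.growth (n + 1) N ≤ K) :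
    ∃ z : Fin N → ℕ, (∀ i, z i ≤ Linear.solBound K N) ∧ Proves φ (fun i => (z i : ℝ)) p := by
  classical
  -- the inequalities say that the weights are positive and that the claims `F q ψ` are justified
  let S : Set (Bool × (Fin N → ℤ)) := {s | (∃ i, s = (true, Pi.single i 1)) ∨
    ∃ i d x c q ψ, (p i).full[d]? = some x ∧ Formula.F c q ψ ∈ claimsOf (A := A) x ∧
      s = (c.strict, fun j => coef q ψ (p i) d (p j))}
  obtain ⟨z, hz, hS⟩ := Linear.exists_int_solution K N (n + 1) S hK (by
    rintro s (⟨i, rfl⟩ | ⟨i, d, x, c, q, ψ, hx, hχ, rfl⟩) j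
    · by_cases hij : j = i
      · subst hij
        simp
      · simp [hij]
        positivity
    · refine (abs_coef_le _ _ _ _ _).trans ?_
      have h1 := hn i x (List.mem_of_getElem? hx) _ hχ
      have h2 := den_le_code c q ψ
      push_cast
      omega) (by
    refine ⟨w, ?_⟩
    rintro s (⟨i, rfl⟩ | ⟨i, d, x, c, q, ψ, hx, hχ, rfl⟩)
    · have := h.valid.w_pos i
      simp only [Pi.single_apply, Int.cast_ite, Int.cast_one, Int.cast_zero, ite_mul, one_mul,
        zero_mul, Finset.sum_ite_eq', Finset.mem_univ, if_true]
      exact ⟨this.le, fun _ => this⟩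
    · have := h.valid.claims i d x hx _ hχ
      rw [sum_coef_mul]
      exact Comparison.holds_iff.1 this)
  have hpos : ∀ i, 0 < z i := by
    intro i
    have := (hS _ (Or.inl ⟨i, rfl⟩)).2 rfl
    simpa [Pi.single_apply] using this
  have hcast : ∀ i, (((z i).toNat : ℕ) : ℝ) = (z i : ℝ) := by
    intro i
    exact_mod_cast congrArg (Int.cast (R := ℝ)) (Int.toNat_of_nonneg (hpos i).le)
  refine ⟨fun i => (z i).toNat, fun i => ?_, ⟨⟨?_, h.valid.cyc_ne, h.valid.nonbranching, ?_⟩,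
    h.nonempty, h.head⟩⟩
  · have := hz i
    rw [abs_of_pos (hpos i)] at this
    exact Int.toNat_le.2 this
  · intro i
    rw [hcast]
    exact_mod_cast hpos i
  · intro i d x hx χ hχ
    have hc := h.valid.claims i d x hx χ hχ
    cases χ with
    | atom a | natom a | and φ ψ | or φ ψ | G c q φ => exact hc
    | F c q ψ =>
      have := hS _ (Or.inr ⟨i, d, x, c, q, ψ, hx, hχ, rfl⟩)
      refine Comparison.holds_iff.2 ?_
      rw [← sum_coef_mul]
      have e : ∑ j, (coef q ψ (p i) d (p j) : ℝ) * ((z j).toNat : ℝ) =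
          ((∑ j, coef q ψ (p i) d (p j) * z j : ℤ) : ℝ) := by
        push_cast
        exact Finset.sum_congr rfl fun j _ => by rw [hcast]
      rw [e]
      exact ⟨by exact_mod_cast this.1, fun hs => by exact_mod_cast this.2 hs⟩

/-- An entry of a certificate: a weight, and the stem and the cycle of a lasso. -/
abbrev Entry := ℕ × (List (ℕ × List ℕ) × List (ℕ × List ℕ))

/-- The lasso of an entry. -/
def Entry.lasso (e : Entry) : Lasso (ℕ × List ℕ) := ⟨e.2.1, e.2.2⟩

open Classical in
/-- The weight of the entries of a list whose lasso satisfies `P`. -/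
noncomputable def listMass (l : List Entry) (P : Lasso (ℕ × List ℕ) → Prop) : ℕ :=
  (l.map fun e => if P e.lasso then e.1 else 0).sum

theorem massOf_eq_listMass (l : List Entry) (P : Lasso (ℕ × List ℕ) → Prop) :
    massOf (fun i : Fin l.length => ((l[i.1]).1 : ℝ)) (fun i => P (l[i.1]).lasso) =
      (listMass l P : ℝ) := by
  classical
  rw [massOf_eq_sum, listMass, ← Fin.sum_univ_fun_getElem, Nat.cast_sum]
  refine Finset.sum_congr rfl fun i _ => ?_
  rw [Nat.cast_ite, Nat.cast_zero]

/-- The condition `ClaimOk` in terms of the code `r` of the claimed formula. The conjuncts treat the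
six kinds of formulae, with two for `F`, according to the comparison. In the code of a bound `q`,
the first component is twice the numerator (see `ratCode_eq`). -/
def CodeOk (l : List Entry) (e : Entry) (d : ℕ) (x : ℕ × List ℕ) (r : ℕ) : Prop :=
  (r.unpair.1 = 0 → Nat.pair 1 r.unpair.2 ∉ x.2) ∧
  (r.unpair.1 = 1 → Nat.pair 0 r.unpair.2 ∉ x.2) ∧
  (r.unpair.1 = 2 → r.unpair.2.unpair.1 ∈ x.2 ∧ r.unpair.2.unpair.2 ∈ x.2) ∧
  (r.unpair.1 = 3 → r.unpair.2.unpair.1 ∈ x.2 ∨ r.unpair.2.unpair.2 ∈ x.2) ∧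
  (r.unpair.1 = 4 → r.unpair.2.unpair.1.unpair.1 = 0 →
    r.unpair.2.unpair.1.unpair.2.unpair.1 / 2 * listMass l (fun q => e.lasso.Through d q) ≤
      r.unpair.2.unpair.1.unpair.2.unpair.2 * listMass l fun q =>
        e.lasso.Through d q ∧ ∃ y ∈ q.fut d, r.unpair.2.unpair.2 ∈ y.2) ∧
  (r.unpair.1 = 4 → r.unpair.2.unpair.1.unpair.1 = 1 →
    r.unpair.2.unpair.1.unpair.2.unpair.1 / 2 * listMass l (fun q => e.lasso.Through d q) <
      r.unpair.2.unpair.1.unpair.2.unpair.2 * listMass l fun q =>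
        e.lasso.Through d q ∧ ∃ y ∈ q.fut d, r.unpair.2.unpair.2 ∈ y.2) ∧
  (r.unpair.1 = 5 → ∀ y ∈ e.lasso.fut d, r.unpair.2.unpair.2 ∈ y.2)

theorem codeOk_iff (l : List Entry) (e : Entry) (d : ℕ) (x : ℕ × List ℕ) (χ : Formula A) :
    CodeOk l e d x χ.code ↔ ClaimOk (claimsOf (A := A)) (fun i : Fin l.length => ((l[i.1]).1 : ℝ))
      (fun i => (l[i.1]).lasso) e.lasso d x χ := by
  cases χ with
  | atom a => simp [CodeOk, ClaimOk, Formula.code, claimsOf]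
  | natom a => simp [CodeOk, ClaimOk, Formula.code, claimsOf]
  | and φ ψ => simp [CodeOk, ClaimOk, Formula.code, claimsOf]
  | or φ ψ => simp [CodeOk, ClaimOk, Formula.code, claimsOf]
  | G c q φ => simp [CodeOk, ClaimOk, Formula.code, claimsOf]
  | F c q φ =>
    have h0 : (0 : ℤ) ≤ (q : ℚ).num := num_nonneg q
    have hnum : (((q : ℚ).num.toNat : ℕ) : ℝ) = ((q : ℚ).num : ℝ) := by
      exact_mod_cast congrArg (Int.cast (R := ℝ)) (Int.toNat_of_nonneg h0)
    rw [ClaimOk, Comparison.holds_iff, hitMass, passMass,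
      massOf_eq_listMass l fun q => e.lasso.Through d q ∧ ∃ y ∈ q.fut d, φ ∈ claimsOf y,
      massOf_eq_listMass l fun q => e.lasso.Through d q, ← hnum]
    cases c with
    | ge =>
      simp only [CodeOk, Formula.code, ratCode_eq, Nat.unpair_pair, Comparison.code,
        Linear.NonnegOrPos, Comparison.strict]
      simp only [OfNat.ofNat_ne_zero, OfNat.ofNat_ne_one, Nat.reduceEqDiff, false_imp_iff,
        true_imp_iff, and_true, true_and, zero_ne_one, Bool.false_eq_true, sub_nonneg,
        Nat.mul_div_cancel_left _ zero_lt_two]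
      norm_cast
    | gt =>
      simp only [CodeOk, Formula.code, ratCode_eq, Nat.unpair_pair, Comparison.code,
        Linear.NonnegOrPos, Comparison.strict]
      simp only [OfNat.ofNat_ne_zero, OfNat.ofNat_ne_one, Nat.reduceEqDiff, false_imp_iff,
        true_imp_iff, and_true, true_and, one_ne_zero, sub_nonneg, sub_pos,
        Nat.mul_div_cancel_left _ zero_lt_two]
      rw [and_iff_right_of_imp le_of_lt]
      norm_cast

/-- `l` is a certificate for the satisfiability of the formula with the code `n`: a valid bundle
with integral weights, stated in terms of codes, whose lassos have a common first element that
claims the formula. -/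
structure Certifies (l : List Entry) (n : ℕ) : Prop where
  pos : ∀ e ∈ l, 0 < e.1
  cyc_ne : ∀ e ∈ l, e.2.2 ≠ []
  nonbranching : ∀ e ∈ l, ∀ f ∈ l, e.lasso.Through e.2.1.length f.lasso → f.2 = e.2
  claims : ∀ e ∈ l, ∀ d < e.lasso.full.length, ∀ x ∈ e.lasso.full[d]?.toList, ∀ r ∈ x.2,
    CodeOk l e d x r
  head : ∃ e ∈ l, (∃ x ∈ e.lasso.full.head?.toList, n ∈ x.2) ∧
    ∀ f ∈ l, f.lasso.full.head? = e.lasso.full.head?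

theorem Certifies.proves {l : List Entry} {φ : Formula A} (h : Certifies l φ.code) :
    Proves φ (fun i : Fin l.length => ((l[i.1]).1 : ℝ)) (fun i => (l[i.1]).lasso) where
  valid :=
    { w_pos := fun i => Nat.cast_pos.2 (h.pos _ (List.getElem_mem _))
      cyc_ne := fun i => h.cyc_ne _ (List.getElem_mem _)
      nonbranching := fun i j hij => by
        have := h.nonbranching _ (List.getElem_mem i.2) _ (List.getElem_mem j.2) hij
        simp only [Entry.lasso, this]
      claims := fun i d x hx χ hχ => by
        rw [← codeOk_iff]
        refine h.claims _ (List.getElem_mem _) d ?_ x ?_ _ hχ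
        · exact (List.getElem?_eq_some_iff.1 hx).1
        · rw [hx]; simp }
  nonempty := by
    obtain ⟨e, he, -⟩ := h.head
    exact ⟨⟨0, List.length_pos_of_mem he⟩⟩
  head := by
    obtain ⟨e, -, ⟨x, hx, hn⟩, hf⟩ := h.head
    rw [Option.mem_toList] at hx
    exact ⟨x, hn, fun i => (hf _ (List.getElem_mem _)).trans hx⟩

/-- The claims of a certificate are numbers, so that for this converse of `Certifies.proves` they
must be known to be codes. -/
theorem certifies_of_proves {l : List Entry} {φ : Formula A}
    (h : Proves φ (fun i : Fin l.length => ((l[i.1]).1 : ℝ)) (fun i => (l[i.1]).lasso))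
    (hcode : ∀ e ∈ l, ∀ x ∈ e.lasso.full, ∀ r ∈ x.2, ∃ χ : Formula A, χ.code = r) :
    Certifies l φ.code where
  pos e he := by
    obtain ⟨i, hi, rfl⟩ := List.mem_iff_getElem.1 he
    exact Nat.cast_pos.1 (h.valid.w_pos ⟨i, hi⟩)
  cyc_ne e he := by
    obtain ⟨i, hi, rfl⟩ := List.mem_iff_getElem.1 he
    exact h.valid.cyc_ne ⟨i, hi⟩
  nonbranching e he f hf hef := by
    obtain ⟨i, hi, rfl⟩ := List.mem_iff_getElem.1 he
    obtain ⟨j, hj, rfl⟩ := List.mem_iff_getElem.1 hf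
    have := h.valid.nonbranching ⟨i, hi⟩ ⟨j, hj⟩ hef
    rw [Entry.lasso, Entry.lasso, Lasso.mk.injEq] at this
    exact Prod.ext this.1 this.2
  claims e he d hd x hx r hr := by
    rw [Option.mem_toList] at hx
    obtain ⟨χ, rfl⟩ := hcode e he x (List.mem_of_getElem? hx) r hr
    obtain ⟨i, hi, rfl⟩ := List.mem_iff_getElem.1 he
    rw [codeOk_iff]
    exact h.valid.claims ⟨i, hi⟩ d x hx χ hr
  head := by
    obtain ⟨x, hx, hh⟩ := h.head
    obtain ⟨i⟩ := h.nonempty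
    refine ⟨l[i.1], List.getElem_mem _, ⟨x, Option.mem_toList.2 (hh i), hx⟩, fun f hf => ?_⟩
    obtain ⟨j, hj, rfl⟩ := List.mem_iff_getElem.1 hf
    exact (hh ⟨j, hj⟩).trans (hh i).symm

/-- A satisfiable formula of the fragment has a certificate of bounded size. -/
theorem exists_certifies {φ : Formula A} (hφ : φ.InFragment) (hs : φ.Satisfiable) {n N K : ℕ}
    (hn : n = φ.code) (hN : N = (n + 2) ^ (n + 2)) (hK : K = Linear.growth (n + 1) N) :
    ∃ l : List Entry, Certifies l n ∧ l.length ≤ N ∧ ∀ e ∈ l, e.1 ≤ Linear.solBound K N ∧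
      e.2.1.length ≤ (n + 1) ^ 2 + 1 ∧ e.2.2.length ≤ (n + 1) ^ 2 + 1 ∧
      ∀ y, y ∈ e.2.1 ∨ y ∈ e.2.2 → y.1 ≤ n + 1 ∧ y.2.length ≤ n + 1 ∧ ∀ r ∈ y.2, r ≤ n := by
  obtain ⟨ι, _, w, p, hp, hcard, hlen, hcont⟩ := exists_proves hφ hs
  have hφn : φ.length ≤ n + 1 := by rw [hn]; exact length_le_code φ
  have hcardN : Fintype.card ι ≤ N := by
    rw [hN]
    have h1 : φ.length + 1 ≤ n + 2 := Nat.succ_le_succ hφn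
    exact hcard.trans ((Nat.pow_le_pow_left h1 _).trans (Nat.pow_le_pow_right (Nat.succ_pos _) h1))
  let e : Fin (Fintype.card ι) ≃ ι := (Fintype.equivFin ι).symm
  have hgrow : Linear.growth (n + 1) (Fintype.card ι) ≤ K := by
    rw [hK]
    exact Function.monotone_iterate_of_id_le (f := fun k => 2 * k ^ 2) Linear.le_two_mul_sq
      hcardN (n + 1)
  obtain ⟨z, hz, hpz⟩ := (hp.reindex e).exists_nat (n := n)
    (fun i y hy r hr => hn ▸ ((hcont (e i) y hy).2.2 r hr).1) hgrow
  let l : List Entry := List.ofFn fun i => (z i, (p (e i)).stem, (p (e i)).cyc)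
  have hl : l.length = Fintype.card ι := List.length_ofFn
  have hget : ∀ i : Fin l.length, l[i.1] =
      (z (finCongr hl i), (p (e (finCongr hl i))).stem, (p (e (finCongr hl i))).cyc) := by
    intro i
    exact List.getElem_ofFn _
  have hmem : ∀ f ∈ l, ∃ i, f = (z i, (p (e i)).stem, (p (e i)).cyc) := by
    intro f hf
    obtain ⟨i, rfl⟩ := List.mem_ofFn.1 hf
    exact ⟨i, rfl⟩
  refine ⟨l, ?_, hl.trans_le hcardN, ?_⟩
  · rw [hn]
    refine certifies_of_proves ?_ ?_
    · have := hpz.reindex (finCongr hl)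
      convert this using 1
      · funext i
        rw [hget]
        rfl
      · funext i
        rw [hget]
        rfl
    · intro f hf x hx r hr
      obtain ⟨i, rfl⟩ := hmem f hf
      exact ((hcont (e i) x hx).2.2 r hr).2
  · intro f hf
    obtain ⟨i, rfl⟩ := hmem f hf
    have h1 := hlen (e i)
    rw [Lasso.full, List.length_append] at h1
    have h2 : φ.length ^ 2 ≤ (n + 1) ^ 2 := Nat.pow_le_pow_left hφn 2
    have hmono : Monotone (Linear.solBound K) := by
      refine monotone_nat_of_le_succ fun m => ?_
      rw [Linear.solBound]
      nlinarith [Nat.one_le_iff_ne_zero.2 K.factorial_ne_zero, Nat.zero_le (Linear.solBound K m),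
        Nat.zero_le (m * K * (K.factorial * Linear.solBound K m))]
    refine ⟨(hz i).trans (hmono hcardN), ?_, ?_, ?_⟩
    · dsimp only
      omega
    · dsimp only
      omega
    · intro y hy
      obtain ⟨h3, h4, h5⟩ := hcont (e i) y (List.mem_append.2 hy)
      exact ⟨by omega, by omega, fun r hr => hn ▸ (h5 r hr).1⟩

end Extraction

/-! ### Primitive recursive recognition of the fragment -/

section Primrec

variable {α β : Type*} [Primcodable α] [Primcodable β]

theorem primrecPred_forall_mem {f : α → List β} {p : α → β → Prop} (hf : Primrec f)
    (hp : PrimrecRel p) : PrimrecPred fun a => ∀ b ∈ f a, p a b :=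
  PrimrecRel.comp (R := fun (l : List β) a => ∀ b ∈ l, p a b) hp.swap.forall_mem_list hf Primrec.id

theorem primrecPred_exists_mem {f : α → List β} {p : α → β → Prop} (hf : Primrec f)
    (hp : PrimrecRel p) : PrimrecPred fun a => ∃ b ∈ f a, p a b :=
  PrimrecRel.comp (R := fun (l : List β) a => ∃ b ∈ l, p a b) hp.swap.exists_mem_list hf Primrec.id

theorem primrecPred_imp {p q : α → Prop} (hp : PrimrecPred p) (hq : PrimrecPred q) :
    PrimrecPred fun a => p a → q a :=
  (hp.not.or hq).of_eq fun _ => imp_iff_not_or.symm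

theorem primrecPred_mem {f : α → List β} {g : α → β} (hf : Primrec f) (hg : Primrec g) :
    PrimrecPred fun a => g a ∈ f a :=
  (primrecPred_exists_mem (p := fun a b => b = g a) hf
    (Primrec.eq.comp Primrec.snd (hg.comp Primrec.fst))).of_eq fun _ => by simp

theorem primrecPred_prefix {f g : α → List β} (hf : Primrec f) (hg : Primrec g) :
    PrimrecPred fun a => f a <+: g a :=
  (Primrec.eq.comp hf (Primrec.list_take.comp (Primrec.list_length.comp hf) hg)).of_eq fun _ =>
    List.prefix_iff_eq_take.symm

theorem primrec_sum {f : α → List β} {g : α → β → ℕ} (hf : Primrec f) (hg : Primrec₂ g) :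
    Primrec fun a => ((f a).map (g a)).sum :=
  (Primrec.list_foldr (h := fun _ (q : ℕ × ℕ) => q.1 + q.2) (Primrec.list_map hf hg)
    (Primrec.const 0) ((Primrec.nat_add.comp Primrec.fst Primrec.snd).comp Primrec.snd)).of_eq
    fun _ => rfl

theorem primrec_pow {f g : α → ℕ} (hf : Primrec f) (hg : Primrec g) :
    Primrec fun a => f a ^ g a := by
  refine (Primrec.nat_iterate (h := fun a k => f a * k) hg (Primrec.const 1)
    (Primrec.nat_mul.comp (hf.comp Primrec.fst) Primrec.snd)).of_eq fun a => ?_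
  induction g a with
  | zero => rfl
  | succ n ih => rw [Function.iterate_succ_apply', ih, pow_succ']

theorem primrec_factorial {f : α → ℕ} (hf : Primrec f) : Primrec fun a => (f a).factorial := by
  refine (Primrec.nat_rec' (h := fun _ (q : ℕ × ℕ) => (q.1 + 1) * q.2) hf (Primrec.const 1)
    (Primrec.nat_mul.comp (Primrec.succ.comp (Primrec.fst.comp Primrec.snd))
      (Primrec.snd.comp Primrec.snd))).of_eq fun a => ?_
  induction f a with
  | zero => rfl
  | succ n ih => rw [Nat.factorial_succ, ← ih]

/-- Course-of-values recursion: a predicate is primitive recursive if its value at `n` is determined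
in a primitive recursive way by `n` and the list of the smaller numbers that satisfy it. -/
theorem primrecPred_of_step {p : ℕ → Prop} [DecidablePred p] {r : List ℕ → ℕ → Prop}
    (hr : PrimrecRel r) (h : ∀ n, p n ↔ r ((List.range n).filter fun k => p k) n) :
    PrimrecPred p := by
  classical
  have hlist : Primrec fun n => (List.range n).filter fun k => p k := by
    refine (Primrec.nat_rec₁ (f := fun n l => if r l n then l ++ [n] else l) []
      (Primrec.ite (PrimrecRel.comp hr Primrec.snd Primrec.fst)
        (Primrec.list_concat.comp Primrec.snd Primrec.fst) Primrec.snd)).of_eq fun n => ?_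
    induction n with
    | zero => rfl
    | succ n ih =>
      have ih' : Nat.rec (motive := fun _ => List ℕ) []
          (fun n l => if r l n then l ++ [n] else l) n = (List.range n).filter fun k => p k := ih
      change (if r (Nat.rec (motive := fun _ => List ℕ) [] _ n) n then
        Nat.rec (motive := fun _ => List ℕ) [] _ n ++ [n] else
        Nat.rec (motive := fun _ => List ℕ) [] _ n) = _
      rw [ih', List.range_succ, List.filter_append]
      by_cases hn : p n
      · simp [hn, (h n).1 hn]
      · have hn' := mt (h n).2 hn
        simp only [if_neg hn']
        simp [hn]
  exact (PrimrecRel.comp hr hlist Primrec.id).of_eq fun n => (h n).symm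

end Primrec

namespace Linear

theorem primrec_growth : Primrec₂ growth :=
  Primrec.nat_iterate Primrec.snd Primrec.fst
    (Primrec.nat_mul.comp (Primrec.const 2)
      (primrec_pow (Primrec.snd (α := ℕ × ℕ) (β := ℕ)) (Primrec.const 2)))

theorem primrec_solBound : Primrec₂ solBound := by
  have hKy : Primrec fun q : (ℕ × ℕ) × ℕ × ℕ => q.1.1.factorial * q.2.2 :=
    Primrec.nat_mul.comp (primrec_factorial (Primrec.fst.comp Primrec.fst))
      (Primrec.snd.comp Primrec.snd)
  have hNK : Primrec fun q : (ℕ × ℕ) × ℕ × ℕ => q.2.1 * q.1.1 :=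
    Primrec.nat_mul.comp (Primrec.fst.comp Primrec.snd) (Primrec.fst.comp Primrec.fst)
  have hstep : Primrec₂ fun (a : ℕ × ℕ) (q : ℕ × ℕ) =>
      2 * (q.1 * a.1 * (a.1.factorial * q.2) + 1) + 2 * (a.1.factorial * q.2) :=
    Primrec.nat_add.comp
      (Primrec.nat_mul.comp (Primrec.const 2) (Primrec.succ.comp (Primrec.nat_mul.comp hNK hKy)))
      (Primrec.nat_mul.comp (Primrec.const 2) hKy)
  refine (Primrec.nat_rec' Primrec.snd (Primrec.const 0) hstep).of_eq fun a => ?_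
  obtain ⟨K, N⟩ := a
  induction N with
  | zero => rfl
  | succ N ih =>
    rw [solBound]
    dsimp only at ih ⊢
    rw [ih]

end Linear

namespace Formula

variable {A : Type u} [Primcodable A]

/-- `k` is the code of a rational number in `[0,1]`. -/
def IsRatCode (k : ℕ) : Prop := ∃ q : Set.Icc (0 : ℚ) 1, ratCode q = k

/-- The last conjunct says that the fraction is in lowest terms. -/
theorem isRatCode_iff {k : ℕ} : IsRatCode k ↔
    k.unpair.1 % 2 = 0 ∧ 0 < k.unpair.2 ∧ k.unpair.1 / 2 ≤ k.unpair.2 ∧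
      ∀ x ∈ List.range (k.unpair.2 + 1), (k.unpair.1 / 2) % x = 0 → k.unpair.2 % x = 0 → x = 1 := by
  constructor
  · rintro ⟨q, rfl⟩
    have h0 := num_nonneg q
    have h1 := num_le_den q
    rw [ratCode_eq, Nat.unpair_pair]
    dsimp only
    rw [Nat.mul_mod_right, Nat.mul_div_cancel_left _ zero_lt_two]
    refine ⟨rfl, (q : ℚ).den_pos, by omega, fun x _ h2 h3 => ?_⟩
    have hc := (q : ℚ).reduced
    have e : (q : ℚ).num.natAbs = (q : ℚ).num.toNat := by omega
    rw [e] at hc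
    exact Nat.eq_one_of_dvd_coprimes hc (Nat.dvd_of_mod_eq_zero h2) (Nat.dvd_of_mod_eq_zero h3)
  · rintro ⟨h0, h1, h2, h3⟩
    generalize ha : k.unpair.1 / 2 = a at *
    generalize hb : k.unpair.2 = b at *
    have hcop : Nat.Coprime a b := by
      refine h3 _ (List.mem_range.2 (Nat.lt_succ_of_le (Nat.gcd_le_right _ h1))) ?_ ?_
      · exact Nat.mod_eq_zero_of_dvd (Nat.gcd_dvd_left _ _)
      · exact Nat.mod_eq_zero_of_dvd (Nat.gcd_dvd_right _ _)
    let r : ℚ := ⟨a, b, h1.ne', hcop⟩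
    have hr : r = a / b := by
      rw [← Rat.num_div_den r]
      rfl
    have hb' : (0 : ℚ) < b := by exact_mod_cast h1
    refine ⟨⟨r, ?_, ?_⟩, ?_⟩
    · rw [hr]; positivity
    · rw [hr, div_le_one hb']; exact_mod_cast h2
    · rw [ratCode_eq]
      change Nat.pair (2 * (a : ℤ).toNat) b = k
      rw [Int.toNat_natCast, ← Nat.pair_unpair k, hb]
      congr 1
      omega

theorem primrec_unpair_fst {α : Type*} [Primcodable α] {f : α → ℕ} (hf : Primrec f) :
    Primrec fun a => (f a).unpair.1 := Primrec.fst.comp (Primrec.unpair.comp hf)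

theorem primrec_unpair_snd {α : Type*} [Primcodable α] {f : α → ℕ} (hf : Primrec f) :
    Primrec fun a => (f a).unpair.2 := Primrec.snd.comp (Primrec.unpair.comp hf)

theorem primrecPred_isRatCode : PrimrecPred IsRatCode := by
  have h1 := primrec_unpair_fst (Primrec.id (α := ℕ))
  have h2 := primrec_unpair_snd (Primrec.id (α := ℕ))
  have h3 : Primrec fun k : ℕ => k.unpair.1 / 2 := Primrec.nat_div.comp h1 (Primrec.const 2)
  refine PrimrecPred.of_eq ?_ fun k => isRatCode_iff.symm
  refine (Primrec.eq.comp (Primrec.nat_mod.comp h1 (Primrec.const 2)) (Primrec.const 0)).and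
    ((Primrec.nat_lt.comp (Primrec.const 0) h2).and ((Primrec.nat_le.comp h3 h2).and ?_))
  refine primrecPred_forall_mem (Primrec.list_range.comp (Primrec.succ.comp h2)) ?_
  exact primrecPred_imp
    (Primrec.eq.comp (Primrec.nat_mod.comp (h3.comp Primrec.fst) Primrec.snd) (Primrec.const 0))
    (primrecPred_imp
      (Primrec.eq.comp (Primrec.nat_mod.comp (h2.comp Primrec.fst) Primrec.snd) (Primrec.const 0))
      (Primrec.eq.comp Primrec.snd (Primrec.const 1)))

variable (A) in
/-- `n` is the code of an inner formula. -/
def IsInnerCode (n : ℕ) : Prop := ∃ φ : Formula A, φ.code = n ∧ φ.IsInner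

variable (A) in
/-- `n` is the code of a formula of the fragment. -/
def IsFragmentCode (n : ℕ) : Prop := ∃ φ : Formula A, φ.code = n ∧ φ.InFragment

theorem lt_pair_pair_left (t a b : ℕ) : a < Nat.pair (t + 1) (Nat.pair a b) := by
  have h1 := Nat.add_le_pair (t + 1) (Nat.pair a b)
  have h2 := Nat.left_le_pair a b
  omega

theorem lt_pair_pair_right (t a b : ℕ) : b < Nat.pair (t + 1) (Nat.pair a b) := by
  have h1 := Nat.add_le_pair (t + 1) (Nat.pair a b)
  have h2 := Nat.right_le_pair a b
  omega

/-- The code of the decoration of `F_{=1}` and `G_{=1}`. -/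
def oneCode : ℕ := Nat.pair 0 (ratCode 1)

open Classical in
/-- Membership of `n` is determined by the list `l` of the smaller codes. -/
theorem isInnerCode_iff {n : ℕ} {l : List ℕ}
    (hl : l = (List.range n).filter fun k => IsInnerCode A k) : IsInnerCode A n ↔
    (n.unpair.1 ≤ 1 ∧ n.unpair.2 ∈ Set.range (Encodable.encode : A → ℕ)) ∨
    ((n.unpair.1 = 2 ∨ n.unpair.1 = 3) ∧
      n.unpair.2.unpair.1 ∈ l ∧ n.unpair.2.unpair.2 ∈ l) ∨
    ((n.unpair.1 = 4 ∨ n.unpair.1 = 5) ∧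
      n.unpair.2.unpair.1 = oneCode ∧ n.unpair.2.unpair.2 ∈ l) := by
  have hmem : ∀ k, k ∈ l ↔ k < n ∧ IsInnerCode A k := by
    intro k
    rw [hl, List.mem_filter, List.mem_range, decide_eq_true_iff]
  constructor
  · rintro ⟨φ, rfl, hφ⟩
    cases hφ with
    | atom a => left; simp [Formula.code]
    | natom a => left; simp [Formula.code]
    | @and φ ψ h₁ h₂ =>
      right; left
      simp only [Formula.code, Nat.unpair_pair, true_or, hmem, true_and]
      exact ⟨⟨lt_pair_pair_left 1 _ _, φ, rfl, h₁⟩, lt_pair_pair_right 1 _ _, ψ, rfl, h₂⟩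
    | @or φ ψ h₁ h₂ =>
      right; left
      simp only [Formula.code, Nat.unpair_pair, or_true, hmem, true_and]
      exact ⟨⟨lt_pair_pair_left 2 _ _, φ, rfl, h₁⟩, lt_pair_pair_right 2 _ _, ψ, rfl, h₂⟩
    | @F φ h =>
      right; right
      simp only [Formula.code, Nat.unpair_pair, true_or, hmem, true_and]
      exact ⟨rfl, lt_pair_pair_right 3 _ _, φ, rfl, h⟩
    | @G φ h =>
      right; right
      simp only [Formula.code, Nat.unpair_pair, or_true, hmem, true_and]
      exact ⟨rfl, lt_pair_pair_right 4 _ _, φ, rfl, h⟩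
  · have hn := Nat.pair_unpair n
    rintro (⟨h, a, ha⟩ | ⟨h, h₁, h₂⟩ | ⟨h, h₁, h₂⟩)
    · rcases Nat.le_one_iff_eq_zero_or_eq_one.1 h with h | h
      · exact ⟨.atom a, by rw [Formula.code, ha, ← h, hn], .atom a⟩
      · exact ⟨.natom a, by rw [Formula.code, ha, ← h, hn], .natom a⟩
    · obtain ⟨-, φ, hφ, hφi⟩ := (hmem _).1 h₁
      obtain ⟨-, ψ, hψ, hψi⟩ := (hmem _).1 h₂
      rcases h with h | h
      · exact ⟨.and φ ψ, by rw [Formula.code, hφ, hψ, Nat.pair_unpair, ← h, hn], .and hφi hψi⟩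
      · exact ⟨.or φ ψ, by rw [Formula.code, hφ, hψ, Nat.pair_unpair, ← h, hn], .or hφi hψi⟩
    · obtain ⟨-, φ, hφ, hφi⟩ := (hmem _).1 h₂
      rcases h with h | h
      · refine ⟨.F .ge 1 φ, ?_, .F hφi⟩
        change Nat.pair 4 (Nat.pair oneCode φ.code) = n
        rw [hφ, ← h₁, Nat.pair_unpair, ← h, hn]
      · refine ⟨.G .ge 1 φ, ?_, .G hφi⟩
        change Nat.pair 5 (Nat.pair oneCode φ.code) = n
        rw [hφ, ← h₁, Nat.pair_unpair, ← h, hn]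

open Classical in
/-- Membership of `n` is determined by the list `l` of the smaller codes. -/
theorem isFragmentCode_iff {n : ℕ} {l : List ℕ}
    (hl : l = (List.range n).filter fun k => IsFragmentCode A k) : IsFragmentCode A n ↔
    (n.unpair.1 ≤ 1 ∧ n.unpair.2 ∈ Set.range (Encodable.encode : A → ℕ)) ∨
    ((n.unpair.1 = 2 ∨ n.unpair.1 = 3) ∧
      n.unpair.2.unpair.1 ∈ l ∧ n.unpair.2.unpair.2 ∈ l) ∨
    (n.unpair.1 = 4 ∧ (n.unpair.2.unpair.1.unpair.1 ≤ 1 ∧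
      IsRatCode n.unpair.2.unpair.1.unpair.2) ∧ n.unpair.2.unpair.2 ∈ l) ∨
    (n.unpair.1 = 5 ∧ n.unpair.2.unpair.1 = oneCode ∧ IsInnerCode A n.unpair.2.unpair.2) := by
  have hmem : ∀ k, k ∈ l ↔ k < n ∧ IsFragmentCode A k := by
    intro k
    rw [hl, List.mem_filter, List.mem_range, decide_eq_true_iff]
  constructor
  · rintro ⟨φ, rfl, hφ⟩
    cases hφ with
    | atom a => left; simp [Formula.code]
    | natom a => left; simp [Formula.code]
    | @and φ ψ h₁ h₂ =>
      right; left
      simp only [Formula.code, Nat.unpair_pair, true_or, hmem, true_and]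
      exact ⟨⟨lt_pair_pair_left 1 _ _, φ, rfl, h₁⟩, lt_pair_pair_right 1 _ _, ψ, rfl, h₂⟩
    | @or φ ψ h₁ h₂ =>
      right; left
      simp only [Formula.code, Nat.unpair_pair, or_true, hmem, true_and]
      exact ⟨⟨lt_pair_pair_left 2 _ _, φ, rfl, h₁⟩, lt_pair_pair_right 2 _ _, ψ, rfl, h₂⟩
    | @F c q φ h =>
      right; right; left
      simp only [Formula.code, Nat.unpair_pair, hmem, true_and]
      refine ⟨⟨?_, q, rfl⟩, lt_pair_pair_right 3 _ _, φ, rfl, h⟩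
      cases c <;> simp [Comparison.code]
    | @G φ h =>
      right; right; right
      simp only [Formula.code, Nat.unpair_pair, true_and]
      exact ⟨rfl, φ, rfl, h⟩
  · have hn := Nat.pair_unpair n
    rintro (⟨h, a, ha⟩ | ⟨h, h₁, h₂⟩ | ⟨h, ⟨hc, q, hq⟩, h₂⟩ | ⟨h, h₁, φ, hφ, hφi⟩)
    · rcases Nat.le_one_iff_eq_zero_or_eq_one.1 h with h | h
      · exact ⟨.atom a, by rw [Formula.code, ha, ← h, hn], .atom a⟩
      · exact ⟨.natom a, by rw [Formula.code, ha, ← h, hn], .natom a⟩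
    · obtain ⟨-, φ, hφ, hφi⟩ := (hmem _).1 h₁
      obtain ⟨-, ψ, hψ, hψi⟩ := (hmem _).1 h₂
      rcases h with h | h
      · exact ⟨.and φ ψ, by rw [Formula.code, hφ, hψ, Nat.pair_unpair, ← h, hn], .and hφi hψi⟩
      · exact ⟨.or φ ψ, by rw [Formula.code, hφ, hψ, Nat.pair_unpair, ← h, hn], .or hφi hψi⟩
    · obtain ⟨-, φ, hφ, hφi⟩ := (hmem _).1 h₂
      obtain ⟨c, hc⟩ : ∃ c : Comparison, c.code = n.unpair.2.unpair.1.unpair.1 := by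
        rcases Nat.le_one_iff_eq_zero_or_eq_one.1 hc with hc | hc
        · exact ⟨.ge, hc.symm⟩
        · exact ⟨.gt, hc.symm⟩
      exact ⟨.F c q φ, by rw [Formula.code, hφ, hq, hc, Nat.pair_unpair, Nat.pair_unpair, ← h, hn],
        .F c q hφi⟩
    · refine ⟨.G .ge 1 φ, ?_, .G hφi⟩
      change Nat.pair 5 (Nat.pair oneCode φ.code) = n
      rw [hφ, ← h₁, Nat.pair_unpair, ← h, hn]

theorem primrecPred_isInnerCode : PrimrecPred (IsInnerCode A) := by
  classical
  have hn : Primrec fun a : List ℕ × ℕ => a.2 := Primrec.snd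
  have hl : Primrec fun a : List ℕ × ℕ => a.1 := Primrec.fst
  have h1 := primrec_unpair_fst hn
  have h2 := primrec_unpair_snd hn
  have h21 := primrec_unpair_fst h2
  have h22 := primrec_unpair_snd h2
  have ht : ∀ t, PrimrecPred fun a : List ℕ × ℕ => a.2.unpair.1 = t := fun t =>
    Primrec.eq.comp h1 (Primrec.const t)
  refine primrecPred_of_step (r := fun l n =>
    (n.unpair.1 ≤ 1 ∧ n.unpair.2 ∈ Set.range (Encodable.encode : A → ℕ)) ∨
    ((n.unpair.1 = 2 ∨ n.unpair.1 = 3) ∧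
      n.unpair.2.unpair.1 ∈ l ∧ n.unpair.2.unpair.2 ∈ l) ∨
    ((n.unpair.1 = 4 ∨ n.unpair.1 = 5) ∧
      n.unpair.2.unpair.1 = oneCode ∧ n.unpair.2.unpair.2 ∈ l)) ?_ fun n => isInnerCode_iff rfl
  refine PrimrecPred.or ?_ (PrimrecPred.or ?_ ?_)
  · exact (Primrec.nat_le.comp h1 (Primrec.const 1)).and (Primcodable.mem_range_encode.comp h2)
  · exact ((ht 2).or (ht 3)).and ((primrecPred_mem hl h21).and (primrecPred_mem hl h22))
  · exact ((ht 4).or (ht 5)).and ((Primrec.eq.comp h21 (Primrec.const _)).and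
      (primrecPred_mem hl h22))

theorem primrecPred_isFragmentCode : PrimrecPred (IsFragmentCode A) := by
  classical
  have hn : Primrec fun a : List ℕ × ℕ => a.2 := Primrec.snd
  have hl : Primrec fun a : List ℕ × ℕ => a.1 := Primrec.fst
  have h1 := primrec_unpair_fst hn
  have h2 := primrec_unpair_snd hn
  have h21 := primrec_unpair_fst h2
  have h22 := primrec_unpair_snd h2
  have ht : ∀ t, PrimrecPred fun a : List ℕ × ℕ => a.2.unpair.1 = t := fun t =>
    Primrec.eq.comp h1 (Primrec.const t)
  refine primrecPred_of_step (r := fun l n =>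
    (n.unpair.1 ≤ 1 ∧ n.unpair.2 ∈ Set.range (Encodable.encode : A → ℕ)) ∨
    ((n.unpair.1 = 2 ∨ n.unpair.1 = 3) ∧
      n.unpair.2.unpair.1 ∈ l ∧ n.unpair.2.unpair.2 ∈ l) ∨
    (n.unpair.1 = 4 ∧ (n.unpair.2.unpair.1.unpair.1 ≤ 1 ∧
      IsRatCode n.unpair.2.unpair.1.unpair.2) ∧ n.unpair.2.unpair.2 ∈ l) ∨
    (n.unpair.1 = 5 ∧ n.unpair.2.unpair.1 = oneCode ∧ IsInnerCode A n.unpair.2.unpair.2)) ?_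
    fun n => isFragmentCode_iff rfl
  refine PrimrecPred.or ?_ (PrimrecPred.or ?_ (PrimrecPred.or ?_ ?_))
  · exact (Primrec.nat_le.comp h1 (Primrec.const 1)).and (Primcodable.mem_range_encode.comp h2)
  · exact ((ht 2).or (ht 3)).and ((primrecPred_mem hl h21).and (primrecPred_mem hl h22))
  · exact (ht 4).and (((Primrec.nat_le.comp (primrec_unpair_fst h21) (Primrec.const 1)).and
      (primrecPred_isRatCode.comp (primrec_unpair_snd h21))).and (primrecPred_mem hl h22))
  · exact (ht 5).and ((Primrec.eq.comp h21 (Primrec.const _)).and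
      (primrecPred_isInnerCode.comp h22))

end Formula

/-! ### Search for certificates -/

namespace Extraction

open Encodable

section Check

variable {α : Type} [Primcodable α]

theorem primrec_full {e : α → Entry} (he : Primrec e) : Primrec fun a => (e a).lasso.full :=
  Primrec.list_append.comp (Primrec.fst.comp (Primrec.snd.comp he))
    (Primrec.snd.comp (Primrec.snd.comp he))

theorem primrec_fut {e : α → Entry} {d : α → ℕ} (he : Primrec e) (hd : Primrec d) :
    Primrec fun a => (e a).lasso.fut (d a) :=
  Primrec.list_append.comp (Primrec.list_drop.comp hd (Primrec.fst.comp (Primrec.snd.comp he)))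
    (Primrec.snd.comp (Primrec.snd.comp he))

theorem primrecPred_through {e f : α → Entry} {d : α → ℕ} (he : Primrec e) (hd : Primrec d)
    (hf : Primrec f) : PrimrecPred fun a => (e a).lasso.Through (d a) (f a).lasso :=
  primrecPred_prefix (Primrec.list_take.comp (Primrec.succ.comp hd) (primrec_full he))
    (primrec_full hf)

theorem primrec_listMass {f : α → List Entry} {P : α → Lasso (ℕ × List ℕ) → Prop} (hf : Primrec f)
    (hP : PrimrecPred fun q : α × Entry => P q.1 q.2.lasso) :
    Primrec fun a => listMass (f a) (P a) := by
  classical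
  exact (primrec_sum (g := fun a (e : Entry) => if P a e.lasso then e.1 else 0) hf
    (Primrec.ite hP (Primrec.fst.comp Primrec.snd) (Primrec.const 0))).of_eq fun a => by
      unfold listMass
      congr!

theorem primrecPred_codeOk {l : α → List Entry} {e : α → Entry} {d : α → ℕ} {x : α → ℕ × List ℕ}
    {r : α → ℕ} (hl : Primrec l) (he : Primrec e) (hd : Primrec d) (hx : Primrec x)
    (hr : Primrec r) : PrimrecPred fun a => CodeOk (l a) (e a) (d a) (x a) (r a) := by
  have hx2 : Primrec fun a => (x a).2 := Primrec.snd.comp hx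
  have r1 := Formula.primrec_unpair_fst hr
  have r2 := Formula.primrec_unpair_snd hr
  have r21 := Formula.primrec_unpair_fst r2
  have r22 := Formula.primrec_unpair_snd r2
  have r211 := Formula.primrec_unpair_fst r21
  have r212 := Formula.primrec_unpair_snd r21
  have hnum := Primrec.nat_div.comp (Formula.primrec_unpair_fst r212) (Primrec.const 2)
  have hden := Formula.primrec_unpair_snd r212
  have ht : ∀ t, PrimrecPred fun a => (r a).unpair.1 = t := fun t =>
    Primrec.eq.comp r1 (Primrec.const t)
  have hc : ∀ t, PrimrecPred fun a => (r a).unpair.2.unpair.1.unpair.1 = t := fun t =>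
    Primrec.eq.comp r211 (Primrec.const t)
  have hpass : PrimrecPred fun q : α × Entry => (e q.1).lasso.Through (d q.1) q.2.lasso :=
    primrecPred_through (he.comp Primrec.fst) (hd.comp Primrec.fst) Primrec.snd
  have hhit : PrimrecPred fun q : α × Entry => (e q.1).lasso.Through (d q.1) q.2.lasso ∧
      ∃ y ∈ q.2.lasso.fut (d q.1), (r q.1).unpair.2.unpair.2 ∈ y.2 :=
    hpass.and (primrecPred_exists_mem (primrec_fut Primrec.snd (hd.comp Primrec.fst))
      (primrecPred_mem (Primrec.snd.comp Primrec.snd)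
        (r22.comp (Primrec.fst.comp Primrec.fst))))
  have mpass := primrec_listMass
    (P := fun a q => (e a).lasso.Through (d a) q) hl hpass
  have mhit := primrec_listMass
    (P := fun a q => (e a).lasso.Through (d a) q ∧
      ∃ y ∈ q.fut (d a), (r a).unpair.2.unpair.2 ∈ y.2) hl hhit
  refine PrimrecPred.and ?_ (PrimrecPred.and ?_ (PrimrecPred.and ?_ (PrimrecPred.and ?_
    (PrimrecPred.and ?_ (PrimrecPred.and ?_ ?_)))))
  · exact primrecPred_imp (ht 0)
      (primrecPred_mem hx2 (Primrec₂.natPair.comp (Primrec.const 1) r2)).not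
  · exact primrecPred_imp (ht 1)
      (primrecPred_mem hx2 (Primrec₂.natPair.comp (Primrec.const 0) r2)).not
  · exact primrecPred_imp (ht 2) ((primrecPred_mem hx2 r21).and (primrecPred_mem hx2 r22))
  · exact primrecPred_imp (ht 3) ((primrecPred_mem hx2 r21).or (primrecPred_mem hx2 r22))
  · exact primrecPred_imp (ht 4) (primrecPred_imp (hc 0) (Primrec.nat_le.comp
      (Primrec.nat_mul.comp hnum mpass) (Primrec.nat_mul.comp hden mhit)))
  · exact primrecPred_imp (ht 4) (primrecPred_imp (hc 1) (Primrec.nat_lt.comp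
      (Primrec.nat_mul.comp hnum mpass) (Primrec.nat_mul.comp hden mhit)))
  · exact primrecPred_imp (ht 5) (primrecPred_forall_mem (primrec_fut he hd)
      (primrecPred_mem (Primrec.snd.comp Primrec.snd) (r22.comp Primrec.fst)))

theorem primrecPred_certifies {l : α → List Entry} {n : α → ℕ} (hl : Primrec l) (hn : Primrec n) :
    PrimrecPred fun a => Certifies (l a) (n a) := by
  have h1 : PrimrecPred fun a => ∀ e ∈ l a, 0 < e.1 :=
    primrecPred_forall_mem hl (Primrec.nat_lt.comp (Primrec.const 0)
      (Primrec.fst.comp Primrec.snd))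
  have h2 : PrimrecPred fun a => ∀ e ∈ l a, e.2.2 ≠ [] :=
    primrecPred_forall_mem hl (Primrec.eq.comp
      (Primrec.snd.comp (Primrec.snd.comp Primrec.snd)) (Primrec.const [])).not
  have h3 : PrimrecPred fun a => ∀ e ∈ l a, ∀ f ∈ l a,
      e.lasso.Through e.2.1.length f.lasso → f.2 = e.2 := by
    refine primrecPred_forall_mem hl (primrecPred_forall_mem (hl.comp Primrec.fst) ?_)
    have he : Primrec fun q : (α × Entry) × Entry => q.1.2 := Primrec.snd.comp Primrec.fst
    exact primrecPred_imp
      (primrecPred_through he (Primrec.list_length.comp (Primrec.fst.comp (Primrec.snd.comp he)))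
        Primrec.snd)
      (Primrec.eq.comp (Primrec.snd.comp Primrec.snd) (Primrec.snd.comp he))
  have h4 : PrimrecPred fun a => ∀ e ∈ l a, ∀ d ∈ List.range e.lasso.full.length,
      ∀ x ∈ e.lasso.full[d]?.toList, ∀ r ∈ x.2, CodeOk (l a) e d x r := by
    refine primrecPred_forall_mem hl (primrecPred_forall_mem
      (Primrec.list_range.comp (Primrec.list_length.comp (primrec_full Primrec.snd)))
      (primrecPred_forall_mem (Primrec.optionToList.comp (Primrec.list_getElem?.comp
        (primrec_full (Primrec.snd.comp Primrec.fst)) Primrec.snd))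
        (primrecPred_forall_mem (Primrec.snd.comp Primrec.snd) ?_)))
    exact primrecPred_codeOk
      (hl.comp (Primrec.fst.comp (Primrec.fst.comp (Primrec.fst.comp Primrec.fst))))
      (Primrec.snd.comp (Primrec.fst.comp (Primrec.fst.comp Primrec.fst)))
      (Primrec.snd.comp (Primrec.fst.comp Primrec.fst)) (Primrec.snd.comp Primrec.fst) Primrec.snd
  have h5 : PrimrecPred fun a => ∃ e ∈ l a, (∃ x ∈ e.lasso.full.head?.toList, n a ∈ x.2) ∧
      ∀ f ∈ l a, f.lasso.full.head? = e.lasso.full.head? := by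
    refine primrecPred_exists_mem hl (PrimrecPred.and ?_ ?_)
    · exact primrecPred_exists_mem
        (Primrec.optionToList.comp (Primrec.list_head?.comp (primrec_full Primrec.snd)))
        (primrecPred_mem (Primrec.snd.comp Primrec.snd) (hn.comp (Primrec.fst.comp Primrec.fst)))
    · exact primrecPred_forall_mem (hl.comp Primrec.fst) (Primrec.eq.comp
        (Primrec.list_head?.comp (primrec_full Primrec.snd))
        (Primrec.list_head?.comp (primrec_full (Primrec.snd.comp Primrec.fst))))
  refine (h1.and (h2.and (h3.and (h4.and h5)))).of_eq fun a => ?_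
  constructor
  · rintro ⟨h1, h2, h3, h4, h5⟩
    exact ⟨h1, h2, h3, fun e he d hd => h4 e he d (List.mem_range.2 hd), h5⟩
  · rintro ⟨h1, h2, h3, h4, h5⟩
    exact ⟨h1, h2, h3, fun e he d hd => h4 e he d (List.mem_range.1 hd), h5⟩

end Check

theorem pair_le_pair {a b c d : ℕ} (h₁ : a ≤ c) (h₂ : b ≤ d) : Nat.pair a b ≤ Nat.pair c d := by
  refine le_trans (b := Nat.pair c b) ?_ ?_
  · rcases h₁.eq_or_lt with rfl | h
    · exact le_rfl
    · exact (Nat.pair_lt_pair_left b h).le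
  · rcases h₂.eq_or_lt with rfl | h
    · exact le_rfl
    · exact (Nat.pair_lt_pair_right c h).le

/-- A bound on the codes of the lists of length at most `L` with entries of code at most `K`. -/
def listBound (L K : ℕ) : ℕ := (fun c => Nat.pair K c + 1)^[L] 0

theorem encode_list_le {α : Type} [Primcodable α] {L K : ℕ} {l : List α} (hL : l.length ≤ L)
    (hK : ∀ x ∈ l, encode x ≤ K) : encode l ≤ listBound L K := by
  induction l generalizing L with
  | nil => exact Nat.zero_le _
  | cons a l ih =>
    obtain ⟨L, rfl⟩ : ∃ L', L = L' + 1 := ⟨L - 1, by rw [List.length_cons] at hL; omega⟩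
    rw [listBound, Function.iterate_succ_apply']
    change (Nat.pair (encode a) (encode l)).succ ≤ _
    refine Nat.succ_le_succ (pair_le_pair (hK a List.mem_cons_self) ?_)
    exact ih (Nat.le_of_succ_le_succ hL) fun x hx => hK x (List.mem_cons_of_mem _ hx)

theorem primrec_listBound {α : Type} [Primcodable α] {f g : α → ℕ} (hf : Primrec f)
    (hg : Primrec g) : Primrec fun a => listBound (f a) (g a) :=
  Primrec.nat_iterate hf (Primrec.const 0)
    (Primrec.succ.comp (Primrec₂.natPair.comp (hg.comp Primrec.fst) Primrec.snd))

/-- A bound on the number of the entries of a certificate for the formula with the code `n`. -/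
def entryCount (n : ℕ) : ℕ := (n + 2) ^ (n + 2)

/-- A bound on the weights in a certificate for the formula with the code `n`. -/
def weightBound (n : ℕ) : ℕ :=
  Linear.solBound (Linear.growth (n + 1) (entryCount n)) (entryCount n)

/-- A bound on the codes of the stems and cycles in a certificate for the formula with the
code `n`. -/
def pathBound (n : ℕ) : ℕ :=
  listBound ((n + 1) ^ 2 + 1) (Nat.pair (n + 1) (listBound (n + 1) n))

/-- A bound on the code of a certificate for the formula with the code `n`. -/
def certBound (n : ℕ) : ℕ :=
  listBound (entryCount n) (Nat.pair (weightBound n) (Nat.pair (pathBound n) (pathBound n)))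

theorem primrec_certBound : Primrec certBound := by
  have h1 : Primrec fun n : ℕ => n + 1 := Primrec.succ
  have h2 : Primrec fun n : ℕ => n + 2 := Primrec.succ.comp Primrec.succ
  have hN : Primrec entryCount := primrec_pow h2 h2
  have hw : Primrec weightBound :=
    Linear.primrec_solBound.comp (Linear.primrec_growth.comp h1 hN) hN
  have hp : Primrec pathBound :=
    primrec_listBound (Primrec.succ.comp (primrec_pow h1 (Primrec.const 2)))
      (Primrec₂.natPair.comp h1 (primrec_listBound h1 Primrec.id))
  exact primrec_listBound hN (Primrec₂.natPair.comp hw (Primrec₂.natPair.comp hp hp))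

variable {A : Type u} [Primcodable A]

/-- A satisfiable formula of the fragment has a certificate whose code is bounded in terms of the
code of the formula. -/
theorem exists_encode_le {φ : Formula A} (hφ : φ.InFragment) (hs : φ.Satisfiable) :
    ∃ l : List Entry, Certifies l φ.code ∧ encode l ≤ certBound φ.code := by
  obtain ⟨l, hl, hlen, hcont⟩ := exists_certifies hφ hs rfl rfl rfl
  refine ⟨l, hl, encode_list_le hlen fun e he => ?_⟩
  obtain ⟨h1, h2, h3, h4⟩ := hcont e he
  have helt : ∀ y, y ∈ e.2.1 ∨ y ∈ e.2.2 →
      encode y ≤ Nat.pair (φ.code + 1) (listBound (φ.code + 1) φ.code) := by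
    intro y hy
    obtain ⟨h5, h6, h7⟩ := h4 y hy
    exact pair_le_pair h5 (encode_list_le h6 h7)
  exact pair_le_pair h1 (pair_le_pair (encode_list_le h2 fun y hy => helt y (Or.inl hy))
    (encode_list_le h3 fun y hy => helt y (Or.inr hy)))

theorem Certifies.satisfiable {l : List Entry} {φ : Formula A} (h : Certifies l φ.code)
    (hφ : φ.InFragment) : φ.Satisfiable := by
  obtain ⟨M, hM, -⟩ := h.proves.exists_model hφ
    (L := Finset.univ.sup fun i : Fin l.length => (l[i.1]).lasso.full.length)
    fun i => (Finset.le_sup (f := fun i : Fin l.length => (l[i.1]).lasso.full.length)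
      (Finset.mem_univ i)).trans (Nat.le_succ _)
  exact ⟨M, hM⟩

theorem decidableOnFragment_satisfiable :
    DecidableOnFragment (Formula.Satisfiable (A := A)) := by
  have h : PrimrecPred fun n : ℕ => Formula.IsFragmentCode A n ∧
      ∃ c ∈ List.range (certBound n + 1), ∃ l ∈ (decode (α := List Entry) c).toList,
        Certifies l n := by
    refine Formula.primrecPred_isFragmentCode.and (primrecPred_exists_mem
      (Primrec.list_range.comp (Primrec.succ.comp primrec_certBound))
      (primrecPred_exists_mem (β := List Entry)
        (Primrec.optionToList.comp (Primrec.decode.comp Primrec.snd)) ?_))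
    exact primrecPred_certifies Primrec.snd (Primrec.fst.comp Primrec.fst)
  refine (h.of_eq fun n => ?_).computablePred
  constructor
  · rintro ⟨⟨φ, rfl, hφ⟩, c, -, l, -, hl⟩
    exact ⟨φ, rfl, hφ, hl.satisfiable hφ⟩
  · rintro ⟨φ, rfl, hφ, hs⟩
    obtain ⟨l, hl, hle⟩ := exists_encode_le hφ hs
    refine ⟨⟨φ, rfl, hφ⟩, encode l, List.mem_range.2 (Nat.lt_succ_of_le hle), l, ?_, hl⟩
    exact Option.mem_toList.2 (encodek l)

/-- A bound on the number of states of a model, in terms of the length of the formula. -/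
def stateBound (n : ℕ) : ℕ := (n + 1) ^ (n + 1) * (n ^ 2 + 1)

theorem computable_stateBound : Computable stateBound := by
  have h1 : Primrec fun n : ℕ => n + 1 := Primrec.succ
  exact (Primrec.nat_mul.comp (primrec_pow h1 h1)
    (Primrec.succ.comp (primrec_pow Primrec.id (Primrec.const 2)))).to_comp

theorem exists_small_model {φ : Formula A} (hφ : φ.InFragment) (hs : φ.Satisfiable) :
    ∃ M : MarkovChain A, φ.Sat M M.init ∧ (∃ h ≤ φ.length ^ 2, M.HasHeight h) ∧ Finite M.S ∧
      Nat.card M.S ≤ stateBound φ.length := by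
  obtain ⟨ι, _, w, p, hp, hcard, hlen, -⟩ := exists_proves hφ hs
  obtain ⟨M, hM, hh, hfin, hc⟩ := hp.exists_model hφ hlen
  exact ⟨M, hM, hh, hfin, hc.trans (Nat.mul_le_mul_right _ hcard)⟩

theorem satisfiable_iff_finitelySatisfiable {φ : Formula A} (hφ : φ.InFragment) :
    φ.Satisfiable ↔ φ.FinitelySatisfiable := by
  constructor
  · intro hs
    obtain ⟨M, hM, -, hfin, -⟩ := exists_small_model hφ hs
    exact ⟨M, hfin, hM⟩
  · rintro ⟨M, -, hM⟩
    exact ⟨M, hM⟩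

end Extraction

end PCTL

theorem mainTheorem6 {A : Type*} [Primcodable A] :
    (∃ f : ℕ → ℕ, Computable f ∧
      ∀ φ : PCTL.Formula A, φ.InFragment → φ.Satisfiable →
        ∃ M : PCTL.MarkovChain A, φ.Sat M M.init ∧
          (∃ h : ℕ, h ≤ φ.length ^ 2 ∧ M.HasHeight h) ∧
          Finite M.S ∧ Nat.card M.S ≤ f φ.length) ∧
    (∀ φ : PCTL.Formula A, φ.InFragment → (φ.Satisfiable ↔ φ.FinitelySatisfiable)) ∧
    PCTL.DecidableOnFragment (PCTL.Formula.Satisfiable (A := A)) ∧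
    PCTL.DecidableOnFragment (PCTL.Formula.FinitelySatisfiable (A := A)) := by
  refine ⟨⟨PCTL.Extraction.stateBound, PCTL.Extraction.computable_stateBound, fun φ hφ hs =>
    PCTL.Extraction.exists_small_model hφ hs⟩,
    fun φ hφ => PCTL.Extraction.satisfiable_iff_finitelySatisfiable hφ,
    PCTL.Extraction.decidableOnFragment_satisfiable, ?_⟩
  refine ComputablePred.of_eq (PCTL.Extraction.decidableOnFragment_satisfiable (A := A)) fun n => ?_
  refine exists_congr fun φ => and_congr_right fun _ => and_congr_right fun hφ => ?_
  exact PCTL.Extraction.satisfiable_iff_finitelySatisfiable hφ
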